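/- **Evolution of a sharp front.** Let $\alpha\in(0,1)$, $K(x)=|x|^{-1-\alpha}$ on $\mathbb R^2$, $\binom ab^\perp=\binom{-b}{a}$, $\nabla^\perp=\binom{-\partial_{x^2}}{\partial_{x^1}}$, $\mathbb T=\mathbb R/\mathbb Z$ with fundamental domain $[-1/2,1/2)$. *Weak solutions.* Let $T>0$. A function $\theta\in L^2(0,T;L^2(\mathbb R^2))$ is a weak solution on $(0,T)$ of $$\partial_t\theta+u\cdot\nabla\theta=0,\qquad u=\nabla^\perp K*\theta,$$ if the distribution $u=\nabla^\perp(K*\theta)$ on $(0,T)\times\mathbb R^2$ is a locally integrable function (for instance $u\in L^2(0,T;L^2(\mathbb R^2;\mathbb R^2))$) and $$\int_0^T\!\!\int_{\mathbb R^2}\theta\,\partial_t\phi+\theta\,u\cdot\nabla\phi\;dx\,dt=0\qquad\text{for all }\phi\in C_c^\infty((0,T)\times\mathbb R^2).$$ *Sharp fronts.* A weak solution $\theta$ on $(0,T)$ is a sharp-front solution if for every $t\in(0,T)$ there is a bounded, simply connected, closed set $A(t)\subset\mathbb R^2$ with $\theta(\cdot,t)=\mathbf 1_{A(t)}$, and the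 boundaries $\partial A(t)$ admit a parametrisation $w(\cdot,t):\mathbb T\to\mathbb R^2$ that is, for each $t$, a regular ($\partial_sw\neq0$), simple, anti-clockwise ($A(t)$ lies locally to the left) $C^2$ parametrisation, and such that $w,\partial_tw,\partial_sw,\partial_s^2w$ are continuous on $\mathbb T\times(0,T)$. **Proposition.** Let $\theta=\mathbf 1_A$ be a sharp-front solution on $(0,T)$, and for each $t\in(0,T)$ let $z(\cdot,t):\mathbb T\to\mathbb R^2$ be a simple anti-clockwise $C^2$ parametrisation of $\partial A(t)$ of uniform speed, i.e. $|\partial_sz(s,t)|=L(t)>0$ for all $s$. Put $N=(\partial_sz)^\perp$. Then for all $t\in(0,T)$ and $s\in\mathbb T$ the integral $$\mathcal I(z)(s,t)=\int_{\mathbb T}K\big(z(s,t)-z(s_*,t)\big)\big(\partial_sz(s_*,t)-\partial_sz(s,t)\big)\,ds_*$$ converges absolutely, and at every $(s,t)$ at which the time derivative $\partial_tz(s,t)$ exists, $$\partial_tz\cdot N=-\,\mathcal I(z)\cdot N .$$ -/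

import Mathlib

open Set MeasureTheory Filter Topology
open scoped ContDiff

noncomputable section

namespace SharpFront

/-- The Euclidean plane. -/
abbrev Plane : Type := EuclideanSpace ℝ (Fin 2)

/-- Counter-clockwise rotation by a right angle, `(a, b)^⊥ = (-b, a)`. -/
def perp (v : Plane) : Plane := !₂[-(v 1), v 0]

/-- The kernel `K(x) = |x|^(-1-α)`. -/
def kernel (α : ℝ) (x : Plane) : ℝ := ‖x‖ ^ (-1 - α)

/-- The potential `K * f`, that is `Λ^(-1+α) f` with the constant normalised to one. -/
def potential (α : ℝ) (f : Plane → ℝ) (x : Plane) : ℝ := ∫ y, kernel α (x - y) * f y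

/-- Test functions: real `C^∞` functions with compact support in `(0,T) × ℝ²`. -/
structure IsTestFunction (T : ℝ) (φ : ℝ × Plane → ℝ) : Prop where
  smooth : ContDiff ℝ ∞ φ
  hasCompactSupport : HasCompactSupport φ
  tsupport_subset : tsupport φ ⊆ Ioo 0 T ×ˢ univ

/-- The time derivative `∂_t φ(t,x)`. -/
def timeDeriv (φ : ℝ × Plane → ℝ) (t : ℝ) (x : Plane) : ℝ := deriv (fun τ => φ (τ, x)) t

/-- The spatial gradient `∇φ(t,x)`. -/
def spaceGrad (φ : ℝ × Plane → ℝ) (t : ℝ) (x : Plane) : Plane := gradient (fun y => φ (t, y)) x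

/-- `u = ∇^⊥ K * θ` on `(0,T) × ℝ²`. The kernel `∇^⊥ K` is not locally integrable, so this is the
statement that `u` is a locally integrable function which is the distributional perpendicular
gradient `∇^⊥ (K * θ)` of the potential of `θ`. -/
structure IsVelocity (α T : ℝ) (θ : ℝ → Plane → ℝ) (u : ℝ → Plane → Plane) : Prop where
  locallyIntegrable :
    LocallyIntegrableOn (fun p : ℝ × Plane => u p.1 p.2) (Ioo 0 T ×ˢ univ) volume
  weak_perp_grad : ∀ ψ : ℝ × Plane → ℝ, IsTestFunction T ψ →
    ∫ t in Ioo 0 T, ∫ x, ψ (t, x) • u t x =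
      -∫ t in Ioo 0 T, ∫ x, potential α (θ t) x • perp (spaceGrad ψ t x)

/-- `θ` is a weak solution on `(0,T)` of `∂_t θ + u · ∇θ = 0`, `u = ∇^⊥ K * θ`. -/
structure IsWeakSolution (α T : ℝ) (θ : ℝ → Plane → ℝ) : Prop where
  pos : 0 < T
  memLp : MemLp (fun p : ℝ × Plane => θ p.1 p.2) 2
    (((volume : Measure ℝ).restrict (Ioo 0 T)).prod (volume : Measure Plane))
  exists_velocity : ∃ u : ℝ → Plane → Plane, IsVelocity α T θ u ∧
    ∀ φ : ℝ × Plane → ℝ, IsTestFunction T φ →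
      ∫ t in Ioo 0 T, ∫ x,
        (θ t x * timeDeriv φ t x + θ t x * inner ℝ (u t x) (spaceGrad φ t x)) = 0

/-- `γ`, a function of period one, is a regular `C²` parametrisation over `𝕋 = ℝ/ℤ`, simple and
anti-clockwise (`A` lies locally to the left of `γ`), of the boundary of `A`. -/
structure IsBoundaryParam (A : Set Plane) (γ : ℝ → Plane) : Prop where
  contDiff : ContDiff ℝ 2 γ
  periodic : Function.Periodic γ 1
  injOn : InjOn γ (Ico 0 1)
  deriv_ne_zero : ∀ s, deriv γ s ≠ 0
  range_eq : range γ = frontier A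
  left : ∀ s, ∀ᶠ r : ℝ in 𝓝[>] 0,
    γ s + r • perp (deriv γ s) ∈ interior A ∧ γ s - r • perp (deriv γ s) ∉ A

/-- A boundary parametrisation of constant speed; the constant is then the length of the curve. -/
structure IsUniformSpeedParam (A : Set Plane) (γ : ℝ → Plane) : Prop
    extends IsBoundaryParam A γ where
  uniform_speed : ∃ L : ℝ, ∀ s, ‖deriv γ s‖ = L

/-- The moving boundary `∂A(t)`, `t ∈ (0,T)`, is parametrised anti-clockwise by `w = w(t,s)`,
where `w, ∂_t w, ∂_s w, ∂_s² w` exist and are continuous in `(t,s)`. -/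
structure IsFrontParam (T : ℝ) (A : ℝ → Set Plane) (w : ℝ → ℝ → Plane) : Prop where
  param : ∀ t ∈ Ioo 0 T, IsBoundaryParam (A t) (w t)
  contDiffOn : ContDiffOn ℝ 1 (fun p : ℝ × ℝ => w p.1 p.2) (Ioo 0 T ×ˢ univ)
  continuousOn : ContinuousOn (fun p : ℝ × ℝ => iteratedDeriv 2 (w p.1) p.2) (Ioo 0 T ×ˢ univ)

/-- `θ = 1_A` is a sharp-front solution on `(0,T)`. -/
structure IsSharpFront (α T : ℝ) (A : ℝ → Set Plane) (θ : ℝ → Plane → ℝ) : Prop where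
  weakSolution : IsWeakSolution α T θ
  isClosed : ∀ t ∈ Ioo 0 T, IsClosed (A t)
  isBounded : ∀ t ∈ Ioo 0 T, Bornology.IsBounded (A t)
  simplyConnected : ∀ t ∈ Ioo 0 T, SimplyConnectedSpace (A t)
  exists_param : ∃ w : ℝ → ℝ → Plane, IsFrontParam T A w
  eq_indicator : ∀ t ∈ Ioo 0 T, θ t = (A t).indicator (fun _ => 1)

/-- The integrand `K(z - z_*) (∂_s z_* - ∂_s z)`, with `z = γ(s)` and `z_* = γ(s')`. -/
def cdeIntegrand (α : ℝ) (γ : ℝ → Plane) (s s' : ℝ) : Plane :=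
  kernel α (γ s - γ s') • (deriv γ s' - deriv γ s)

/-- `I(z)(s) = ∫_𝕋 K(z - z_*) (∂_s z_* - ∂_s z) ds_*`. -/
def cdeIntegral (α : ℝ) (γ : ℝ → Plane) (s : ℝ) : Plane :=
  ∫ s' in (-1 / 2 : ℝ)..(1 / 2), cdeIntegrand α γ s s'

end SharpFront

end

/-!
The equation is a pointwise consequence of the weak formulation, obtained by rewriting both of its
terms as integrals over the moving curve.

* *Boundary measures.* For a region `A` bounded by `γ`, the distributional gradient of `1_A` is the
  measure `(∂_s γ)^⊥ ds` on the curve (`IsBoundaryParam.green`). Near a boundary point the chart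
  `(s, r) ↦ γ(s) + r n`, with a constant vector `n`, flattens the boundary; the hypothesis that `A`
  lies to the left decides which side of the chart is `A`, and a partition of unity concludes.

* *Time term.* For test functions `g(t) β(x)` with `β = ∂₀ G` (coordinates are numbered `0` and
  `1`), the integral of `1_A g' β` is by the divergence theorem an integral over the curve. It
  becomes `∫∫ g β(w) ∂_t w · (∂_s w)^⊥ ds dt` since `∫∫ d(g G(w)) ∧ d(w₁) = 0`
  (`IsFront.integral_time`). As `w` is only `C¹` in `(t, s)`, the latter is proved with difference
  quotients.

* *Flux term.* The velocity `u` is known only as the distribution `∇^⊥ V`, where `V = K * 1_A` is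
  continuous in space and time (`IsFront.continuous_potential`). The function `θ ∇φ` is not an
  admissible test function, but it is one after `θ` has been mollified. Integrating against `V`, the
  derivatives of the mollified `θ` converge to the boundary measure, and what remains is
  `∫∫ V(w) ∂_s (φ(t, w)) ds dt` (`IsVelocity.integral_flux`).

* *Tangential derivative of the potential.* Along the curve, `V` has the weak derivative
  `-∫ K(γ - γ_*) ∂_s γ_* · (∂_s γ)^⊥ ds_*` (`IsBoundaryParam.integral_potential_mul_deriv`). This is
  immediate for a smooth kernel. The regularisation `k_δ → (1 - α) K` used here is a divergence, so
  that the regularised potential is itself a boundary integral, which gives the continuity of `V`.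
  The singular integral converges because `∂_s γ` is Lipschitz and the curve satisfies a chord-arc
  estimate, while the term `∂_s γ · (∂_s γ)^⊥` that is subtracted vanishes.

Together these give the weak form of `∂_t w · N + ∫ K(w - w_*) ∂_s w_* · N ds_* = 0`. Both terms are
continuous, and a front has no self-intersections, so that test functions of `(t, x)` localise in
`(t, s)` and the identity holds pointwise. Finally, the normal velocity of a point carried by the
front does not depend on the parametrisation (`IsFront.inner_velocity_eq`), and neither does the
singular integral, whose regularisations are integrals over `A` (`circ_eq_circ`). This transfers the
identity from `w` to `z`, for which no regularity in time is assumed beyond the existence of the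
derivative in question.
-/

noncomputable section

namespace SharpFront

/-! ### The plane in coordinates -/

@[simp] theorem perp_apply_zero (v : Plane) : perp v 0 = -(v 1) := by simp [perp]

@[simp] theorem perp_apply_one (v : Plane) : perp v 1 = v 0 := by simp [perp]

theorem inner_plane (v w : Plane) : inner ℝ v w = v 0 * w 0 + v 1 * w 1 := by
  simp [PiLp.inner_apply, Fin.sum_univ_two, mul_comm]

theorem norm_sq_plane (v : Plane) : ‖v‖ ^ 2 = v 0 ^ 2 + v 1 ^ 2 := by
  rw [← real_inner_self_eq_norm_sq, inner_plane]; ring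

theorem perp_ne_zero {v : Plane} (hv : v ≠ 0) : perp v ≠ 0 := by
  intro h
  apply hv
  have h0 : perp v 0 = 0 := by rw [h]; rfl
  have h1 : perp v 1 = 0 := by rw [h]; rfl
  rw [perp_apply_zero, neg_eq_zero] at h0
  rw [perp_apply_one] at h1
  ext i
  fin_cases i
  · exact h1
  · exact h0

theorem inner_perp_perp (v w : Plane) : inner ℝ (perp v) (perp w) = inner ℝ v w := by
  simp [inner_plane]; ring

theorem inner_perp_self (v : Plane) : inner ℝ (perp v) v = 0 := by
  simp [inner_plane]; ring

theorem continuous_perp : Continuous perp := by unfold perp; fun_prop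

theorem norm_perp (v : Plane) : ‖perp v‖ = ‖v‖ := by
  rw [← sq_eq_sq₀ (norm_nonneg _) (norm_nonneg _), norm_sq_plane, norm_sq_plane]
  simp; ring

theorem perp_perp (v : Plane) : perp (perp v) = -v := by
  ext i
  fin_cases i <;> simp

theorem perp_eq_smul_perp {x y : Plane} (hy : y ≠ 0) (h : inner ℝ x (perp y) = 0) :
    ∃ c : ℝ, perp x = c • perp y := by
  have hn : y 0 * y 0 + y 1 * y 1 ≠ 0 := fun hh => hy (by
    have h0 : y 0 = 0 := by nlinarith [mul_self_nonneg (y 0), mul_self_nonneg (y 1)]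
    have h1 : y 1 = 0 := by nlinarith [mul_self_nonneg (y 0), mul_self_nonneg (y 1)]
    ext i
    fin_cases i <;> simp [h0, h1])
  rw [inner_plane, perp_apply_zero, perp_apply_one] at h
  obtain ⟨c, hc⟩ : ∃ c : ℝ, c * (y 0 * y 0 + y 1 * y 1) = x 0 * y 0 + x 1 * y 1 :=
    ⟨_, div_mul_cancel₀ _ hn⟩
  have e1 : x 1 = c * y 1 := mul_right_cancel₀ hn (by linear_combination y 0 * h - y 1 * hc)
  have e0 : x 0 = c * y 0 := mul_right_cancel₀ hn (by linear_combination -y 1 * h - y 0 * hc)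
  refine ⟨c, ?_⟩
  ext i
  fin_cases i <;> simp [e0, e1]

/-- The coordinates of a point of the plane, as a measurable equivalence. -/
def planeEquiv : Plane ≃ᵐ ℝ × ℝ :=
  (MeasurableEquiv.toLp 2 (Fin 2 → ℝ)).symm.trans MeasurableEquiv.finTwoArrow

theorem planeEquiv_apply (q : Plane) : planeEquiv q = (q 0, q 1) := rfl

theorem planeEquiv_measurePreserving : MeasurePreserving planeEquiv volume volume :=
  (EuclideanSpace.volume_preserving_symm_measurableEquiv_toLp (Fin 2)).trans
    (volume_preserving_finTwoArrow ℝ)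

/-- The linear map of the plane whose columns are `a` and `b`. -/
def columns (a b : Plane) : Plane →L[ℝ] Plane :=
  (EuclideanSpace.proj (0 : Fin 2) : Plane →L[ℝ] ℝ).smulRight a +
    (EuclideanSpace.proj (1 : Fin 2) : Plane →L[ℝ] ℝ).smulRight b

theorem columns_apply (a b v : Plane) : columns a b v = v 0 • a + v 1 • b := rfl

theorem det_columns (a b : Plane) : (columns a b).det = inner ℝ (perp a) b := by
  have : ((columns a b : Plane →L[ℝ] Plane) : Plane →ₗ[ℝ] Plane) =
      Matrix.toLin (EuclideanSpace.basisFun (Fin 2) ℝ).toBasis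
        (EuclideanSpace.basisFun (Fin 2) ℝ).toBasis !![a 0, b 0; a 1, b 1] := by
    apply (EuclideanSpace.basisFun (Fin 2) ℝ).toBasis.ext
    intro i
    rw [Matrix.toLin_self]
    ext j
    fin_cases i <;> fin_cases j <;> simp [columns_apply]
  rw [ContinuousLinearMap.det, this, LinearMap.det_toLin, Matrix.det_fin_two_of, inner_plane]
  simp
  ring

/-- A closed bounded set is contained in every ball that contains its boundary: a ray to infinity
would otherwise leave the set without crossing the boundary. -/
theorem norm_le_of_frontier {A : Set Plane} (hb : Bornology.IsBounded A) {R : ℝ}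
    (hR : ∀ x ∈ frontier A, ‖x‖ ≤ R) {x : Plane} (hx : x ∈ A) (hx0 : x ≠ 0) : ‖x‖ ≤ R := by
  by_contra! hlt
  obtain ⟨M, hM⟩ := hb.exists_norm_le
  have hxpos : 0 < ‖x‖ := norm_pos_iff.2 hx0
  let ray : Set Plane := (fun l : ℝ => l • x) '' Ici 1
  have hray : IsPreconnected ray :=
    isPreconnected_Ici.image _ (by fun_prop)
  have h1 : (ray ∩ A).Nonempty := ⟨x, ⟨1, by simp, by simp⟩, hx⟩
  have h2 : (ray ∩ Aᶜ).Nonempty := by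
    have hM0 : 0 ≤ M := (norm_nonneg x).trans (hM x hx)
    refine ⟨(1 + (M + 1) / ‖x‖) • x, ⟨_, ?_, rfl⟩, fun h => ?_⟩
    · have : 0 ≤ (M + 1) / ‖x‖ := by positivity
      simpa using this
    · have := hM _ h
      rw [norm_smul, Real.norm_of_nonneg (by positivity), add_mul,
          div_mul_cancel₀ _ hxpos.ne'] at this
      linarith
  rcases Set.eq_empty_or_nonempty (ray ∩ frontier A) with h | ⟨y, ⟨l, hl, rfl⟩, hy⟩
  · have hsub : ray ⊆ interior A ∪ (closure A)ᶜ := by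
      intro y hy
      by_contra hn
      rw [mem_union, not_or, mem_compl_iff, not_not] at hn
      have : y ∈ ray ∩ frontier A := ⟨hy, hn.2, hn.1⟩
      simp [h] at this
    obtain ⟨a, har, haA⟩ := h1
    obtain ⟨b, hbr, hbA⟩ := h2
    have ha : (ray ∩ interior A).Nonempty := by
      refine ⟨a, har, (hsub har).resolve_right fun h => h (subset_closure haA)⟩
    have hb' : (ray ∩ (closure A)ᶜ).Nonempty := by
      refine ⟨b, hbr, (hsub hbr).resolve_left fun h => hbA (interior_subset h)⟩
    obtain ⟨c, -, hc1, hc2⟩ := hray _ _ isOpen_interior isClosed_closure.isOpen_compl hsub ha hb'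
    exact hc2 (subset_closure (interior_subset hc1))
  · have := hR _ hy
    simp only [norm_smul, Real.norm_eq_abs] at this
    have hl1 : 1 ≤ |l| := (show (1:ℝ) ≤ l from hl).trans (le_abs_self l)
    nlinarith

/-! ### Boundary curves -/

namespace IsBoundaryParam

variable {A : Set Plane} {γ : ℝ → Plane}

theorem differentiable (h : IsBoundaryParam A γ) : Differentiable ℝ γ :=
  h.contDiff.differentiable (by norm_num)

theorem continuous (h : IsBoundaryParam A γ) : Continuous γ := h.contDiff.continuous

theorem contDiff_deriv (h : IsBoundaryParam A γ) : ContDiff ℝ 1 (deriv γ) :=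
  ((contDiff_succ_iff_deriv (n := 1)).1 h.contDiff).2.2

theorem continuous_deriv (h : IsBoundaryParam A γ) : Continuous (deriv γ) :=
  h.contDiff_deriv.continuous

theorem hasDerivAt (h : IsBoundaryParam A γ) (s : ℝ) : HasDerivAt γ (deriv γ s) s :=
  (h.differentiable s).hasDerivAt

theorem periodic_deriv (h : IsBoundaryParam A γ) : Function.Periodic (deriv γ) 1 := by
  intro s
  have : (fun x => γ (x + 1)) = γ := funext h.periodic
  rw [← deriv_comp_add_const, this]

theorem ne_of_lt_add_one (h : IsBoundaryParam A γ) {s s' : ℝ} (h1 : s < s') (h2 : s' < s + 1) :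
    γ s ≠ γ s' := by
  intro he
  have e : ∀ x, γ (Int.fract x) = γ x := fun x => by
    have := h.periodic.sub_int_mul_eq (x := x) ⌊x⌋
    rwa [mul_one] at this
  have := h.injOn ⟨Int.fract_nonneg s, Int.fract_lt_one s⟩ ⟨Int.fract_nonneg s',
      Int.fract_lt_one s'⟩
    (by rw [e, e, he])
  obtain ⟨n, hn⟩ := Int.fract_eq_fract.1 this
  have a1 : (-1 : ℝ) < n := by linarith
  have a2 : (n : ℝ) < 0 := by linarith
  have b1 : (-1 : ℤ) < n := by exact_mod_cast a1
  have b2 : n < (0 : ℤ) := by exact_mod_cast a2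
  omega

theorem exists_eq_of_mem_frontier (h : IsBoundaryParam A γ) {x : Plane} (hx : x ∈ frontier A)
    (a : ℝ) : ∃ s ∈ Ico a (a + 1), γ s = x := by
  rw [← h.range_eq] at hx
  obtain ⟨s, rfl⟩ := hx
  obtain ⟨y, hy, e⟩ := h.periodic.exists_mem_Ico one_pos s a
  exact ⟨y, hy, e.symm⟩

end IsBoundaryParam

section

/-! ### Charts flattening the boundary -/

/-- The chart `(s, r) ↦ γ(s) + r n` with a constant transversal direction `n`. -/
def chart (γ : ℝ → Plane) (n : Plane) (q : Plane) : Plane := γ (q 0) + q 1 • n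

/-- The coordinate rectangle of half-sides `δ` and `η` about `(s₀, 0)`. -/
def box (s₀ δ η : ℝ) : Set Plane := {q | q 0 ∈ Ioo (s₀ - δ) (s₀ + δ) ∧ q 1 ∈ Ioo (-η) η}

theorem isOpen_box (s₀ δ η : ℝ) : IsOpen (box s₀ δ η) := by
  apply IsOpen.inter
  · exact isOpen_Ioo.preimage (by fun_prop : Continuous fun q : Plane => q 0)
  · exact isOpen_Ioo.preimage (by fun_prop : Continuous fun q : Plane => q 1)

theorem exists_box_subset {s₀ : ℝ} {S : Set Plane} (hS : S ∈ 𝓝 (!₂[s₀, 0] : Plane)) :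
    ∃ ε > 0, box s₀ ε ε ⊆ S := by
  obtain ⟨ε, hε, hb⟩ := Metric.mem_nhds_iff.1 hS
  refine ⟨ε / 2, by positivity, fun q hq => hb ?_⟩
  obtain ⟨⟨h1, h2⟩, h3, h4⟩ := hq
  rw [Metric.mem_ball, dist_eq_norm]
  refine lt_of_pow_lt_pow_left₀ 2 hε.le ?_
  rw [norm_sq_plane]
  simp only [PiLp.sub_apply, Matrix.cons_val_zero, Matrix.cons_val_one,
    Matrix.cons_val_fin_one, sub_zero]
  nlinarith

variable {A : Set Plane} {γ : ℝ → Plane}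

theorem IsBoundaryParam.hasFDerivAt_chart (h : IsBoundaryParam A γ) (n q : Plane) :
    HasFDerivAt (chart γ n) (columns (deriv γ (q 0)) n) q := by
  have h0 : HasFDerivAt (fun q : Plane => q 0) (EuclideanSpace.proj
      (0 : Fin 2) : Plane →L[ℝ] ℝ) q :=
    (EuclideanSpace.proj (0 : Fin 2) : Plane →L[ℝ] ℝ).hasFDerivAt
  have h1 : HasFDerivAt (fun q : Plane => q 1) (EuclideanSpace.proj
      (1 : Fin 2) : Plane →L[ℝ] ℝ) q :=
    (EuclideanSpace.proj (1 : Fin 2) : Plane →L[ℝ] ℝ).hasFDerivAt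
  have h2 := ((h.hasDerivAt (q 0)).hasFDerivAt.comp q h0).add (h1.smul_const n)
  refine h2.congr_fderiv ?_
  ext v
  simp [columns_apply]

theorem IsBoundaryParam.contDiff_chart (h : IsBoundaryParam A γ) (n : Plane) :
    ContDiff ℝ 2 (chart γ n) := by
  have h0 : ContDiff ℝ 2 (fun q : Plane => q 0) :=
    (EuclideanSpace.proj (0 : Fin 2) : Plane →L[ℝ] ℝ).contDiff
  have h1 : ContDiff ℝ 2 (fun q : Plane => q 1) :=
    (EuclideanSpace.proj (1 : Fin 2) : Plane →L[ℝ] ℝ).contDiff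
  exact (h.contDiff.comp h0).add (h1.smul contDiff_const)

/-- In a neighbourhood of a boundary point the chart is a diffeomorphism onto a neighbourhood, and
the only part of the boundary it sees is `{r = 0}`. -/
theorem IsBoundaryParam.exists_chart (h : IsBoundaryParam A γ) (s₀ : ℝ) :
    ∃ δ η : ℝ, 0 < δ ∧ δ < 1 / 2 ∧ 0 < η ∧
      InjOn (chart γ (perp (deriv γ s₀))) {q | q 0 ∈ Icc (s₀ - δ) (s₀ + δ)} ∧
      (∀ s ∈ Icc (s₀ - δ) (s₀ + δ), 0 < inner ℝ (perp (deriv γ s)) (perp (deriv γ s₀))) ∧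
      chart γ (perp (deriv γ s₀)) '' box s₀ δ η ∈ 𝓝 (γ s₀) ∧
      ∀ q ∈ box s₀ δ η, chart γ (perp (deriv γ s₀)) q ∈ frontier A → q 1 = 0 := by
  set e := deriv γ s₀ with he
  set n := perp e with hn
  have he0 : e ≠ 0 := h.deriv_ne_zero s₀
  have hcont : Continuous fun s => inner ℝ (deriv γ s) e :=
    h.continuous_deriv.inner continuous_const
  have hpos : ∀ᶠ s in 𝓝 s₀, 0 < inner ℝ (deriv γ s) e :=
    hcont.continuousAt.eventually (lt_mem_nhds (by
      show 0 < inner ℝ (deriv γ s₀) e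
      rw [← he]; exact real_inner_self_pos.2 he0))
  obtain ⟨ε, hε, hεp⟩ := Metric.eventually_nhds_iff.1 hpos
  set δ := min (ε / 2) (1 / 4) with hδ
  have hδ0 : 0 < δ := by positivity
  have hδε : δ < ε := (min_le_left _ _).trans_lt (by linarith)
  have hδ4 : δ ≤ 1 / 4 := min_le_right _ _
  have hdet : ∀ s ∈ Icc (s₀ - δ) (s₀ + δ), 0 < inner ℝ (deriv γ s) e := fun s hs => hεp (by
    rw [Real.dist_eq, abs_lt]; constructor <;> linarith [hs.1, hs.2])
  have hmono : StrictMonoOn (fun s => inner ℝ (γ s) e) (Icc (s₀ - δ) (s₀ + δ)) := by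
    have hd : ∀ s, HasDerivAt (fun s => inner ℝ (γ s) e) (inner ℝ (deriv γ s) e) s := fun s => by
      simpa using (h.hasDerivAt s).inner ℝ (hasDerivAt_const s e)
    refine strictMonoOn_of_deriv_pos (convex_Icc _ _)
      (fun s _ => (hd s).continuousAt.continuousWithinAt) fun s hs => ?_
    rw [(hd s).deriv]
    exact hdet s (interior_subset hs)
  have hinj : InjOn (chart γ n) {q | q 0 ∈ Icc (s₀ - δ) (s₀ + δ)} := by
    intro q hq q' hq' hqq
    have hi : ∀ q : Plane, inner ℝ (chart γ n q) e = inner ℝ (γ (q 0)) e := fun q => by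
      rw [chart, inner_add_left, inner_smul_left, hn, inner_perp_self]; simp
    have h0 : q 0 = q' 0 := hmono.injOn hq hq' (by
      show inner ℝ (γ (q 0)) e = inner ℝ (γ (q' 0)) e
      rw [← hi, ← hi, hqq])
    have h1 : q 1 = q' 1 := by
      rw [chart, chart, h0, add_right_inj] at hqq
      exact smul_left_injective ℝ (perp_ne_zero he0) hqq
    ext i
    fin_cases i
    · exact h0
    · exact h1
  -- The arc of parameters away from `s₀` keeps a positive distance from `γ s₀`.
  set q₀ : Plane := !₂[s₀, 0] with hq₀
  have hq00 : q₀ 0 = s₀ := rfl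
  have hq01 : q₀ 1 = 0 := rfl
  have hcq : chart γ n q₀ = γ s₀ := by rw [chart, hq00, hq01, zero_smul, add_zero]
  have hfar : chart γ n ⁻¹' (γ '' Icc (s₀ + δ) (s₀ + 1 - δ))ᶜ ∈ 𝓝 q₀ := by
    refine (h.contDiff_chart n).continuous.continuousAt.preimage_mem_nhds ?_
    refine ((isCompact_Icc.image h.continuous).isClosed.isOpen_compl).mem_nhds ?_
    rw [hcq]
    rintro ⟨s, hs, hse⟩
    exact h.ne_of_lt_add_one (s := s₀) (s' := s) (by linarith [hs.1]) (by linarith [hs.2]) hse.symm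
  obtain ⟨ρ, hρ, hbox⟩ := exists_box_subset hfar
  refine ⟨min δ ρ, ρ, by positivity, (min_le_left _ _).trans_lt (by linarith), hρ, ?_, ?_, ?_, ?_⟩
  · refine hinj.mono fun q hq => ?_
    have := min_le_left δ ρ
    exact ⟨by linarith [hq.1], by linarith [hq.2]⟩
  · intro s hs
    have := min_le_left δ ρ
    rw [inner_perp_perp]
    exact hdet s ⟨by linarith [hs.1], by linarith [hs.2]⟩
  · have hstrict : HasStrictFDerivAt (chart γ n) (columns e n) q₀ := by
      have := (h.contDiff_chart n).contDiffAt.hasStrictFDerivAt (x := q₀) (by norm_num)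
      rwa [(h.hasFDerivAt_chart n q₀).fderiv, hq00] at this
    have hsurj : (columns e n).range = ⊤ := by
      have hdet0 : (columns e n).det ≠ 0 := by
        rw [det_columns, hn]
        exact (real_inner_self_pos.2 (perp_ne_zero he0)).ne'
      exact (LinearMap.equivOfDetNeZero _ hdet0).range
    rw [← hcq, ← hstrict.map_nhds_eq_of_surj hsurj]
    refine image_mem_map ((isOpen_box _ _ _).mem_nhds ?_)
    refine ⟨?_, ?_⟩
    · rw [hq00]; constructor <;> simp [hδ0, hρ]
    · rw [hq01]; constructor <;> simp [hρ]
  · intro q hq hqf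
    have hmδ := min_le_left δ ρ
    have hmρ := min_le_right δ ρ
    obtain ⟨s, hs, hse⟩ := h.exists_eq_of_mem_frontier hqf (s₀ - δ)
    have hqρ : q ∈ box s₀ ρ ρ := ⟨⟨by linarith [hq.1.1], by linarith [hq.1.2]⟩, hq.2⟩
    have hs' : s ≤ s₀ + δ := by
      by_contra! hlt
      exact hbox hqρ ⟨s, ⟨hlt.le, by linarith [hs.2]⟩, hse⟩
    have hp : chart γ n !₂[s, 0] = chart γ n q := by
      rw [← hse, chart]; simp
    have := hinj (show s ∈ Icc (s₀ - δ) (s₀ + δ) from ⟨hs.1, hs'⟩)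
      (show q 0 ∈ Icc (s₀ - δ) (s₀ + δ) from ⟨by linarith [hq.1.1], by linarith [hq.1.2]⟩) hp
    rw [← this]
    rfl

/-- The part `{r > 0}` of a chart lies in `A` and the part `{r < 0}` in its complement: both are
connected and miss the boundary, and points on the normal at `s₀` decide the side. -/
theorem IsBoundaryParam.chart_mem_iff (h : IsBoundaryParam A γ) {s₀ δ η : ℝ} (hδ : 0 < δ)
    (hη : 0 < η)
    (hf : ∀ q ∈ box s₀ δ η, chart γ (perp (deriv γ s₀)) q ∈ frontier A → q 1 = 0)
    {q : Plane} (hq : q ∈ box s₀ δ η) (hq1 : q 1 ≠ 0) :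
    chart γ (perp (deriv γ s₀)) q ∈ A ↔ 0 < q 1 := by
  set n := perp (deriv γ s₀) with hn
  -- A convex set of chart coordinates off `{r = 0}` lies on one side.
  have key : ∀ p q : Plane, p ∈ box s₀ δ η → q ∈ box s₀ δ η → 0 < p 1 * q 1 →
      chart γ n p ∈ A → chart γ n q ∈ A := by
    intro p q hp hq hpq hpA
    have hseg : IsPreconnected (chart γ n '' segment ℝ p q) :=
      (convex_segment p q).isPreconnected.image _ (h.contDiff_chart n).continuous.continuousOn
    have hbox : segment ℝ p q ⊆ box s₀ δ η := by
      have hc : Convex ℝ (box s₀ δ η) := by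
        apply Convex.inter
        · exact (convex_Ioo _ _).is_linear_preimage (f := fun q : Plane => q 0)
            ⟨fun _ _ => rfl, fun _ _ => rfl⟩
        · exact (convex_Ioo _ _).is_linear_preimage (f := fun q : Plane => q 1)
            ⟨fun _ _ => rfl, fun _ _ => rfl⟩
      exact hc.segment_subset hp hq
    have hoff : ∀ x ∈ segment ℝ p q, x 1 ≠ 0 := by
      rintro x ⟨a, b, ha, hb, hab, rfl⟩ h0
      have h0 : a * p 1 + b * q 1 = 0 := h0
      rcases pos_and_pos_or_neg_and_neg_of_mul_pos hpq with ⟨h1, h2⟩ | ⟨h1, h2⟩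
      · rcases ha.eq_or_lt with rfl | ha
        · nlinarith
        · nlinarith [mul_pos ha h1, mul_nonneg hb h2.le]
      · rcases ha.eq_or_lt with rfl | ha
        · nlinarith
        · nlinarith [mul_neg_of_pos_of_neg ha h1, mul_nonneg hb (neg_nonneg.2 h2.le)]
    have hmiss : chart γ n '' segment ℝ p q ⊆ interior A ∪ (closure A)ᶜ := by
      rintro _ ⟨x, hx, rfl⟩
      by_contra hc
      rw [mem_union, not_or, mem_compl_iff, not_not] at hc
      exact hoff x hx (hf x (hbox hx) ⟨hc.2, hc.1⟩)
    by_contra hqA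
    have hpm : chart γ n p ∈ chart γ n '' segment ℝ p q := ⟨p, left_mem_segment ℝ p q, rfl⟩
    have hqm : chart γ n q ∈ chart γ n '' segment ℝ p q := ⟨q, right_mem_segment ℝ p q, rfl⟩
    obtain ⟨c, -, hc1, hc2⟩ := hseg _ _ isOpen_interior isClosed_closure.isOpen_compl hmiss
      ⟨_, hpm, (hmiss hpm).resolve_right fun hh => hh (subset_closure hpA)⟩
      ⟨_, hqm, (hmiss hqm).resolve_left fun hh => hqA (interior_subset hh)⟩
    exact hc2 (subset_closure (interior_subset hc1))
  obtain ⟨r, ⟨hr1, hr2⟩, hr0, hrη⟩ := ((h.left s₀).and (Ioo_mem_nhdsGT hη)).exists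
  have hmem : ∀ r' ∈ Ioo (-η) η, (!₂[s₀, r'] : Plane) ∈ box s₀ δ η := fun r' hr' =>
    ⟨⟨by simp [hδ], by simp [hδ]⟩, hr'⟩
  have hpos : (!₂[s₀, r] : Plane) ∈ box s₀ δ η := hmem r ⟨by linarith, hrη⟩
  have hneg : (!₂[s₀, -r] : Plane) ∈ box s₀ δ η := hmem (-r) ⟨by linarith, by linarith⟩
  have epos : chart γ n !₂[s₀, r] = γ s₀ + r • n := rfl
  have eneg : chart γ n !₂[s₀, -r] = γ s₀ - r • n := by
    rw [sub_eq_add_neg, ← neg_smul]; rfl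
  rcases lt_or_gt_of_ne hq1 with hlt | hgt
  · refine iff_of_false (fun hA => ?_) hlt.not_gt
    have := key q !₂[s₀, -r] hq hneg (mul_pos_of_neg_of_neg hlt (neg_neg_of_pos hr0)) hA
    rw [eneg] at this
    exact hr2 this
  · refine iff_of_true (key !₂[s₀, r] q hpos hq (mul_pos hr0 hgt) ?_) hgt
    rw [epos]
    exact interior_subset hr1

end

section

/-! ### The divergence theorem for a region bounded by a parametrised curve -/

variable {A : Set Plane} {γ : ℝ → Plane}

theorem integral_fderiv_eq_zero {f : Plane → ℝ} (hf : ContDiff ℝ 1 f) (hc : HasCompactSupport f)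
    (e : Plane) : ∫ x, fderiv ℝ f x e = 0 := by
  have hd : Continuous fun x => fderiv ℝ f x e := (hf.continuous_fderiv (by norm_num)).clm_apply
    continuous_const
  have hdc : HasCompactSupport fun x => fderiv ℝ f x e := hc.fderiv_apply ℝ e
  have := integral_mul_fderiv_eq_neg_fderiv_mul_of_integrable (μ := (volume : Measure Plane))
    (f := fun _ => (1 : ℝ)) (g := f) (v := e) (by simp)
    (by simpa using hd.integrable_of_hasCompactSupport hdc)
    (by simpa using hf.continuous.integrable_of_hasCompactSupport hc)
    (fun x _ => differentiableAt_const _) (fun x _ => hf.differentiable (by norm_num) x)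
  simpa using this

/-- Expansion of `e` in the basis `a`, `b`, by Cramer's rule. -/
theorem cramer (a b e : Plane) : inner ℝ (perp a) b • e =
    -inner ℝ (perp b) e • a + inner ℝ (perp a) e • b := by
  ext i
  fin_cases i <;> simp [inner_plane] <;> ring

/-- The divergence theorem for functions supported near a boundary point: in a chart it reduces to
the fundamental theorem of calculus. The Jacobian of the chart is cleared by `cramer`, which leaves
a term differentiated along the boundary and one differentiated across it. -/
theorem IsBoundaryParam.local_green (h : IsBoundaryParam A γ) (hA : IsClosed A) (s₀ : ℝ) :
    ∃ U ∈ 𝓝 (γ s₀), ∀ f : Plane → ℝ, ContDiff ℝ 1 f → tsupport f ⊆ U → ∀ e : Plane,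
      ∫ x in A, fderiv ℝ f x e = -∫ s in (0 : ℝ)..1, f (γ s) * inner ℝ (perp (deriv γ s)) e := by
  obtain ⟨δ, η, hδ, hδ2, hη, hinj, hdet, hU, hfr⟩ := h.exists_chart s₀
  set n := perp (deriv γ s₀) with hn
  refine ⟨chart γ n '' box s₀ δ η, hU, fun f hf hsupp e => ?_⟩
  have hboxI : ∀ q ∈ box s₀ δ η, q 0 ∈ Icc (s₀ - δ) (s₀ + δ) := fun q hq =>
    ⟨hq.1.1.le, hq.1.2.le⟩
  have hf0 : ∀ x, x ∉ chart γ n '' box s₀ δ η → f x = 0 := fun x hx =>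
    image_eq_zero_of_notMem_tsupport fun hh => hx (hsupp hh)
  have hdf0 : ∀ x, x ∉ chart γ n '' box s₀ δ η → fderiv ℝ f x = 0 := fun x hx =>
    image_eq_zero_of_notMem_tsupport fun hh => hx (hsupp (tsupport_fderiv_subset ℝ hh))
  have hchart : ∀ s r, chart γ n !₂[s, r] = γ s + r • n := fun _ _ => rfl
  -- Points of the closed coordinate strip outside the rectangle are outside the support of `f`.
  have hout : ∀ s r, s ∈ Icc (s₀ - δ) (s₀ + δ) → (!₂[s, r] : Plane) ∉ box s₀ δ η →
      f (γ s + r • n) = 0 := by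
    intro s r hs hb
    rw [← hchart]
    refine hf0 _ ?_
    rintro ⟨q, hq, hqe⟩
    have : q = !₂[s, r] := hinj (hboxI q hq) hs hqe
    exact hb (this ▸ hq)
  set d : ℝ → ℝ := fun s => inner ℝ (perp (deriv γ s)) e with hd
  set c : ℝ := inner ℝ (perp n) e with hc
  set G : ℝ → ℝ → ℝ := fun s r =>
    inner ℝ (perp (deriv γ s)) n * fderiv ℝ f (γ s + r • n) e with hG
  have hperp := continuous_perp
  have hγ := h.continuous
  have hγ' := h.continuous_deriv
  have hDf : Continuous (fderiv ℝ f) := hf.continuous_fderiv (by norm_num)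
  have hGc : Continuous (Function.uncurry G) := by
    simp only [hG, Function.uncurry_def]
    fun_prop
  have hdc : Continuous d := by simp only [hd]; fun_prop
  set hs' : ℝ → ℝ → ℝ := fun s r => fderiv ℝ f (γ s + r • n) (deriv γ s) with hhs
  set hr' : ℝ → ℝ → ℝ := fun s r => fderiv ℝ f (γ s + r • n) n with hhr
  have hhsc : Continuous (Function.uncurry hs') := by
    simp only [hhs, Function.uncurry_def]; fun_prop
  have hhrc : Continuous (Function.uncurry hr') := by
    simp only [hhr, Function.uncurry_def]; fun_prop
  have hGeq : ∀ s r, G s r = -c * hs' s r + d s * hr' s r := by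
    intro s r
    have := congrArg (fderiv ℝ f (γ s + r • n)) (cramer (deriv γ s) n e)
    simpa using this
  -- Change of variables and Fubini.
  have step1 : ∫ x in A, fderiv ℝ f x e =
      ∫ s in (s₀ - δ)..(s₀ + δ), ∫ r in (0 : ℝ)..η, G s r := by
    rw [← integral_indicator hA.measurableSet,
      ← setIntegral_eq_integral_of_forall_compl_eq_zero (s := chart γ n '' box s₀ δ η)]
    swap
    · intro x hx
      by_cases hxA : x ∈ A
      · rw [indicator_of_mem hxA, hdf0 x hx]; rfl
      · rw [indicator_of_notMem hxA]
    rw [integral_image_eq_integral_abs_det_fderiv_smul volume (isOpen_box _ _ _).measurableSet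
      (fun q _ => (h.hasFDerivAt_chart n q).hasFDerivWithinAt) (hinj.mono hboxI)]
    have e1 : ∀ q ∈ box s₀ δ η,
        |(columns (deriv γ (q 0)) n).det| • A.indicator (fun x => fderiv ℝ f x e) (chart γ n q) =
        {q : Plane | 0 ≤ q 1}.indicator (fun q : Plane => G (q 0) (q 1)) q := by
      intro q hq
      rw [det_columns, abs_of_pos (hdet _ (hboxI q hq)), smul_eq_mul]
      have hiff : chart γ n q ∈ A ↔ 0 ≤ q 1 := by
        by_cases hq1 : q 1 = 0
        · refine iff_of_true ?_ hq1.ge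
          rw [chart, hq1, zero_smul, add_zero]
          exact hA.frontier_subset (h.range_eq ▸ mem_range_self _)
        · rw [h.chart_mem_iff hδ hη hfr hq hq1]
          exact ⟨le_of_lt, fun hh => lt_of_le_of_ne hh (Ne.symm hq1)⟩
      by_cases hq1 : 0 ≤ q 1
      · rw [indicator_of_mem (hiff.2 hq1), indicator_of_mem
          (show q ∈ {q : Plane | 0 ≤ q 1} from hq1)]
        rfl
      · rw [indicator_of_notMem (fun hh => hq1 (hiff.1 hh)),
          indicator_of_notMem (show q ∉ {q : Plane | 0 ≤ q 1} from hq1), mul_zero]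
    rw [setIntegral_congr_fun (isOpen_box _ _ _).measurableSet e1, setIntegral_indicator
      (isClosed_le continuous_const (by fun_prop : Continuous fun q : Plane => q 1)).measurableSet]
    have e2 : box s₀ δ η ∩ {q : Plane | 0 ≤ q 1} =
        planeEquiv ⁻¹' (Ioo (s₀ - δ) (s₀ + δ) ×ˢ Ico 0 η) := by
      ext q
      simp only [box, mem_inter_iff, mem_ofPred_eq, mem_preimage, planeEquiv_apply, mem_prod,
        mem_Ioo, mem_Ico]
      constructor
      · rintro ⟨⟨h1, h2, h3⟩, h4⟩; exact ⟨h1, h4, h3⟩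
      · rintro ⟨h1, h4, h3⟩; exact ⟨⟨h1, by linarith, h3⟩, h4⟩
    rw [e2]
    have e3 := planeEquiv_measurePreserving.setIntegral_preimage_emb
      planeEquiv.measurableEmbedding (Function.uncurry G) (Ioo (s₀ - δ) (s₀ + δ) ×ˢ Ico 0 η)
    simp only [planeEquiv_apply, Function.uncurry_apply_pair] at e3
    rw [e3, Measure.volume_eq_prod, setIntegral_prod, intervalIntegral.integral_of_le (by linarith),
      integral_Ioc_eq_integral_Ioo]
    · refine setIntegral_congr_fun measurableSet_Ioo fun s _ => ?_
      simp only [Function.uncurry_apply_pair]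
      rw [intervalIntegral.integral_of_le hη.le, integral_Ico_eq_integral_Ioc]
    · exact (hGc.continuousOn.integrableOn_compact (isCompact_Icc.prod isCompact_Icc)).mono_set
        (prod_mono Ioo_subset_Icc_self Ico_subset_Icc_self)
  -- The tangential term integrates to zero, the transversal one to boundary values.
  have step2 : ∫ s in (s₀ - δ)..(s₀ + δ), ∫ r in (0 : ℝ)..η, hs' s r = 0 := by
    rw [intervalIntegral_intervalIntegral_swap]
    · refine intervalIntegral.integral_zero_ae (Eventually.of_forall fun r _ => ?_)
      have hder : ∀ s ∈ uIcc (s₀ - δ) (s₀ + δ),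
          HasDerivAt (fun s => f (γ s + r • n)) (hs' s r) s := fun s _ =>
        ((hf.differentiable (by norm_num) _).hasFDerivAt).comp_hasDerivAt s
          ((h.hasDerivAt s).add_const _)
      rw [intervalIntegral.integral_eq_sub_of_hasDerivAt hder
        ((hhsc.comp (by fun_prop : Continuous fun s => (s, r))).intervalIntegrable _ _),
        hout _ r ⟨by linarith, le_rfl⟩ (fun hh => lt_irrefl _ hh.1.2),
        hout _ r ⟨le_rfl, by linarith⟩ (fun hh => lt_irrefl _ hh.1.1), sub_zero]
    · rw [uIoc_of_le (by linarith), uIoc_of_le hη.le]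
      exact (hhsc.continuousOn.integrableOn_compact (isCompact_Icc.prod isCompact_Icc)).mono_set
        (prod_mono Ioc_subset_Icc_self Ioc_subset_Icc_self)
  have step3 : ∀ s ∈ Icc (s₀ - δ) (s₀ + δ), ∫ r in (0 : ℝ)..η, hr' s r = -f (γ s) := by
    intro s hs
    have hder : ∀ r ∈ uIcc 0 η, HasDerivAt (fun r => f (γ s + r • n)) (hr' s r) r := fun r _ => by
      have h1 : HasDerivAt (fun r : ℝ => γ s + r • n) n r := by
        simpa using ((hasDerivAt_id r).smul_const n).const_add (γ s)
      exact ((hf.differentiable (by norm_num) _).hasFDerivAt).comp_hasDerivAt r h1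
    rw [intervalIntegral.integral_eq_sub_of_hasDerivAt hder
      ((hhrc.comp (by fun_prop : Continuous fun r => (s, r))).intervalIntegrable _ _),
      hout s η hs (fun hh => lt_irrefl _ hh.2.2)]
    simp
  have step4 : ∫ x in A, fderiv ℝ f x e = -∫ s in (s₀ - δ)..(s₀ + δ), f (γ s) * d s := by
    rw [step1]
    have hin : ∀ s, ∫ r in (0 : ℝ)..η, G s r =
        -c * (∫ r in (0 : ℝ)..η, hs' s r) + d s * ∫ r in (0 : ℝ)..η, hr' s r := fun s => by
      have i1 : IntervalIntegrable (hs' s) volume 0 η :=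
        (hhsc.comp (by fun_prop : Continuous fun r => (s, r))).intervalIntegrable _ _
      have i2 : IntervalIntegrable (hr' s) volume 0 η :=
        (hhrc.comp (by fun_prop : Continuous fun r => (s, r))).intervalIntegrable _ _
      simp only [hGeq]
      rw [intervalIntegral.integral_add (i1.const_mul _) (i2.const_mul _),
        intervalIntegral.integral_const_mul, intervalIntegral.integral_const_mul]
    simp only [hin]
    rw [intervalIntegral.integral_add, intervalIntegral.integral_const_mul, step2, mul_zero,
      zero_add, ← intervalIntegral.integral_neg]
    · refine intervalIntegral.integral_congr fun s hs => ?_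
      rw [uIcc_of_le (by linarith)] at hs
      simp only [step3 s hs]
      ring
    · exact (continuous_const.mul
        (intervalIntegral.continuous_parametric_intervalIntegral_of_continuous'
          hhsc 0 η)).intervalIntegrable _ _
    · exact (hdc.mul
        (intervalIntegral.continuous_parametric_intervalIntegral_of_continuous'
          hhrc 0 η)).intervalIntegrable _ _
  rw [step4, neg_inj]
  -- The rest of a period does not contribute.
  have hper : Function.Periodic (fun s => f (γ s) * d s) 1 := fun s => by
    simp only [hd, h.periodic s, h.periodic_deriv s]
  have hfdc : Continuous fun s => f (γ s) * d s := (hf.continuous.comp hγ).mul hdc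
  have e5 := hper.intervalIntegral_add_eq 0 (s₀ - δ)
  rw [zero_add] at e5
  rw [e5, ← intervalIntegral.integral_add_adjacent_intervals (b := s₀ + δ)
    (c := s₀ - δ + 1)
    (hfdc.intervalIntegrable _ _) (hfdc.intervalIntegrable _ _), left_eq_add]
  have hz : EqOn (fun s => f (γ s) * d s) (fun _ => 0) (uIcc (s₀ + δ) (s₀ - δ + 1)) := by
    intro s hs
    rw [uIcc_of_le (by linarith)] at hs
    have : f (γ s) = 0 := by
      refine hf0 _ ?_
      rintro ⟨q, hq, hqe⟩
      have hq1 := hfr q hq (hqe ▸ h.range_eq ▸ mem_range_self s)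
      rw [chart, hq1, zero_smul, add_zero] at hqe
      exact h.ne_of_lt_add_one (s := q 0) (s' := s) (by linarith [hq.1.2, hs.1])
        (by linarith [hq.1.1, hs.2]) hqe
    simp [this]
  rw [intervalIntegral.integral_congr hz]
  simp

open scoped Manifold in
/-- **Divergence theorem**: `∇ 1_A` is the measure `(∂_s γ)^⊥ ds` on the boundary curve. -/
theorem IsBoundaryParam.green (h : IsBoundaryParam A γ) (hA : IsClosed A)
    (hb : Bornology.IsBounded A) {f : Plane → ℝ} (hf : ContDiff ℝ 1 f) (e : Plane) :
    ∫ x in A, fderiv ℝ f x e = -∫ s in (0 : ℝ)..1, f (γ s) * inner ℝ (perp (deriv γ s)) e := by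
  have hloc : ∀ x : Plane, ∃ U : Set Plane, IsOpen U ∧ x ∈ U ∧ ∀ f : Plane → ℝ, ContDiff ℝ 1 f →
      tsupport f ⊆ U →
      ∫ x in A, fderiv ℝ f x e = -∫ s in (0 : ℝ)..1, f (γ s) * inner ℝ (perp (deriv γ s)) e := by
    intro x
    have hmem : ∀ s, γ s ∈ frontier A := fun s => h.range_eq ▸ mem_range_self s
    by_cases hx : x ∈ frontier A
    · rw [← h.range_eq] at hx
      obtain ⟨s₀, rfl⟩ := hx
      obtain ⟨U, hU, hUf⟩ := h.local_green hA s₀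
      exact ⟨interior U, isOpen_interior, mem_interior_iff_mem_nhds.2 hU, fun f hf hs =>
        hUf f hf (hs.trans interior_subset) e⟩
    by_cases hxA : x ∈ A
    · refine ⟨interior A, isOpen_interior, ?_, fun f hf hs => ?_⟩
      · by_contra hc
        exact hx ⟨subset_closure hxA, hc⟩
      have h1 : ∫ x in A, fderiv ℝ f x e = ∫ x, fderiv ℝ f x e := by
        refine setIntegral_eq_integral_of_forall_compl_eq_zero fun y hy => ?_
        have : fderiv ℝ f y = 0 := image_eq_zero_of_notMem_tsupport fun hh =>
          hy (interior_subset (hs (tsupport_fderiv_subset ℝ hh)))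
        rw [this]; rfl
      have hcs : HasCompactSupport f :=
        (Metric.isCompact_of_isClosed_isBounded hA hb).of_isClosed_subset (isClosed_tsupport f)
          (hs.trans interior_subset)
      have h2 : ∀ s, f (γ s) = 0 := fun s => image_eq_zero_of_notMem_tsupport fun hh =>
        (hmem s).2 (hs hh)
      rw [h1, integral_fderiv_eq_zero hf hcs]
      simp [h2]
    · refine ⟨Aᶜ, hA.isOpen_compl, hxA, fun f hf hs => ?_⟩
      have h2 : ∀ s, f (γ s) = 0 := fun s => image_eq_zero_of_notMem_tsupport fun hh =>
        hs hh (hA.frontier_subset (hmem s))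
      have h1 : ∀ y ∈ A, fderiv ℝ f y e = 0 := fun y hy => by
        have : fderiv ℝ f y = 0 := image_eq_zero_of_notMem_tsupport fun hh =>
          (hs (tsupport_fderiv_subset ℝ hh)) hy
        rw [this]; rfl
      rw [setIntegral_congr_fun hA.measurableSet h1]
      simp [h2]
  choose U hUo hUx hUf using hloc
  obtain ⟨ρ, hρ⟩ := SmoothPartitionOfUnity.exists_isSubordinate 𝓘(ℝ, Plane) isClosed_univ U hUo
    (fun x _ => mem_iUnion.2 ⟨x, hUx x⟩)
  have hAc : IsCompact A := Metric.isCompact_of_isClosed_isBounded hA hb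
  have hC : IsCompact (Metric.cthickening 1 A) := hAc.cthickening
  have hfin := ρ.locallyFinite.finite_nonempty_inter_compact hC
  set I := hfin.toFinset with hI
  have hρs : ∀ i, ContDiff ℝ 1 (fun x => ρ i x) := fun i =>
    ((ρ i).contMDiff.contDiff).of_le (by exact_mod_cast le_top)
  set g : Plane → Plane → ℝ := fun i x => ρ i x * f x with hg
  have hgs : ∀ i, ContDiff ℝ 1 (g i) := fun i => (hρs i).mul hf
  have hgt : ∀ i, tsupport (g i) ⊆ U i := fun i =>
    (tsupport_mul_subset_left).trans (hρ i)
  have hsum : ∀ x ∈ Metric.cthickening 1 A, f x = ∑ i ∈ I, g i x := by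
    intro x hx
    have h1 := ρ.sum_eq_one (mem_univ x)
    rw [finsum_eq_sum_of_support_subset _ (s := I)] at h1
    · simp only [hg, ← Finset.sum_mul, h1, one_mul]
    · intro i hi
      rw [hI, hfin.coe_toFinset]
      exact ⟨x, hi, hx⟩
  have hnhds : ∀ x ∈ A, Metric.cthickening 1 A ∈ 𝓝 x := fun x hx =>
    mem_of_superset (Metric.isOpen_thickening.mem_nhds (Metric.self_subset_thickening one_pos A hx))
      (Metric.thickening_subset_cthickening 1 A)
  have hder : ∀ x ∈ A, fderiv ℝ f x e = ∑ i ∈ I, fderiv ℝ (g i) x e := by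
    intro x hx
    have : f =ᶠ[𝓝 x] fun x => ∑ i ∈ I, g i x := by
      filter_upwards [hnhds x hx] with y hy using hsum y hy
    rw [this.fderiv_eq, fderiv_fun_sum fun i _ => (hgs i).differentiable (by norm_num) x]
    simp
  have hγA : ∀ s, γ s ∈ A := fun s => hA.frontier_subset (h.range_eq ▸ mem_range_self s)
  have hperp := continuous_perp
  have hγ' := h.continuous_deriv
  rw [setIntegral_congr_fun hA.measurableSet hder, integral_finsetSum]
  · simp only [fun i => hUf i (g i) (hgs i) (hgt i)]
    rw [Finset.sum_neg_distrib, ← intervalIntegral.integral_finsetSum]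
    · congr 1
      refine intervalIntegral.integral_congr fun s _ => ?_
      rw [← Finset.sum_mul, ← hsum _ (Metric.self_subset_cthickening A (hγA s))]
    · intro i _
      have h1 : Continuous fun s => inner ℝ (perp (deriv γ s)) e := by fun_prop
      exact (((hgs i).continuous.comp h.continuous).mul h1).intervalIntegrable _ _
  · intro i _
    exact (((hgs i).continuous_fderiv (by norm_num)).clm_apply
      continuous_const).continuousOn.integrableOn_compact hAc

end

/-! ### Moving fronts -/

/-- A family of closed bounded regions `A t`, `t ∈ ℝ`, whose boundaries are parametrised by `w`,
with `w`, `∂_t w`, `∂_s w` and `∂_s² w` continuous in `(t, s)`. -/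
structure IsFront (A : ℝ → Set Plane) (w : ℝ → ℝ → Plane) : Prop where
  param : ∀ t, IsBoundaryParam (A t) (w t)
  isClosed : ∀ t, IsClosed (A t)
  isBounded : ∀ t, Bornology.IsBounded (A t)
  contDiff : ContDiff ℝ 1 (fun p : ℝ × ℝ => w p.1 p.2)
  continuous_second : Continuous (fun p : ℝ × ℝ => iteratedDeriv 2 (w p.1) p.2)

/-- A continuous function of `(t, s)`, periodic in `s`, is bounded for `t` in a compact set. -/
theorem exists_bound_of_periodic {E : Type*} [NormedAddCommGroup E] {f : ℝ → ℝ → E}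
    (hf : Continuous (fun p : ℝ × ℝ => f p.1 p.2)) (hp : ∀ t, Function.Periodic (f t) 1)
    {J : Set ℝ} (hJ : IsCompact J) : ∃ M, 0 < M ∧ ∀ t ∈ J, ∀ s, ‖f t s‖ ≤ M := by
  obtain ⟨M, hM⟩ := (hJ.prod isCompact_Icc).exists_bound_of_continuousOn
    (s := J ×ˢ Icc (0 : ℝ) 1) hf.continuousOn
  refine ⟨max M 1, by positivity, fun t ht s => ?_⟩
  obtain ⟨y, hy, e⟩ := (hp t).exists_mem_Ico₀ one_pos s
  rw [e]
  exact (hM (t, y) ⟨ht, hy.1, hy.2.le⟩).trans (le_max_left _ _)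

namespace IsFront

variable {A : ℝ → Set Plane} {w : ℝ → ℝ → Plane}

theorem continuous (h : IsFront A w) : Continuous (fun p : ℝ × ℝ => w p.1 p.2) :=
  h.contDiff.continuous

theorem hasFDerivAt (h : IsFront A w) (t s : ℝ) :
    HasFDerivAt (fun p : ℝ × ℝ => w p.1 p.2) (fderiv ℝ (fun p : ℝ × ℝ => w p.1 p.2) (t, s)) (t,
        s) :=
  (h.contDiff.differentiable (by norm_num) (t, s)).hasFDerivAt

theorem fderiv_space (h : IsFront A w) (t s : ℝ) :
    fderiv ℝ (fun p : ℝ × ℝ => w p.1 p.2) (t, s) (0, 1) = deriv (w t) s := by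
  have h1 : HasDerivAt (fun σ : ℝ => (t, σ)) ((0, 1) : ℝ × ℝ) s :=
    (hasDerivAt_const s t).prodMk (hasDerivAt_id s)
  exact ((h.hasFDerivAt t s).comp_hasDerivAt s h1).deriv.symm

theorem hasDerivAt_time (h : IsFront A w) (t s : ℝ) :
    HasDerivAt (fun τ => w τ s) (fderiv ℝ (fun p : ℝ × ℝ => w p.1 p.2) (t, s) (1, 0)) t := by
  have h1 : HasDerivAt (fun τ : ℝ => (τ, s)) ((1, 0) : ℝ × ℝ) t :=
    (hasDerivAt_id t).prodMk (hasDerivAt_const t s)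
  exact (h.hasFDerivAt t s).comp_hasDerivAt t h1

theorem fderiv_time (h : IsFront A w) (t s : ℝ) :
    fderiv ℝ (fun p : ℝ × ℝ => w p.1 p.2) (t, s) (1, 0) = deriv (fun τ => w τ s) t :=
  (h.hasDerivAt_time t s).deriv.symm

theorem continuous_deriv (h : IsFront A w) : Continuous (fun p : ℝ × ℝ => deriv (w p.1) p.2) := by
  have : (fun p : ℝ × ℝ => deriv (w p.1) p.2) =
      fun p : ℝ × ℝ => fderiv ℝ (fun p : ℝ × ℝ => w p.1 p.2) p (0, 1) :=
    funext fun p => (h.fderiv_space p.1 p.2).symm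
  rw [this]
  exact (h.contDiff.continuous_fderiv (by norm_num)).clm_apply continuous_const

theorem continuous_time (h : IsFront A w) :
    Continuous (fun p : ℝ × ℝ => deriv (fun τ => w τ p.2) p.1) := by
  have : (fun p : ℝ × ℝ => deriv (fun τ => w τ p.2) p.1) =
      fun p : ℝ × ℝ => fderiv ℝ (fun p : ℝ × ℝ => w p.1 p.2) p (1, 0) :=
    funext fun p => (h.fderiv_time p.1 p.2).symm
  rw [this]
  exact (h.contDiff.continuous_fderiv (by norm_num)).clm_apply continuous_const

theorem periodic_time (h : IsFront A w) (t : ℝ) :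
    Function.Periodic (fun s => deriv (fun τ => w τ s) t) 1 := fun s => by
  have : (fun τ => w τ (s + 1)) = fun τ => w τ s := funext fun τ => (h.param τ).periodic s
  simp only [this]

/-- The chord-arc estimate, uniform for times in a compact set. It follows from compactness, since
`w(s + h) - w(s) = h ∫₀¹ ∂_s w(s + λ h) dλ` and the integral is continuous and never zero. -/
theorem exists_chord_arc (h : IsFront A w) {J : Set ℝ} (hJ : IsCompact J) :
    ∃ c, 0 < c ∧ ∀ t ∈ J, ∀ s, ∀ x ∈ Icc (-1 / 2 : ℝ) (1 / 2),
      c * |x| ≤ ‖w t (s + x) - w t s‖ := by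
  let m : ℝ × ℝ × ℝ → Plane := fun p => ∫ l in (0 : ℝ)..1, deriv (w p.1) (p.2.1 + l * p.2.2)
  have hwd := h.continuous_deriv
  have hm : Continuous m := by
    apply intervalIntegral.continuous_parametric_intervalIntegral_of_continuous'
    exact hwd.comp (by fun_prop : Continuous fun q : (ℝ × ℝ × ℝ) × ℝ =>
      (q.1.1, q.1.2.1 + q.2 * q.1.2.2))
  have hmul : ∀ t s x, x • m (t, s, x) = w t (s + x) - w t s := by
    intro t s x
    have hd : ∀ l ∈ uIcc (0 : ℝ) 1,
        HasDerivAt (fun l : ℝ => w t (s + l * x)) (x • deriv (w t) (s + l * x)) l := fun l _ => by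
      have h1 : HasDerivAt (fun l : ℝ => s + l * x) x l := by
        simpa using ((hasDerivAt_id l).mul_const x).const_add s
      exact ((h.param t).hasDerivAt _).scomp l h1
    have hc : Continuous fun l : ℝ => deriv (w t) (s + l * x) :=
      (h.param t).continuous_deriv.comp (by fun_prop)
    have := intervalIntegral.integral_eq_sub_of_hasDerivAt hd
      ((hc.const_smul x).intervalIntegrable _ _)
    rw [intervalIntegral.integral_smul] at this
    simpa [m] using this
  have hm0 : ∀ t s, ∀ x ∈ Icc (-1 / 2 : ℝ) (1 / 2), m (t, s, x) ≠ 0 := by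
    intro t s x hx h0
    by_cases hx0 : x = 0
    · subst hx0
      simp [m] at h0
      exact (h.param t).deriv_ne_zero s h0
    · have he := hmul t s x
      rw [h0, smul_zero, eq_comm, sub_eq_zero] at he
      rcases lt_or_gt_of_ne hx0 with hlt | hgt
      · exact (h.param t).ne_of_lt_add_one (s := s + x) (s' := s) (by linarith)
          (by linarith [hx.1]) he
      · exact (h.param t).ne_of_lt_add_one (s := s) (s' := s + x) (by linarith)
          (by linarith [hx.2]) he.symm
  have hcpt : IsCompact (J ×ˢ Icc (0 : ℝ) 1 ×ˢ Icc (-1 / 2 : ℝ) (1 / 2)) :=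
    hJ.prod (isCompact_Icc.prod isCompact_Icc)
  rcases (J ×ˢ Icc (0 : ℝ) 1 ×ˢ Icc (-1 / 2 : ℝ) (1 / 2)).eq_empty_or_nonempty with he | hne
  · refine ⟨1, one_pos, fun t ht => ?_⟩
    have : (t, (0 : ℝ), (0 : ℝ)) ∈ J ×ˢ Icc (0 : ℝ) 1 ×ˢ Icc (-1 / 2 : ℝ) (1 / 2) :=
      ⟨ht, by simp, by norm_num⟩
    rw [he] at this
    exact this.elim
  obtain ⟨p, hp, hmin⟩ := hcpt.exists_isMinOn hne hm.norm.continuousOn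
  refine ⟨‖m p‖, norm_pos_iff.2 (hm0 p.1 p.2.1 p.2.2 hp.2.2), fun t ht s x hx => ?_⟩
  have hmper : Function.Periodic (fun s => m (t, s, x)) 1 := fun s => by
    simp only [m]
    refine intervalIntegral.integral_congr fun l _ => ?_
    have := (h.param t).periodic_deriv (s + l * x)
    simp only [← this]
    congr 1
    ring
  obtain ⟨y, hy, e⟩ := hmper.exists_mem_Ico₀ one_pos s
  rw [← hmul, norm_smul, e, mul_comm, Real.norm_eq_abs]
  exact mul_le_mul_of_nonneg_left (hmin (show (t, y, x) ∈ _ from ⟨ht, ⟨hy.1, hy.2.le⟩, hx⟩))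
    (abs_nonneg _)

theorem exists_lipschitz_deriv (h : IsFront A w) {J : Set ℝ} (hJ : IsCompact J) :
    ∃ M, 0 < M ∧ ∀ t ∈ J, ∀ s x, ‖deriv (w t) (s + x) - deriv (w t) s‖ ≤ M * |x| := by
  have hper : ∀ t, Function.Periodic (fun s => iteratedDeriv 2 (w t) s) 1 := fun t s => by
    simp only [iteratedDeriv_succ, iteratedDeriv_zero]
    have : (fun x => deriv (w t) (x + 1)) = deriv (w t) := funext (h.param t).periodic_deriv
    rw [← deriv_comp_add_const, this]
  obtain ⟨M, hM, hb⟩ := exists_bound_of_periodic h.continuous_second hper hJ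
  refine ⟨M, hM, fun t ht s x => ?_⟩
  have := (convex_univ : Convex ℝ (univ : Set ℝ)).norm_image_sub_le_of_norm_deriv_le
    (f := deriv (w t)) (C := M) (x := s) (y := s + x)
    (fun y _ => (h.param t).contDiff_deriv.differentiable (by norm_num) y)
    (fun y _ => by
      have := hb t ht y
      simpa [iteratedDeriv_succ, iteratedDeriv_zero] using this)
    (mem_univ _) (mem_univ _)
  simpa using this

end IsFront

/-- A single region with its boundary curve is a front that does not move. -/
theorem IsBoundaryParam.isFront {A : Set Plane} {γ : ℝ → Plane} (h : IsBoundaryParam A γ)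
    (hA : IsClosed A)
    (hb : Bornology.IsBounded A) : IsFront (fun _ => A) (fun _ => γ) where
  param _ := h
  isClosed _ := hA
  isBounded _ := hb
  contDiff := (h.contDiff.of_le (by norm_num)).comp contDiff_snd
  continuous_second := by
    simp only [iteratedDeriv_succ, iteratedDeriv_zero]
    exact (h.contDiff_deriv.continuous_deriv (by norm_num)).comp continuous_snd

/-! ### Velocity of points carried by a front -/

/-- If the point `x τ` lies on the front at every time near `t`, the normal component of its
velocity is that of the front. -/
theorem IsFront.inner_velocity_eq {A : ℝ → Set Plane} {w : ℝ → ℝ → Plane} (h : IsFront A w)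
    {x : ℝ → Plane} {t σ₀ : ℝ} {v : Plane}
    (hx : ∀ᶠ τ in 𝓝 t, x τ ∈ frontier (A τ)) (h0 : x t = w t σ₀) (hv : HasDerivAt x v t) :
    inner ℝ v (perp (deriv (w t) σ₀)) =
      inner ℝ (deriv (fun τ => w τ σ₀) t) (perp (deriv (w t) σ₀)) := by
  set N := perp (deriv (w t) σ₀) with hN
  obtain ⟨c, hc, hca⟩ := h.exists_chord_arc (isCompact_Icc (a := t - 1) (b := t + 1))
  have hσ : ∀ τ, ∃ σ, x τ ∈ frontier (A τ) → σ ∈ Icc (-1 / 2 : ℝ) (1 / 2) ∧ w τ (σ₀ + σ) = x τ := by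
    intro τ
    by_cases hτ : x τ ∈ frontier (A τ)
    · obtain ⟨s, hs, e⟩ := (h.param τ).exists_eq_of_mem_frontier hτ (σ₀ - 1 / 2)
      exact ⟨s - σ₀, fun _ => ⟨⟨by linarith [hs.1], by linarith [hs.2]⟩, by rwa [add_sub_cancel]⟩⟩
    · exact ⟨0, fun hh => absurd hh hτ⟩
  choose σ hσ using hσ
  have hwt := h.hasDerivAt_time t σ₀
  rw [h.fderiv_time] at hwt
  -- The chord-arc estimate gives `σ τ = O(τ - t)`.
  have hO : σ =O[𝓝 t] fun τ => τ - t := by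
    have h1 : (fun τ => x τ - w τ σ₀) =O[𝓝 t] fun τ => τ - t := by
      have := (hv.sub hwt).isBigO_sub
      simpa [h0] using this
    refine Asymptotics.IsBigO.trans (Asymptotics.IsBigO.of_bound c⁻¹ ?_) h1
    filter_upwards [hx, Icc_mem_nhds (show t - 1 < t by linarith) (show t < t + 1 by linarith)]
      with τ hτ hτJ
    have h2 := hca τ hτJ σ₀ (σ τ) (hσ τ hτ).1
    rw [(hσ τ hτ).2] at h2
    rw [Real.norm_eq_abs, inv_mul_eq_div, le_div_iff₀ hc]
    linarith
  have hpair : (fun τ => (τ - t, σ τ)) =O[𝓝 t] fun τ => τ - t :=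
    (Asymptotics.isBigO_refl _ _).prod_left hO
  have htend : Tendsto (fun τ => (τ, σ₀ + σ τ)) (𝓝 t) (𝓝 (t, σ₀)) := by
    refine tendsto_id.prodMk_nhds ?_
    have : Tendsto σ (𝓝 t) (𝓝 0) := by
      refine hO.trans_tendsto ?_
      have : Tendsto (fun τ => τ - t) (𝓝 t) (𝓝 (t - t)) :=
          (continuous_id.sub continuous_const).tendsto t
      simpa using this
    simpa using this.const_add σ₀
  have hlin := ((h.hasFDerivAt t σ₀).isLittleO.comp_tendsto htend)
  have hlin' : (fun τ => x τ - x t - (τ - t) • deriv (fun τ => w τ σ₀) t -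
      σ τ • deriv (w t) σ₀) =o[𝓝 t] fun τ => τ - t := by
    refine Asymptotics.IsLittleO.trans_isBigO
        (Asymptotics.IsLittleO.congr' hlin ?_ EventuallyEq.rfl) ?_
    · filter_upwards [hx] with τ hτ
      simp only [Function.comp]
      rw [(hσ τ hτ).2, h0]
      have : ((τ, σ₀ + σ τ) - (t, σ₀) : ℝ × ℝ) = (τ - t) • ((1, 0) : ℝ × ℝ) + σ τ • ((0,
          1) : ℝ × ℝ) := by
        ext <;> simp
      rw [this, map_add, map_smul, map_smul, h.fderiv_time, h.fderiv_space]
      abel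
    · refine hpair.congr_left fun τ => ?_
      simp
  have hv' : (fun τ => x τ - x t - (τ - t) • v) =o[𝓝 t] fun τ => τ - t := hv.isLittleO
  have hdiff : (fun τ => (τ - t) • inner ℝ (v - deriv (fun τ => w τ σ₀) t) N) =o[𝓝 t]
      fun τ => τ - t := by
    have h3 := hlin'.sub hv'
    have h4 := ((innerSL ℝ N).isBigO_comp (fun τ => x τ - x t - (τ - t) • deriv (fun τ =>
        w τ σ₀) t -
      σ τ • deriv (w t) σ₀ - (x τ - x t - (τ - t) • v)) (𝓝 t)).trans_isLittleO h3
    refine h4.congr_left fun τ => ?_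
    have e : x τ - x t - (τ - t) • deriv (fun τ => w τ σ₀) t - σ τ • deriv (w t) σ₀ -
        (x τ - x t - (τ - t) • v) =
        (τ - t) • (v - deriv (fun τ => w τ σ₀) t) - σ τ • deriv (w t) σ₀ := by
      rw [smul_sub]; abel
    rw [e, map_sub, map_smul, map_smul]
    simp only [innerSL_apply_apply]
    rw [hN, inner_perp_self, smul_zero, sub_zero, real_inner_comm]
  have hder : HasDerivAt (fun _ : ℝ => (0 : ℝ)) (inner ℝ (v - deriv (fun τ => w τ σ₀) t) N) t := by
    rw [hasDerivAt_iff_isLittleO]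
    simpa using hdiff.neg_left
  have := hder.unique (hasDerivAt_const t 0)
  rw [inner_sub_left, sub_eq_zero] at this
  exact this

section

/-! ### The circulation integral and its regularisation -/

/-- The kernel `k_δ`, a multiple of a smooth approximation of `K`. It is the divergence of
`(|y|² + δ²)^(-(1+α)/2) y`, so that its potential is a boundary integral, and `k_δ → (1 - α) K` as
`δ → 0`. -/
def regKernel (α δ : ℝ) (y : Plane) : ℝ :=
  (‖y‖ ^ 2 + δ ^ 2) ^ (-(3 + α) / 2) * ((1 - α) * ‖y‖ ^ 2 + 2 * δ ^ 2)

/-- The circulation integral `∫_𝕋 K(p - γ(s)) ∂_s γ(s) · n ds`. It is evaluated at points `p` of the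
curve and vectors `n` normal to the curve there; this is the case in which it converges absolutely,
and `-circ α γ p n` is then the component along `n` of the velocity `∇^⊥ K * 1_A`. -/
def circ (α : ℝ) (γ : ℝ → Plane) (p n : Plane) : ℝ :=
  ∫ s in (0 : ℝ)..1, kernel α (p - γ s) * inner ℝ (deriv γ s) n

variable {α δ : ℝ}

theorem kernel_nonneg (y : Plane) : 0 ≤ kernel α y := Real.rpow_nonneg (norm_nonneg _) _

theorem regKernel_sub_comm (x y : Plane) : regKernel α δ (x - y) = regKernel α δ (y - x) := by
  rw [regKernel, regKernel, norm_sub_rev]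

theorem measurable_kernel : Measurable (kernel α) := by unfold kernel; fun_prop

theorem continuousAt_kernel {y : Plane} (hy : y ≠ 0) : ContinuousAt (kernel α) y :=
  continuous_norm.continuousAt.rpow_const (Or.inl (norm_ne_zero_iff.2 hy))

theorem contDiff_regKernel (hδ : δ ≠ 0) : ContDiff ℝ ∞ (regKernel α δ) := by
  unfold regKernel
  have h : ContDiff ℝ ∞ fun y : Plane => ‖y‖ ^ 2 := contDiff_norm_sq ℝ
  refine ((h.add contDiff_const).rpow_const_of_ne fun y => ?_).mul
    ((contDiff_const.mul h).add contDiff_const)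
  positivity

theorem regKernel_nonneg (hα : α ∈ Ioo (0 : ℝ) 1) (y : Plane) : 0 ≤ regKernel α δ y := by
  have := hα.2
  unfold regKernel
  have : 0 ≤ 1 - α := by linarith
  positivity

theorem regKernel_le (hα : α ∈ Ioo (0 : ℝ) 1) (hδ : δ ≠ 0) {y : Plane} (hy : y ≠ 0) :
    regKernel α δ y ≤ 2 * kernel α y := by
  have hy' : 0 < ‖y‖ := norm_pos_iff.2 hy
  have hρ : 0 < ‖y‖ ^ 2 + δ ^ 2 := by positivity
  have e1 : (‖y‖ ^ 2 + δ ^ 2) ^ (-(1 + α) / 2) =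
      (‖y‖ ^ 2 + δ ^ 2) ^ (-(3 + α) / 2) * (‖y‖ ^ 2 + δ ^ 2) := by
    rw [← Real.rpow_add_one hρ.ne']; congr 1; ring
  have e2 : kernel α y = (‖y‖ ^ 2) ^ (-(1 + α) / 2) := by
    rw [kernel, ← Real.rpow_natCast, ← Real.rpow_mul hy'.le]; congr 1; push_cast; ring
  have h1 : (‖y‖ ^ 2 + δ ^ 2) ^ (-(1 + α) / 2) ≤ kernel α y := by
    rw [e2]
    exact Real.rpow_le_rpow_of_nonpos (by positivity) (by nlinarith [sq_nonneg δ])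
      (by linarith [hα.1])
  have h2 : regKernel α δ y ≤ 2 * (‖y‖ ^ 2 + δ ^ 2) ^ (-(1 + α) / 2) := by
    rw [e1, regKernel, mul_left_comm]
    refine mul_le_mul_of_nonneg_left ?_ (by positivity)
    nlinarith [hα.1, sq_nonneg ‖y‖]
  linarith

/-- Regularisation parameters tending to zero. -/
def reg (m : ℕ) : ℝ := 1 / ((m : ℝ) + 1)

theorem reg_ne_zero (m : ℕ) : reg m ≠ 0 := by unfold reg; positivity

theorem tendsto_reg : Tendsto reg atTop (𝓝 0) := tendsto_one_div_add_atTop_nhds_zero_nat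

theorem tendsto_regKernel {y : Plane} (hy : y ≠ 0) :
    Tendsto (fun m => regKernel α (reg m) y) atTop (𝓝 ((1 - α) * kernel α y)) := by
  have hy' : 0 < ‖y‖ := norm_pos_iff.2 hy
  have h1 : ContinuousAt (fun δ : ℝ => regKernel α δ y) 0 := by
    unfold regKernel
    refine ContinuousAt.mul (ContinuousAt.rpow_const (by fun_prop) (Or.inl ?_)) (by fun_prop)
    positivity
  have h2 : regKernel α 0 y = (1 - α) * kernel α y := by
    have : kernel α y = (‖y‖ ^ 2) ^ (-(3 + α) / 2) * ‖y‖ ^ 2 := by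
      rw [← Real.rpow_add_one (by positivity), kernel, ← Real.rpow_natCast,
        ← Real.rpow_mul hy'.le]
      congr 1; push_cast; ring
    rw [this, regKernel]; ring_nf
  rw [← h2]
  exact h1.tendsto.comp tendsto_reg

theorem locallyIntegrable_kernel (hα : α ∈ Ioo (0 : ℝ) 1) : LocallyIntegrable
    (kernel α) volume := by
  refine locallyIntegrable_of_norm_le_rpow (C := 1) (α := 1 + α) (by simp) (by
    simp; linarith [hα.2]) (Eventually.of_forall fun x => ?_)
    measurable_kernel.aestronglyMeasurable
  rw [Real.norm_of_nonneg (kernel_nonneg x), one_mul, kernel]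
  apply le_of_eq; congr 1; ring

theorem intervalIntegrable_abs_rpow (hα : α ∈ Ioo (0 : ℝ) 1) (a b : ℝ) :
    IntervalIntegrable (fun x : ℝ => |x| ^ (-α)) volume a b := by
  have : LocallyIntegrable (fun x : ℝ => |x| ^ (-α)) volume := by
    refine locallyIntegrable_of_norm_le_rpow (C := 1) (α := α) (by simp) (by simp [hα.2])
      (Eventually.of_forall fun x => ?_) (Measurable.aestronglyMeasurable (by fun_prop))
    rw [Real.norm_of_nonneg (by positivity), one_mul, Real.norm_eq_abs]
  exact (this.integrableOn_isCompact isCompact_uIcc).intervalIntegrable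

/-- The divergence theorem for the regularised kernel. -/
theorem IsBoundaryParam.integral_regKernel {A : Set Plane} {γ : ℝ → Plane}
    (h : IsBoundaryParam A γ) (hA : IsClosed A) (hb : Bornology.IsBounded A) (hδ : δ ≠ 0)
    (p n : Plane) :
    ∫ s in (0 : ℝ)..1, regKernel α δ (p - γ s) * inner ℝ (deriv γ s) n =
      -∫ y in A, fderiv ℝ (fun y => regKernel α δ (p - y)) y (perp n) := by
  have hf : ContDiff ℝ 1 (fun y => regKernel α δ (p - y)) :=
    ((contDiff_regKernel hδ).of_le (by exact_mod_cast le_top)).comp (contDiff_const.sub contDiff_id)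
  rw [h.green hA hb hf, neg_neg]
  simp only [inner_perp_perp]

namespace IsFront

variable {A : ℝ → Set Plane} {w : ℝ → ℝ → Plane}

/-- The kernel on the front is dominated by `|x|^(-α)`, uniformly for times in a compact set. -/
theorem exists_kernel_bound (h : IsFront A w) (hα : α ∈ Ioo (0 : ℝ) 1) {J : Set ℝ}
    (hJ : IsCompact J) : ∃ C, 0 < C ∧ ∀ t ∈ J, ∀ s, ∀ x ∈ Icc (-1 / 2 : ℝ) (1 / 2),
      kernel α (w t s - w t (s + x)) * ‖deriv (w t) (s + x) - deriv (w t) s‖ ≤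
        C * |x| ^ (-α) := by
  obtain ⟨c, hc, hca⟩ := h.exists_chord_arc hJ
  obtain ⟨M, hM, hlip⟩ := h.exists_lipschitz_deriv hJ
  refine ⟨c ^ (-1 - α) * M, by positivity, fun t ht s x hx => ?_⟩
  by_cases hx0 : x = 0
  · subst hx0; simp; positivity
  have hx0' : 0 < |x| := abs_pos.2 hx0
  have h1 : kernel α (w t s - w t (s + x)) ≤ (c * |x|) ^ (-1 - α) := by
    rw [kernel, norm_sub_rev]
    exact Real.rpow_le_rpow_of_nonpos (by positivity) (hca t ht s x hx) (by linarith [hα.1])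
  calc _ ≤ (c * |x|) ^ (-1 - α) * (M * |x|) :=
        mul_le_mul h1 (hlip t ht s x) (norm_nonneg _) (by positivity)
    _ = c ^ (-1 - α) * M * (|x| ^ (-1 - α) * |x|) := by
        rw [Real.mul_rpow hc.le hx0'.le]; ring
    _ = _ := by rw [← Real.rpow_add_one hx0'.ne']; congr 2; ring

theorem ne_add (h : IsFront A w) (t s : ℝ) {x : ℝ} (hx : x ∈ Icc (-1 / 2 : ℝ) (1 / 2))
    (hx0 : x ≠ 0) : w t s - w t (s + x) ≠ 0 := by
  obtain ⟨c, hc, hca⟩ := h.exists_chord_arc (isCompact_singleton (x := t))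
  have := hca t rfl s x hx
  rw [← norm_pos_iff, norm_sub_rev]
  have : 0 < c * |x| := by positivity
  linarith

end IsFront

/-- An integral over a period, recentred at `s`. -/
theorem integral_period_eq {E : Type*} [NormedAddCommGroup E] [NormedSpace ℝ E] {f : ℝ → E}
    (hf : Function.Periodic f 1) (s : ℝ) :
    ∫ x in (0 : ℝ)..1, f x = ∫ x in (-1 / 2 : ℝ)..(1 / 2), f (s + x) := by
  rw [intervalIntegral.integral_comp_add_left]
  have := hf.intervalIntegral_add_eq 0 (s + -1 / 2)
  rw [zero_add] at this
  rw [this]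
  congr 1
  ring

/-- If `n` is normal at the base point, `∂_s γ` may be replaced by its increment, which compensates
the singularity of the kernel. -/
theorem integral_kernel_recentre {A : Set Plane} {γ : ℝ → Plane} (h : IsBoundaryParam A γ)
    (k : Plane → ℝ) (s : ℝ) {n : Plane} (hn : inner ℝ (deriv γ s) n = 0) :
    ∫ s' in (0 : ℝ)..1, k (γ s - γ s') * inner ℝ (deriv γ s') n =
      ∫ x in (-1 / 2 : ℝ)..(1 / 2),
        k (γ s - γ (s + x)) * inner ℝ (deriv γ (s + x) - deriv γ s) n := by
  rw [integral_period_eq (s := s)]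
  · simp only [inner_sub_left, hn, sub_zero]
  · intro s'
    simp only [h.periodic s', h.periodic_deriv s']

section

variable {A : Set Plane} {γ : ℝ → Plane}

theorem aestronglyMeasurable_kernel_curve {E : Type*} [NormedAddCommGroup E] [NormedSpace ℝ E]
    {γ : ℝ → Plane} (hγ : Continuous γ) {g : ℝ → E} (hg : Continuous g) (p : Plane)
    (μ : Measure ℝ) : AEStronglyMeasurable (fun x => kernel α (p - γ x) • g x) μ := by
  refine AEStronglyMeasurable.smul (f := fun x => kernel α (p - γ x)) ?_ hg.aestronglyMeasurable
  exact (measurable_kernel.comp (by fun_prop : Measurable fun x => p - γ x)).aestronglyMeasurable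

theorem ae_ne_zero : ∀ᵐ x : ℝ, x ≠ 0 := by
  simp [ae_iff]

theorem mem_Icc_of_uIoc {x : ℝ} (hx : x ∈ uIoc (-1 / 2 : ℝ) (1 / 2)) :
    x ∈ Icc (-1 / 2 : ℝ) (1 / 2) := by
  rw [uIoc_of_le (by norm_num)] at hx
  exact Ioc_subset_Icc_self hx

theorem IsBoundaryParam.intervalIntegrable_cdeIntegrand (h : IsBoundaryParam A γ)
    (hA : IsClosed A) (hb : Bornology.IsBounded A) (hα : α ∈ Ioo (0 : ℝ) 1) (s a b : ℝ) :
    IntervalIntegrable (cdeIntegrand α γ s) volume a b := by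
  have hper : Function.Periodic (cdeIntegrand α γ s) 1 := fun s' => by
    simp only [cdeIntegrand, h.periodic s', h.periodic_deriv s']
  refine hper.intervalIntegrable one_ne_zero (t := s + -1 / 2) ?_ a b
  obtain ⟨C, hC, hb⟩ := (h.isFront hA hb).exists_kernel_bound hα (isCompact_singleton (x := 0))
  have h1 : IntervalIntegrable (fun x => cdeIntegrand α γ s (s + x)) volume (-1 / 2) (1 / 2) := by
    refine ((intervalIntegrable_abs_rpow hα (-1 / 2) (1 / 2)).const_mul C).mono_fun' ?_ ?_
    · unfold cdeIntegrand
      exact aestronglyMeasurable_kernel_curve (h.continuous.comp (by fun_prop))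
        ((h.continuous_deriv.comp (by fun_prop)).sub continuous_const) _ _
    · refine (ae_restrict_iff' measurableSet_uIoc).2 (Eventually.of_forall fun x hx => ?_)
      simp only [cdeIntegrand]
      rw [norm_smul, Real.norm_of_nonneg (kernel_nonneg _)]
      exact hb 0 rfl s x (mem_Icc_of_uIoc hx)
  have h2 := h1.comp_sub_right s
  simp only [add_sub_cancel] at h2
  have e1 : s + -1 / 2 = -1 / 2 + s := by ring
  have e2 : s + -1 / 2 + 1 = 1 / 2 + s := by ring
  rwa [e2, e1]

/-- On normal vectors the subtracted term `∂_s γ(s)` of the integral `I` does not contribute. -/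
theorem IsBoundaryParam.inner_cdeIntegral (h : IsBoundaryParam A γ)
    (hA : IsClosed A) (hb : Bornology.IsBounded A) (hα : α ∈ Ioo (0 : ℝ) 1) (s : ℝ) {n : Plane}
    (hn : inner ℝ (deriv γ s) n = 0) :
    inner ℝ (cdeIntegral α γ s) n = circ α γ (γ s) n := by
  have hper : Function.Periodic (fun s' => kernel α (γ s - γ s') * inner ℝ (deriv γ s') n) 1 :=
    fun s' => by simp only [h.periodic s', h.periodic_deriv s']
  rw [cdeIntegral, real_inner_comm, ← innerSL_apply_apply ℝ,
    ← ContinuousLinearMap.intervalIntegral_comp_comm _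
      (h.intervalIntegrable_cdeIntegrand hA hb hα s _ _), circ, integral_period_eq hper 0]
  refine intervalIntegral.integral_congr fun s' _ => ?_
  simp only [zero_add, cdeIntegrand, map_smul, innerSL_apply_apply, smul_eq_mul]
  rw [real_inner_comm, inner_sub_left, hn, sub_zero]

end

namespace IsFront

variable {A : ℝ → Set Plane} {w : ℝ → ℝ → Plane}

theorem norm_regKernel_inner_le (h : IsFront A w) (hα : α ∈ Ioo (0 : ℝ) 1) {J : Set ℝ}
    (hJ : IsCompact J) : ∃ C, 0 < C ∧ ∀ t ∈ J, ∀ s, ∀ x ∈ Icc (-1 / 2 : ℝ) (1 / 2), x ≠ 0 →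
      ∀ n δ, δ ≠ 0 →
      ‖regKernel α δ (w t s - w t (s + x)) * inner ℝ (deriv (w t) (s + x) - deriv (w t) s) n‖ ≤
        C * ‖n‖ * |x| ^ (-α) ∧
      ‖kernel α (w t s - w t (s + x)) * inner ℝ (deriv (w t) (s + x) - deriv (w t) s) n‖ ≤
        C * ‖n‖ * |x| ^ (-α) := by
  obtain ⟨C, hC, hb⟩ := h.exists_kernel_bound hα hJ
  refine ⟨2 * C, by positivity, fun t ht s x hx hx0 n δ hδ => ?_⟩
  have h1 := regKernel_le hα hδ (h.ne_add t s hx hx0)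
  have h2 := regKernel_nonneg (δ := δ) hα (w t s - w t (s + x))
  have h3 := kernel_nonneg (α := α) (w t s - w t (s + x))
  have h4 := hb t ht s x hx
  have h5 := abs_real_inner_le_norm (deriv (w t) (s + x) - deriv (w t) s) n
  have h6 := norm_nonneg (deriv (w t) (s + x) - deriv (w t) s)
  have h7 := norm_nonneg n
  have key : ∀ k, 0 ≤ k → k ≤ 2 * kernel α (w t s - w t (s + x)) →
      ‖k * inner ℝ (deriv (w t) (s + x) - deriv (w t) s) n‖ ≤ 2 * C * ‖n‖ * |x| ^ (-α) := by
    intro k hk0 hk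
    rw [norm_mul, Real.norm_of_nonneg hk0, Real.norm_eq_abs]
    calc _ ≤ 2 * kernel α (w t s - w t (s + x)) *
          (‖deriv (w t) (s + x) - deriv (w t) s‖ * ‖n‖) :=
          mul_le_mul hk h5 (abs_nonneg _) (by positivity)
      _ = 2 * ‖n‖ * (kernel α (w t s - w t (s + x)) *
          ‖deriv (w t) (s + x) - deriv (w t) s‖) := by ring
      _ ≤ 2 * ‖n‖ * (C * |x| ^ (-α)) := mul_le_mul_of_nonneg_left h4 (by positivity)
      _ = _ := by ring
  exact ⟨key _ h2 h1, key _ h3 (by linarith)⟩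

/-- The regularised circulation integrals converge to the singular one. -/
theorem tendsto_regKernel_circ (h : IsFront A w) (hα : α ∈ Ioo (0 : ℝ) 1) (t s : ℝ) {n : Plane}
    (hn : inner ℝ (deriv (w t) s) n = 0) :
    Tendsto (fun m => ∫ s' in (0 : ℝ)..1,
      regKernel α (reg m) (w t s - w t s') * inner ℝ (deriv (w t) s') n) atTop
      (𝓝 ((1 - α) * circ α (w t) (w t s) n)) := by
  obtain ⟨C, hC, hb⟩ := h.norm_regKernel_inner_le hα (isCompact_singleton (x := t))
  have hw := (h.param t).continuous
  have hw' := (h.param t).continuous_deriv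
  rw [circ, integral_kernel_recentre (h.param t) _ s hn, ← intervalIntegral.integral_const_mul]
  simp only [integral_kernel_recentre (h.param t) (regKernel α (reg _)) s hn]
  refine intervalIntegral.tendsto_integral_filter_of_dominated_convergence
    (fun x => C * ‖n‖ * |x| ^ (-α)) (Eventually.of_forall fun m => ?_)
    (Eventually.of_forall fun m => ?_) ((intervalIntegrable_abs_rpow hα _ _).const_mul _) ?_
  · have := (contDiff_regKernel (α := α) (reg_ne_zero m)).continuous
    exact Continuous.aestronglyMeasurable (by fun_prop)
  · filter_upwards [ae_ne_zero] with x hx0 hx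
    exact (hb t rfl s x (mem_Icc_of_uIoc hx) hx0 n _ (reg_ne_zero m)).1
  · filter_upwards [ae_ne_zero] with x hx0 hx
    rw [← mul_assoc]
    exact (tendsto_regKernel (h.ne_add t s (mem_Icc_of_uIoc hx) hx0)).mul_const _

theorem regKernel_circ_bound (h : IsFront A w) (hα : α ∈ Ioo (0 : ℝ) 1) (t : ℝ) :
    ∃ C, 0 < C ∧ ∀ s n, inner ℝ (deriv (w t) s) n = 0 → ∀ δ, δ ≠ 0 →
      ‖∫ s' in (0 : ℝ)..1, regKernel α δ (w t s - w t s') * inner ℝ (deriv (w t) s') n‖ ≤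
        C * ‖n‖ := by
  obtain ⟨C, hC, hb⟩ := h.norm_regKernel_inner_le hα (isCompact_singleton (x := t))
  set D := ∫ x in (-1 / 2 : ℝ)..(1 / 2), |x| ^ (-α) with hD
  have hD0 : 0 ≤ D := intervalIntegral.integral_nonneg (by norm_num) fun x _ => by positivity
  refine ⟨C * D + 1, by positivity, fun s n hn δ hδ => ?_⟩
  rw [integral_kernel_recentre (h.param t) _ s hn]
  refine (intervalIntegral.norm_integral_le_of_norm_le (g := fun x => C * ‖n‖ * |x| ^ (-α))
    (by norm_num) ?_ ((intervalIntegrable_abs_rpow hα _ _).const_mul _)).trans ?_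
  · filter_upwards [ae_ne_zero] with x hx0 hx
    exact (hb t rfl s x (Ioc_subset_Icc_self hx) hx0 n δ hδ).1
  · rw [intervalIntegral.integral_const_mul, ← hD]
    nlinarith [norm_nonneg n]

/-- The normal component of the velocity is continuous along the front. -/
theorem continuous_circ (h : IsFront A w) (hα : α ∈ Ioo (0 : ℝ) 1) :
    Continuous fun p : ℝ × ℝ => circ α (w p.1) (w p.1 p.2) (perp (deriv (w p.1) p.2)) := by
  have hw := h.continuous
  have hw' := h.continuous_deriv
  have hn : ∀ t s, inner ℝ (deriv (w t) s) (perp (deriv (w t) s)) = 0 := fun t s => by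
    rw [real_inner_comm, inner_perp_self]
  simp only [circ, fun p : ℝ × ℝ => integral_kernel_recentre (h.param p.1) (kernel α) p.2
      (hn p.1 p.2)]
  rw [continuous_iff_continuousAt]
  rintro ⟨t, s⟩
  obtain ⟨C, hC, hb⟩ := h.norm_regKernel_inner_le hα (isCompact_Icc (a := t - 1) (b := t + 1))
  obtain ⟨M, hM, hMb⟩ := exists_bound_of_periodic hw' (fun t => (h.param t).periodic_deriv)
    (isCompact_Icc (a := t - 1) (b := t + 1))
  have hnear : ∀ᶠ p : ℝ × ℝ in 𝓝 (t, s), p.1 ∈ Icc (t - 1) (t + 1) :=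
    continuous_fst.continuousAt.eventually (Icc_mem_nhds (by simp) (by simp))
  refine intervalIntegral.continuousAt_of_dominated_interval (bound := fun x => C * M * |x| ^ (-α))
    (Eventually.of_forall fun p => ?_) ?_ ((intervalIntegrable_abs_rpow hα _ _).const_mul _) ?_
  · have h1 := (h.param p.1).continuous
    have h2 := (h.param p.1).continuous_deriv
    exact aestronglyMeasurable_kernel_curve (E := ℝ) (γ := fun x => w p.1 (p.2 + x))
      (g := fun x => inner ℝ (deriv (w p.1) (p.2 + x) - deriv (w p.1) p.2) (perp (deriv
          (w p.1) p.2)))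
      (h1.comp (by fun_prop)) (by fun_prop) _ _
  · filter_upwards [hnear] with p hp
    filter_upwards [ae_ne_zero] with x hx0 hx
    refine (hb p.1 hp p.2 x (mem_Icc_of_uIoc hx) hx0 _ 1 one_ne_zero).2.trans ?_
    rw [norm_perp]
    have := hMb p.1 hp p.2
    gcongr
  · filter_upwards [ae_ne_zero] with x hx0 hx
    have c1 : Continuous fun p : ℝ × ℝ => w p.1 (p.2 + x) :=
      hw.comp (by fun_prop : Continuous fun p : ℝ × ℝ => (p.1, p.2 + x))
    have c2 : Continuous fun p : ℝ × ℝ => deriv (w p.1) (p.2 + x) :=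
      hw'.comp (by fun_prop : Continuous fun p : ℝ × ℝ => (p.1, p.2 + x))
    have c3 : Continuous fun p : ℝ × ℝ => perp (deriv (w p.1) p.2) := continuous_perp.comp hw'
    refine ContinuousAt.mul ?_ ((c2.sub hw').inner c3).continuousAt
    exact ContinuousAt.comp (f := fun p : ℝ × ℝ => w p.1 p.2 - w p.1 (p.2 + x))
      (continuousAt_kernel (h.ne_add t s (mem_Icc_of_uIoc hx) hx0)) (hw.sub c1).continuousAt

end IsFront

/-- The circulation integral does not depend on the parametrisation: its regularisations are
integrals over the region. -/
theorem circ_eq_circ {A : Set Plane} {γ₁ γ₂ : ℝ → Plane} (h₁ : IsBoundaryParam A γ₁)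
    (h₂ : IsBoundaryParam A γ₂) (hA : IsClosed A) (hb : Bornology.IsBounded A)
    (hα : α ∈ Ioo (0 : ℝ) 1) {s₁ s₂ : ℝ} (hs : γ₁ s₁ = γ₂ s₂) {n : Plane}
    (hn₁ : inner ℝ (deriv γ₁ s₁) n = 0) (hn₂ : inner ℝ (deriv γ₂ s₂) n = 0) :
    circ α γ₁ (γ₁ s₁) n = circ α γ₂ (γ₂ s₂) n := by
  have t1 := (h₁.isFront hA hb).tendsto_regKernel_circ hα 0 s₁ hn₁
  have t2 := (h₂.isFront hA hb).tendsto_regKernel_circ hα 0 s₂ hn₂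
  simp only [h₁.integral_regKernel hA hb (reg_ne_zero _)] at t1
  simp only [h₂.integral_regKernel hA hb (reg_ne_zero _), ← hs] at t2
  have := tendsto_nhds_unique t1 t2
  rw [← hs]
  exact mul_left_cancel₀ (sub_pos.2 hα.2).ne' this

end

section

/-! ### The potential of a region -/

/-- The potential of a region with respect to the regularised kernel. -/
def regPotential (α δ : ℝ) (A : Set Plane) (x : Plane) : ℝ := ∫ y in A, regKernel α δ (x - y)

variable {α δ : ℝ}

theorem potential_indicator {A : Set Plane} (hA : IsClosed A) (x : Plane) :
    potential α (A.indicator fun _ => 1) x = ∫ y in A, kernel α (x - y) := by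
  rw [potential, ← integral_indicator hA.measurableSet]
  congr 1
  ext y
  by_cases hy : y ∈ A <;> simp [hy]

theorem integrableOn_kernel_sub (hα : α ∈ Ioo (0 : ℝ) 1) (x : Plane) {S : Set Plane}
    (hS : Bornology.IsBounded S) : IntegrableOn (fun y => kernel α (x - y)) S := by
  obtain ⟨r, hr⟩ := (Metric.isBounded_iff_subset_closedBall 0).1 hS
  have h1 : IntegrableOn (kernel α) (Metric.closedBall 0 (‖x‖ + r)) :=
    (locallyIntegrable_kernel hα).integrableOn_isCompact (isCompact_closedBall 0 _)
  have hmp := Measure.measurePreserving_sub_left (volume : Measure Plane) x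
  have hme := (MeasurableEquiv.subLeft x).measurableEmbedding
  have h2 : IntegrableOn (kernel α ∘ fun y => x - y)
      ((fun y => x - y) ⁻¹' Metric.closedBall 0 (‖x‖ + r)) :=
    (hmp.integrableOn_comp_preimage hme).2 h1
  refine IntegrableOn.mono_set h2 fun y hy => ?_
  rw [mem_preimage, mem_closedBall_zero_iff]
  exact (norm_sub_le _ _).trans (add_le_add le_rfl (mem_closedBall_zero_iff.1 (hr hy)))

/-- The `L¹` distance on a ball between the regularised kernel and its limit. -/
def kernelError (α R : ℝ) (m : ℕ) : ℝ :=
  ∫ y in Metric.closedBall (0 : Plane) R, |regKernel α (reg m) y - (1 - α) * kernel α y|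

theorem ae_plane_ne_zero : ∀ᵐ y : Plane, y ≠ 0 := by
  simp [ae_iff]

theorem integrableOn_regKernel (hδ : δ ≠ 0) (S : Set Plane) (hS : Bornology.IsBounded S)
    (x : Plane) : IntegrableOn (fun y => regKernel α δ (x - y)) S := by
  have h1 : Continuous fun y => regKernel α δ (x - y) :=
    (contDiff_regKernel hδ).continuous.comp (by fun_prop)
  obtain ⟨r, hr⟩ := (Metric.isBounded_iff_subset_closedBall 0).1 hS
  exact (h1.continuousOn.integrableOn_compact (isCompact_closedBall 0 r)).mono_set hr

theorem tendsto_kernelError (hα : α ∈ Ioo (0 : ℝ) 1) (R : ℝ) :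
    Tendsto (kernelError α R) atTop (𝓝 0) := by
  have hK : IntegrableOn (kernel α) (Metric.closedBall (0 : Plane) R) :=
    (locallyIntegrable_kernel hα).integrableOn_isCompact (isCompact_closedBall 0 R)
  have := tendsto_integral_of_dominated_convergence (μ := volume.restrict (Metric.closedBall 0 R))
    (F := fun m y => |regKernel α (reg m) y - (1 - α) * kernel α y|) (f := fun _ => (0 : ℝ))
    (fun y => 3 * kernel α y) (fun m => ?_) (hK.const_mul 3) (fun m => ?_) ?_
  · unfold kernelError
    simpa using this
  · have h1 := (contDiff_regKernel (α := α) (reg_ne_zero m)).continuous.measurable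
    have h2 := measurable_kernel (α := α)
    exact Measurable.aestronglyMeasurable (by fun_prop)
  · filter_upwards [ae_restrict_of_ae ae_plane_ne_zero] with y hy
    have h1 := regKernel_le hα (reg_ne_zero m) hy
    have h2 := regKernel_nonneg (δ := reg m) hα y
    have h3 := kernel_nonneg (α := α) y
    rw [Real.norm_eq_abs, abs_abs, abs_le]
    have h4 := hα.1
    have h5 := hα.2
    constructor <;> nlinarith
  · filter_upwards [ae_restrict_of_ae ae_plane_ne_zero] with y hy
    have := ((tendsto_regKernel (α := α) hy).sub_const ((1 - α) * kernel α y)).abs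
    simpa using this

theorem abs_regPotential_sub_le (hα : α ∈ Ioo (0 : ℝ) 1) {A : Set Plane} (hA : IsClosed A)
    {R R' : ℝ} (hR : ∀ y ∈ A, ‖y‖ ≤ R) {x : Plane} (hx : ‖x‖ ≤ R') (m : ℕ) :
    |regPotential α (reg m) A x - (1 - α) * potential α (A.indicator fun _ => 1) x| ≤
      kernelError α (R' + R) m := by
  have hb : Bornology.IsBounded A := (Metric.isBounded_iff_subset_closedBall 0).2
    ⟨R, fun y hy => mem_closedBall_zero_iff.2 (hR y hy)⟩
  have i1 := integrableOn_regKernel (α := α) (reg_ne_zero m) A hb x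
  have i2 := integrableOn_kernel_sub hα x hb
  rw [potential_indicator hA, regPotential, ← integral_const_mul,
    ← integral_sub i1 (i2.const_mul _)]
  refine (abs_integral_le_integral_abs).trans ?_
  set g : Plane → ℝ := fun y => |regKernel α (reg m) y - (1 - α) * kernel α y| with hg
  have hgi : IntegrableOn g (Metric.closedBall 0 (R' + R)) := by
    have hK : IntegrableOn (kernel α) (Metric.closedBall (0 : Plane) (R' + R)) :=
      (locallyIntegrable_kernel hα).integrableOn_isCompact (isCompact_closedBall 0 _)
    have hr := (contDiff_regKernel (α :=
        α) (reg_ne_zero m)).continuous.continuousOn.integrableOn_compact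
      (μ := volume) (isCompact_closedBall (0 : Plane) (R' + R))
    exact (hr.sub (hK.const_mul _)).abs
  have hmp := Measure.measurePreserving_sub_left (volume : Measure Plane) x
  have hme := (MeasurableEquiv.subLeft x).measurableEmbedding
  have e : ∫ y in (fun y => x - y) ⁻¹' Metric.closedBall 0 (R' + R), g (x - y) =
      kernelError α (R' + R) m := hmp.setIntegral_preimage_emb hme g _
  rw [← e]
  refine setIntegral_mono_set ?_ (Eventually.of_forall fun y => abs_nonneg _) ?_
  · exact (hmp.integrableOn_comp_preimage hme).2 hgi
  · refine LE.le.eventuallyLE fun y hy => ?_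
    rw [mem_preimage, mem_closedBall_zero_iff]
    exact (norm_sub_le _ _).trans (add_le_add hx (hR y hy))

/-! ### Continuity of the potential of a moving region -/

/-- The regularised potential as a boundary integral: `k_δ` is a divergence. -/
theorem IsBoundaryParam.regPotential_eq {A : Set Plane} {γ : ℝ → Plane} (h : IsBoundaryParam A γ)
    (hA : IsClosed A) (hb : Bornology.IsBounded A) (hδ : δ ≠ 0) (x : Plane) :
    regPotential α δ A x = -∫ s in (0 : ℝ)..1,
      (‖γ s - x‖ ^ 2 + δ ^ 2) ^ (-(1 + α) / 2) * inner ℝ (perp (deriv γ s)) (γ s - x) := by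
  set a : ℝ := -(1 + α) / 2 with ha
  have hρ0 : ∀ y : Plane, 0 < ‖y - x‖ ^ 2 + δ ^ 2 := fun y => by positivity
  set F : Fin 2 → Plane → ℝ := fun i y => (‖y - x‖ ^ 2 + δ ^ 2) ^ a * (y - x) i with hF
  have hsub : ContDiff ℝ 1 fun y : Plane => y - x := contDiff_id.sub contDiff_const
  have hFc : ∀ i, ContDiff ℝ 1 (F i) := fun i =>
    ((((contDiff_norm_sq ℝ).comp hsub).add contDiff_const).rpow_const_of_ne
      fun y => (hρ0 y).ne').mul
      ((EuclideanSpace.proj i : Plane →L[ℝ] ℝ).contDiff.comp hsub)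
  have hFd : ∀ i y, fderiv ℝ (F i) y (EuclideanSpace.single i 1) =
      (‖y - x‖ ^ 2 + δ ^ 2) ^ a +
        2 * a * (‖y - x‖ ^ 2 + δ ^ 2) ^ (a - 1) * (y - x) i ^ 2 := by
    intro i y
    have h1 : HasFDerivAt (fun y : Plane => ‖y - x‖ ^ 2 + δ ^ 2) (2 • innerSL ℝ (y - x)) y :=
      (((hasFDerivAt_id y).sub_const x).norm_sq.add_const _).congr_fderiv (by ext; simp)
    have h2 := h1.rpow_const (p := a) (Or.inl (hρ0 y).ne')
    have h3 : HasFDerivAt (fun y : Plane => (y - x) i) (EuclideanSpace.proj i : Plane →L[ℝ] ℝ) y :=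
      (EuclideanSpace.proj i : Plane →L[ℝ] ℝ).hasFDerivAt.comp y ((hasFDerivAt_id y).sub_const x)
    have h4 : HasFDerivAt (F i) _ y := h2.mul h3
    rw [h4.fderiv]
    simp [EuclideanSpace.inner_single_right]
    ring
  have hdiv : ∀ y, regKernel α δ (x - y) = fderiv ℝ (F 0) y (EuclideanSpace.single 0 1) +
      fderiv ℝ (F 1) y (EuclideanSpace.single 1 1) := by
    intro y
    have e1 : (‖y - x‖ ^ 2 + δ ^ 2) ^ a =
        (‖y - x‖ ^ 2 + δ ^ 2) ^ (a - 1) * (‖y - x‖ ^ 2 + δ ^ 2) := by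
      rw [← Real.rpow_add_one (hρ0 y).ne']; congr 1; ring
    have e2 : -(3 + α) / 2 = a - 1 := by rw [ha]; ring
    rw [regKernel_sub_comm, regKernel, e2, hFd, hFd, e1]
    have e3 := norm_sq_plane (y - x)
    have e4 : 2 * a = -(1 + α) := by rw [ha]; ring
    rw [e4]
    have e5 : (y - x) 1 ^ 2 = ‖y - x‖ ^ 2 - (y - x) 0 ^ 2 := by rw [e3]; ring
    rw [e5]
    ring
  have hAc := Metric.isCompact_of_isClosed_isBounded hA hb
  have hint : ∀ i, IntegrableOn (fun y => fderiv ℝ (F i) y (EuclideanSpace.single i 1)) A :=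
    fun i => (((hFc i).continuous_fderiv (by norm_num)).clm_apply
      continuous_const).continuousOn.integrableOn_compact hAc
  have hγ := h.continuous
  have hγ' := h.continuous_deriv
  have hp := continuous_perp
  have hii : ∀ i, IntervalIntegrable (fun s => F i (γ s) *
      inner ℝ (perp (deriv γ s)) (EuclideanSpace.single i 1)) volume 0 1 := fun i => by
    have h1 := (hFc i).continuous.comp hγ
    have h2 : Continuous fun s => inner ℝ (perp (deriv γ s)) (EuclideanSpace.single i (1 : ℝ)) := by
      fun_prop
    exact (h1.mul h2).intervalIntegrable _ _
  simp only [regPotential, hdiv]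
  rw [integral_add (hint 0) (hint 1), h.green hA hb (hFc 0), h.green hA hb (hFc 1), ← neg_add,
    ← intervalIntegral.integral_add (hii 0) (hii 1)]
  congr 1
  refine intervalIntegral.integral_congr fun s _ => ?_
  simp only [hF, EuclideanSpace.inner_single_right, inner_plane]
  simp
  ring

/-- The potential of the regions bounded by a front is continuous in time and space. -/
theorem IsFront.continuous_potential {A : ℝ → Set Plane} {w : ℝ → ℝ → Plane} (h : IsFront A w)
    (hα : α ∈ Ioo (0 : ℝ) 1) :
    Continuous fun p : ℝ × Plane => potential α ((A p.1).indicator fun _ => 1) p.2 := by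
  have hw := h.continuous
  have hw' := h.continuous_deriv
  have hp := continuous_perp
  have hreg : ∀ m, Continuous fun p : ℝ × Plane => regPotential α (reg m) (A p.1) p.2 := by
    intro m
    simp only [fun p : ℝ × Plane => (h.param p.1).regPotential_eq (α := α) (h.isClosed p.1)
        (h.isBounded p.1)
      (reg_ne_zero m) p.2]
    refine Continuous.neg ?_
    apply intervalIntegral.continuous_parametric_intervalIntegral_of_continuous'
    have c1 : Continuous fun q : (ℝ × Plane) × ℝ => w q.1.1 q.2 :=
      hw.comp (by fun_prop : Continuous fun q : (ℝ × Plane) × ℝ => (q.1.1, q.2))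
    have c2 : Continuous fun q : (ℝ × Plane) × ℝ => deriv (w q.1.1) q.2 :=
      hw'.comp (by fun_prop : Continuous fun q : (ℝ × Plane) × ℝ => (q.1.1, q.2))
    have c3 : Continuous fun q : (ℝ × Plane) × ℝ => w q.1.1 q.2 - q.1.2 := by fun_prop
    refine Continuous.mul ?_ ((hp.comp c2).inner c3)
    refine Continuous.rpow_const (by fun_prop) fun q => Or.inl ?_
    have : 0 < reg m ^ 2 := by have := reg_ne_zero m; positivity
    have := sq_nonneg ‖w q.1.1 q.2 - q.1.2‖
    positivity
  have hα' : (1 - α) ≠ 0 := (sub_pos.2 hα.2).ne'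
  suffices hs : Continuous fun p : ℝ × Plane =>
      (1 - α) * potential α ((A p.1).indicator fun _ => 1) p.2 by
    refine (hs.const_mul (1 - α)⁻¹).congr fun p => ?_
    rw [← mul_assoc, inv_mul_cancel₀ hα', one_mul]
  rw [← continuousOn_univ]
  refine TendstoLocallyUniformlyOn.continuousOn
    (F := fun m (p : ℝ × Plane) => regPotential α (reg m) (A p.1) p.2) (p := atTop) ?_
    (Frequently.of_forall fun m => (hreg m).continuousOn)
  rw [tendstoLocallyUniformlyOn_univ, Metric.tendstoLocallyUniformly_iff]
  rintro ε hε ⟨t, x⟩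
  obtain ⟨R, hR, hRb⟩ := exists_bound_of_periodic hw (fun t => (h.param t).periodic)
    (isCompact_Icc (a := t - 1) (b := t + 1))
  refine ⟨{p | p.1 ∈ Icc (t - 1) (t + 1) ∧ ‖p.2‖ < ‖x‖ + 1}, ?_, ?_⟩
  · refine Filter.inter_mem ?_ ?_
    · exact continuous_fst.continuousAt.preimage_mem_nhds (Icc_mem_nhds (by simp) (by simp))
    · have c1 : Continuous fun p : ℝ × Plane => ‖p.2‖ := by fun_prop
      exact (isOpen_lt c1 continuous_const).mem_nhds (show ‖x‖ < ‖x‖ + 1 by linarith)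
  · filter_upwards [(tendsto_kernelError hα (‖x‖ + 1 + R)).eventually (gt_mem_nhds hε)] with m hm
    rintro p ⟨hp1, hp2⟩
    rw [dist_comm, Real.dist_eq]
    refine (abs_regPotential_sub_le hα (h.isClosed p.1) (R := R) (fun y hy =>
        ?_) hp2.le m).trans_lt hm
    by_cases hy0 : y = 0
    · simp [hy0, hR.le]
    · refine norm_le_of_frontier (h.isBounded p.1) (fun z hz => ?_) hy hy0
      rw [← (h.param p.1).range_eq] at hz
      obtain ⟨s, rfl⟩ := hz
      exact hRb p.1 hp1 s

/-! ### The tangential derivative of the potential along the boundary -/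

variable {A : Set Plane} {γ : ℝ → Plane}

/-- The tangential derivative of the regularised potential, in weak form: integration by parts in
`s` under the integral over the region, on which the divergence theorem is then applied. -/
theorem IsBoundaryParam.integral_regPotential_mul_deriv (h : IsBoundaryParam A γ)
    (hA : IsClosed A) (hb : Bornology.IsBounded A) (hδ : δ ≠ 0) {β : ℝ → ℝ} (hβ : ContDiff ℝ 1 β)
    (hβp : Function.Periodic β 1) :
    ∫ s in (0 : ℝ)..1, regPotential α δ A (γ s) * deriv β s =
      ∫ s in (0 : ℝ)..1, β s * ∫ s' in (0 : ℝ)..1,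
        regKernel α δ (γ s - γ s') * inner ℝ (deriv γ s') (perp (deriv γ s)) := by
  have hAc := Metric.isCompact_of_isClosed_isBounded hA hb
  have hk : ContDiff ℝ 1 (regKernel α δ) := (contDiff_regKernel hδ).of_le (by exact_mod_cast le_top)
  have hkc := hk.continuous
  have hkd : Continuous (fderiv ℝ (regKernel α δ)) := hk.continuous_fderiv (by norm_num)
  have hγ := h.continuous
  have hγ' := h.continuous_deriv
  have hβc := hβ.continuous
  have hβ' : Continuous (deriv β) := hβ.continuous_deriv (by norm_num)
  have hswap : ∀ f : ℝ → Plane → ℝ, Continuous (Function.uncurry f) →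
      ∫ s in (0 : ℝ)..1, ∫ y in A, f s y = ∫ y in A, ∫ s in (0 : ℝ)..1, f s y := by
    intro f hf
    apply intervalIntegral_integral_swap
    rw [Measure.prod_restrict, uIoc_of_le zero_le_one]
    exact (hf.continuousOn.integrableOn_compact (isCompact_Icc.prod hAc)).mono_set
      (prod_mono Ioc_subset_Icc_self subset_rfl)
  have e1 : ∫ s in (0 : ℝ)..1, regPotential α δ A (γ s) * deriv β s =
      ∫ s in (0 : ℝ)..1, ∫ y in A, regKernel α δ (γ s - y) * deriv β s := by
    simp only [regPotential, integral_mul_const]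
  have e2 : ∀ y, ∫ s in (0 : ℝ)..1, regKernel α δ (γ s - y) * deriv β s =
      ∫ s in (0 : ℝ)..1, -(fderiv ℝ (regKernel α δ) (γ s - y) (deriv γ s) * β s) := by
    intro y
    have hd : ∀ s ∈ uIcc (0 : ℝ) 1, HasDerivAt (fun s => regKernel α δ (γ s - y))
        (fderiv ℝ (regKernel α δ) (γ s - y) (deriv γ s)) s := fun s _ =>
      ((hk.differentiable (by norm_num) _).hasFDerivAt).comp_hasDerivAt s
        ((h.hasDerivAt s).sub_const y)
    have c1 : Continuous fun s => fderiv ℝ (regKernel α δ) (γ s - y) (deriv γ s) := by fun_prop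
    rw [intervalIntegral.integral_mul_deriv_eq_deriv_mul hd
      (fun s _ => (hβ.differentiable (by norm_num) s).hasDerivAt) (c1.intervalIntegrable _ _)
      (hβ'.intervalIntegrable _ _), intervalIntegral.integral_neg]
    have p1 := h.periodic 0
    have p2 := hβp 0
    rw [zero_add] at p1 p2
    rw [p1, p2]
    ring
  rw [e1, hswap _ (by simp only [Function.uncurry_def]; fun_prop)]
  simp only [e2]
  rw [← hswap (fun s y => -(fderiv ℝ (regKernel α δ) (γ s - y) (deriv γ s) * β s))
    (by simp only [Function.uncurry_def]; fun_prop)]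
  refine intervalIntegral.integral_congr fun s _ => ?_
  rw [h.integral_regKernel hA hb hδ, perp_perp, integral_neg, integral_mul_const, mul_comm,
      ← mul_neg]
  congr 2
  refine setIntegral_congr_fun hA.measurableSet fun y _ => ?_
  have hd : HasFDerivAt (fun y => regKernel α δ (γ s - y))
      (-fderiv ℝ (regKernel α δ) (γ s - y)) y := by
    have h1 : HasFDerivAt (fun y => γ s - y) (-ContinuousLinearMap.id ℝ Plane) y :=
      (hasFDerivAt_id y).const_sub (γ s)
    refine ((hk.differentiable (by norm_num) (γ s - y)).hasFDerivAt.comp y h1).congr_fderiv ?_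
    ext; simp
  rw [hd.fderiv]
  simp

theorem IsBoundaryParam.exists_norm_le (h : IsBoundaryParam A γ)
    (hb : Bornology.IsBounded A) : ∃ R, (∀ y ∈ A, ‖y‖ ≤ R) ∧ ∀ s, ‖γ s‖ ≤ R := by
  have hc : Bornology.IsBounded (range γ) := by
    rw [h.range_eq]
    exact hb.closure.subset frontier_subset_closure
  obtain ⟨R₁, h1⟩ := hb.exists_norm_le
  obtain ⟨R₂, h2⟩ := hc.exists_norm_le
  exact ⟨max R₁ R₂, fun y hy => (h1 y hy).trans (le_max_left _ _),
    fun s => (h2 _ (mem_range_self s)).trans (le_max_right _ _)⟩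

theorem IsBoundaryParam.continuous_potential_comp (h : IsBoundaryParam A γ)
    (hA : IsClosed A) (hb : Bornology.IsBounded A) (hα : α ∈ Ioo (0 : ℝ) 1) :
    Continuous fun s => potential α (A.indicator fun _ => 1) (γ s) := by
  have h1 : Continuous fun p : ℝ × Plane => potential α (A.indicator fun _ => 1) p.2 :=
    (h.isFront hA hb).continuous_potential hα
  have c : Continuous fun s => ((0 : ℝ), γ s) := continuous_const.prodMk h.continuous
  have h2 := h1.comp c
  simpa only [Function.comp_def] using h2

theorem IsBoundaryParam.tendsto_integral_regPotential (h : IsBoundaryParam A γ)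
    (hA : IsClosed A) (hb : Bornology.IsBounded A) (hα : α ∈ Ioo (0 : ℝ) 1) {g : ℝ → ℝ}
    (hg : Continuous g) :
    Tendsto (fun m => ∫ s in (0 : ℝ)..1, regPotential α (reg m) A (γ s) * g s) atTop
      (𝓝 (∫ s in (0 : ℝ)..1,
        ((1 - α) * potential α (A.indicator fun _ => 1) (γ s)) * g s)) := by
  obtain ⟨R, hAR, hRb⟩ := h.exists_norm_le hb
  have hVc := h.continuous_potential_comp hA hb hα
  have hregc : ∀ m, Continuous fun s => regPotential α (reg m) A (γ s) := by
    intro m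
    have hk := (contDiff_regKernel (α := α) (reg_ne_zero m)).continuous
    have hγ := h.continuous
    exact continuous_parametric_integral_of_continuous (f := fun s y => regKernel α (reg m)
        (γ s - y))
      (by fun_prop) (Metric.isCompact_of_isClosed_isBounded hA hb)
  have herr := tendsto_kernelError hα (R + R)
  have hclose := fun s m => abs_regPotential_sub_le hα hA hAR (hRb s) m
  obtain ⟨E, hE⟩ := herr.bddAbove_range
  refine intervalIntegral.tendsto_integral_filter_of_dominated_convergence
    (fun s => (E + |(1 - α) * potential α (A.indicator fun _ => 1) (γ s)|) * |g s|)
    (Eventually.of_forall fun m => ((hregc m).mul hg).aestronglyMeasurable)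
    (Eventually.of_forall fun m => Eventually.of_forall fun s _ => ?_)
    (Continuous.intervalIntegrable ?_ _ _) (Eventually.of_forall fun s _ => ?_)
  · rw [norm_mul, Real.norm_eq_abs, Real.norm_eq_abs]
    refine mul_le_mul_of_nonneg_right ?_ (abs_nonneg _)
    have a1 := hclose s m
    have a2 := hE (mem_range_self m)
    have a3 := abs_sub_abs_le_abs_sub (regPotential α (reg m) A (γ s))
      ((1 - α) * potential α (A.indicator fun _ => 1) (γ s))
    linarith
  · exact (continuous_const.add (continuous_const.mul hVc).abs).mul hg.abs
  · refine Tendsto.mul_const _ ?_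
    rw [tendsto_iff_dist_tendsto_zero]
    exact squeeze_zero (fun _ => dist_nonneg) (hclose s) herr

theorem IsBoundaryParam.tendsto_integral_regKernel (h : IsBoundaryParam A γ)
    (hA : IsClosed A) (hb : Bornology.IsBounded A) (hα : α ∈ Ioo (0 : ℝ) 1) {β : ℝ → ℝ}
    (hβ : Continuous β) :
    Tendsto (fun m => ∫ s in (0 : ℝ)..1, β s * ∫ s' in (0 : ℝ)..1,
        regKernel α (reg m) (γ s - γ s') * inner ℝ (deriv γ s') (perp (deriv γ s))) atTop
      (𝓝 (∫ s in (0 : ℝ)..1, β s * ((1 - α) * circ α γ (γ s) (perp (deriv γ s))))) := by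
  have hF := h.isFront hA hb
  have hn : ∀ s, inner ℝ (deriv γ s) (perp (deriv γ s)) = 0 := fun s => by
    rw [real_inner_comm, inner_perp_self]
  obtain ⟨C, hC, hCb⟩ := hF.regKernel_circ_bound hα 0
  have hγ := h.continuous
  have hγ' := h.continuous_deriv
  have hp := continuous_perp
  refine intervalIntegral.tendsto_integral_filter_of_dominated_convergence
    (fun s => |β s| * (C * ‖perp (deriv γ s)‖))
    (Eventually.of_forall fun m => ?_)
    (Eventually.of_forall fun m => Eventually.of_forall fun s _ => ?_)
    (Continuous.intervalIntegrable ?_ _ _) (Eventually.of_forall fun s _ => ?_)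
  · have hk := (contDiff_regKernel (α := α) (reg_ne_zero m)).continuous
    refine (hβ.mul ?_).aestronglyMeasurable
    apply intervalIntegral.continuous_parametric_intervalIntegral_of_continuous'
    simp only [Function.uncurry_def]
    fun_prop
  · rw [norm_mul, Real.norm_eq_abs]
    exact mul_le_mul_of_nonneg_left (hCb s _ (hn s) _ (reg_ne_zero m)) (abs_nonneg _)
  · exact hβ.abs.mul (continuous_const.mul (hp.comp hγ').norm)
  · exact (hF.tendsto_regKernel_circ hα 0 s (hn s)).const_mul _

/-- The tangential derivative of the potential along the boundary, in weak form. -/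
theorem IsBoundaryParam.integral_potential_mul_deriv (h : IsBoundaryParam A γ)
    (hA : IsClosed A) (hb : Bornology.IsBounded A) (hα : α ∈ Ioo (0 : ℝ) 1) {β : ℝ → ℝ}
    (hβ : ContDiff ℝ 1 β) (hβp : Function.Periodic β 1) :
    ∫ s in (0 : ℝ)..1, potential α (A.indicator fun _ => 1) (γ s) * deriv β s =
      ∫ s in (0 : ℝ)..1, β s * circ α γ (γ s) (perp (deriv γ s)) := by
  have hα' : (1 - α) ≠ 0 := (sub_pos.2 hα.2).ne'
  have t1 := h.tendsto_integral_regPotential hA hb hα (hβ.continuous_deriv (by norm_num))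
  have t2 := h.tendsto_integral_regKernel hA hb hα hβ.continuous
  simp only [h.integral_regPotential_mul_deriv hA hb (reg_ne_zero _) hβ hβp] at t1
  have := tendsto_nhds_unique t1 t2
  have r1 : ∀ s, (1 - α) * potential α (A.indicator fun _ => 1) (γ s) * deriv β s =
      (1 - α) * (potential α (A.indicator fun _ => 1) (γ s) * deriv β s) := fun s => mul_assoc _ _ _
  have r2 : ∀ s, β s * ((1 - α) * circ α γ (γ s) (perp (deriv γ s))) =
      (1 - α) * (β s * circ α γ (γ s) (perp (deriv γ s))) := fun s => mul_left_comm _ _ _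
  simp only [r1, r2] at this
  rw [intervalIntegral.integral_const_mul, intervalIntegral.integral_const_mul] at this
  exact mul_left_cancel₀ hα' this

end

/-! ### Transport of an integral over a moving region -/

theorem tendsto_double_integral {F : ℕ → ℝ → ℝ → ℝ} {f : ℝ → ℝ → ℝ} {a b M : ℝ} (hab : a ≤ b)
    (hF : ∀ n, Continuous (fun p : ℝ × ℝ => F n p.1 p.2))
    (hM : ∀ n, ∀ t ∈ Icc a b, ∀ s, ‖F n t s‖ ≤ M)
    (hlim : ∀ t s, Tendsto (fun n => F n t s) atTop (𝓝 (f t s))) :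
    Tendsto (fun n => ∫ t in a..b, ∫ s in (0 : ℝ)..1, F n t s) atTop
      (𝓝 (∫ t in a..b, ∫ s in (0 : ℝ)..1, f t s)) := by
  have hmem : ∀ t ∈ uIoc a b, t ∈ Icc a b := fun t ht => by
    rw [uIoc_of_le hab] at ht; exact Ioc_subset_Icc_self ht
  refine intervalIntegral.tendsto_integral_filter_of_dominated_convergence (fun _ => M)
    (Eventually.of_forall fun n => ?_)
    (Eventually.of_forall fun n => Eventually.of_forall fun t ht => ?_)
    intervalIntegrable_const (Eventually.of_forall fun t ht => ?_)
  · exact (intervalIntegral.continuous_parametric_intervalIntegral_of_continuous'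
      (f := F n) (hF n) 0 1).aestronglyMeasurable
  · have := intervalIntegral.norm_integral_le_of_norm_le_const (a := 0) (b := 1)
      (f := F n t) (C := M) fun s _ => hM n t (hmem t ht) s
    simpa using this
  · refine intervalIntegral.tendsto_integral_filter_of_dominated_convergence (fun _ => M)
      (Eventually.of_forall fun n => ?_)
      (Eventually.of_forall fun n => Eventually.of_forall fun s hs => hM n t (hmem t ht) s)
      intervalIntegrable_const (Eventually.of_forall fun s hs => hlim t s)
    exact ((hF n).comp (by fun_prop : Continuous fun s : ℝ => (t, s))).aestronglyMeasurable

section Calculus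

variable {q h : ℝ → ℝ → ℝ}

theorem hasDerivAt_left (hq : ContDiff ℝ 1 (fun p : ℝ × ℝ => q p.1 p.2)) (t s : ℝ) :
    HasDerivAt (fun τ => q τ s) (deriv (fun τ => q τ s) t) t :=
  (((hq.comp (contDiff_id.prodMk contDiff_const : ContDiff ℝ 1 fun τ : ℝ => (τ, s))).differentiable
    (by norm_num)) t).hasDerivAt

theorem hasDerivAt_right (hq : ContDiff ℝ 1 (fun p : ℝ × ℝ => q p.1 p.2)) (t s : ℝ) :
    HasDerivAt (q t) (deriv (q t) s) s :=
  (((hq.comp (contDiff_const.prodMk contDiff_id : ContDiff ℝ 1 fun σ : ℝ => (t, σ))).differentiable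
    (by norm_num)) s).hasDerivAt

theorem continuous_deriv_left (hq : ContDiff ℝ 1 (fun p : ℝ × ℝ => q p.1 p.2)) :
    Continuous fun p : ℝ × ℝ => deriv (fun τ => q τ p.2) p.1 := by
  have : (fun p : ℝ × ℝ => deriv (fun τ => q τ p.2) p.1) =
      fun p : ℝ × ℝ => fderiv ℝ (fun p : ℝ × ℝ => q p.1 p.2) p (1, 0) := by
    ext ⟨t, s⟩
    have h1 : HasDerivAt (fun τ : ℝ => (τ, s)) ((1, 0) : ℝ × ℝ) t :=
      (hasDerivAt_id t).prodMk (hasDerivAt_const t s)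
    exact (((hq.differentiable (by norm_num) (t, s)).hasFDerivAt).comp_hasDerivAt t h1).deriv
  rw [this]
  exact (hq.continuous_fderiv (by norm_num)).clm_apply continuous_const

theorem continuous_deriv_right (hq : ContDiff ℝ 1 (fun p : ℝ × ℝ => q p.1 p.2)) :
    Continuous fun p : ℝ × ℝ => deriv (q p.1) p.2 := by
  have : (fun p : ℝ × ℝ => deriv (q p.1) p.2) =
      fun p : ℝ × ℝ => fderiv ℝ (fun p : ℝ × ℝ => q p.1 p.2) p (0, 1) := by
    ext ⟨t, s⟩
    have h1 : HasDerivAt (fun σ : ℝ => (t, σ)) ((0, 1) : ℝ × ℝ) s :=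
      (hasDerivAt_const s t).prodMk (hasDerivAt_id s)
    exact (((hq.differentiable (by norm_num) (t, s)).hasFDerivAt).comp_hasDerivAt s h1).deriv
  rw [this]
  exact (hq.continuous_fderiv (by norm_num)).clm_apply continuous_const

theorem periodic_deriv_left (hp : ∀ t, Function.Periodic (h t) 1) (t : ℝ) :
    Function.Periodic (fun s => deriv (fun τ => h τ s) t) 1 := fun s => by
  have : (fun τ => h τ (s + 1)) = fun τ => h τ s := funext fun τ => hp τ s
  simp only [this]

theorem periodic_deriv_right (hp : ∀ t, Function.Periodic (h t) 1) (t : ℝ) :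
    Function.Periodic (deriv (h t)) 1 := fun s => by
  have : (fun x => h t (x + 1)) = h t := funext (hp t)
  rw [← deriv_comp_add_const, this]

theorem exists_lipschitz_of_periodic (hh : ContDiff ℝ 1 (fun p : ℝ × ℝ => h p.1 p.2))
    (hp : ∀ t, Function.Periodic (h t) 1) (a b : ℝ) :
    ∃ M, 0 < M ∧ ∀ t ∈ Icc a b, ∀ s x, ‖h t (s + x) - h t s‖ ≤ M * |x| := by
  obtain ⟨M, hM, hb⟩ := exists_bound_of_periodic (f := fun t s => deriv (h t) s)
    (continuous_deriv_right hh) (periodic_deriv_right hp) (isCompact_Icc (a := a) (b := b))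
  refine ⟨M, hM, fun t ht s x => ?_⟩
  have := (convex_univ : Convex ℝ (univ : Set ℝ)).norm_image_sub_le_of_norm_deriv_le
    (f := h t) (C := M) (x := s) (y := s + x)
    (fun y _ => (hasDerivAt_right hh t y).differentiableAt)
    (fun y _ => hb t ht y) (mem_univ _) (mem_univ _)
  simpa using this

theorem tendsto_diff_quotient {f : ℝ → ℝ} {f' s : ℝ} (hf : HasDerivAt f f' s) :
    Tendsto (fun n => (reg n)⁻¹ * (f (s + reg n) - f s)) atTop (𝓝 f') := by
  have h1 := hasDerivAt_iff_tendsto_slope_zero.1 hf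
  have h2 : Tendsto reg atTop (𝓝[≠] 0) :=
    tendsto_nhdsWithin_iff.2 ⟨tendsto_reg, Eventually.of_forall reg_ne_zero⟩
  simpa [Function.comp_def] using h1.comp h2

/-- `∫ dq ∧ dh = 0` for functions of class `C¹` only: one derivative is replaced by a difference
quotient, the other one is then moved by parts. -/
theorem integral_deriv_mul_deriv_comm (hq : ContDiff ℝ 1 (fun p : ℝ × ℝ => q p.1 p.2))
    (hh : ContDiff ℝ 1 (fun p : ℝ × ℝ => h p.1 p.2)) (hqp : ∀ t, Function.Periodic (q t) 1)
    (hhp : ∀ t, Function.Periodic (h t) 1) {a b : ℝ} (hab : a ≤ b) (hqa : ∀ s, q a s = 0)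
    (hqb : ∀ s, q b s = 0) :
    ∫ t in a..b, ∫ s in (0 : ℝ)..1, deriv (fun τ => q τ s) t * deriv (h t) s =
      ∫ t in a..b, ∫ s in (0 : ℝ)..1, deriv (q t) s * deriv (fun τ => h τ s) t := by
  have cq := hq.continuous
  have ch := hh.continuous
  have cqt := continuous_deriv_left hq
  have cht := continuous_deriv_left hh
  have hshift : ∀ {f : ℝ → ℝ → ℝ}, Continuous (fun p : ℝ × ℝ => f p.1 p.2) → ∀ e,
      Continuous fun p : ℝ × ℝ => f p.1 (p.2 + e) := fun hf e =>
    hf.comp (by fun_prop : Continuous fun p : ℝ × ℝ => (p.1, p.2 + e))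
  have hsec : ∀ {f : ℝ → ℝ → ℝ}, Continuous (fun p : ℝ × ℝ => f p.1 p.2) → ∀ t,
      Continuous (f t) := fun hf t =>
    hf.comp (by fun_prop : Continuous fun s : ℝ => (t, s))
  have hsec' : ∀ {f : ℝ → ℝ → ℝ}, Continuous (fun p : ℝ × ℝ => f p.1 p.2) → ∀ s,
      Continuous (fun t => f t s) := fun hf s =>
    hf.comp (by fun_prop : Continuous fun t : ℝ => (t, s))
  have hswap : ∀ f : ℝ → ℝ → ℝ, Continuous (fun p : ℝ × ℝ => f p.1 p.2) →
      ∫ t in a..b, ∫ s in (0 : ℝ)..1, f t s = ∫ s in (0 : ℝ)..1, ∫ t in a..b, f t s := by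
    intro f hf
    apply intervalIntegral_intervalIntegral_swap
    rw [uIoc_of_le hab, uIoc_of_le zero_le_one]
    exact (hf.continuousOn.integrableOn_compact (isCompact_Icc.prod isCompact_Icc)).mono_set
      (prod_mono Ioc_subset_Icc_self Ioc_subset_Icc_self)
  have cF : ∀ e, Continuous fun p : ℝ × ℝ =>
      deriv (fun τ => q τ p.2) p.1 * (e⁻¹ * (h p.1 (p.2 + e) - h p.1 p.2)) := fun e =>
    cqt.mul (continuous_const.mul ((hshift ch e).sub ch))
  have cG : ∀ e, Continuous fun p : ℝ × ℝ =>
      (e⁻¹ * (q p.1 (p.2 + e) - q p.1 p.2)) * deriv (fun τ => h τ (p.2 + e)) p.1 := fun e =>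
    (continuous_const.mul ((hshift cq e).sub cq)).mul (hshift (f := fun t s => deriv (fun τ =>
        h τ s) t) cht e)
  have hreg : ∀ e, ∫ t in a..b, ∫ s in (0 : ℝ)..1,
        deriv (fun τ => q τ s) t * (e⁻¹ * (h t (s + e) - h t s)) =
      ∫ t in a..b, ∫ s in (0 : ℝ)..1,
        (e⁻¹ * (q t (s + e) - q t s)) * deriv (fun τ => h τ (s + e)) t := by
    intro e
    rw [hswap (fun t s => deriv (fun τ => q τ s) t * (e⁻¹ * (h t (s + e) - h t s))) (cF e)]
    have e1 : ∀ s, ∫ t in a..b, deriv (fun τ => q τ s) t * (e⁻¹ * (h t (s + e) - h t s)) =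
        ∫ t in a..b, -(q t s * (e⁻¹ * (deriv (fun τ => h τ (s + e)) t -
          deriv (fun τ => h τ s) t))) := by
      intro s
      have hu : ∀ t ∈ uIcc a b, HasDerivAt (fun t => e⁻¹ * (h t (s + e) - h t s))
          (e⁻¹ * (deriv (fun τ => h τ (s + e)) t - deriv (fun τ => h τ s) t)) t := fun t _ =>
        ((hasDerivAt_left hh t (s + e)).sub (hasDerivAt_left hh t s)).const_mul _
      have c1 := hsec' (f := fun t s => deriv (fun τ => h τ s) t) cht
      have hparts := intervalIntegral.integral_mul_deriv_eq_deriv_mul hu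
        (fun t _ => hasDerivAt_left hq t s)
        ((continuous_const.mul ((c1 (s + e)).sub (c1 s))).intervalIntegrable _ _)
        ((hsec' (f := fun t s => deriv (fun τ => q τ s) t) cqt s).intervalIntegrable _ _)
      rw [hqa, hqb, mul_zero, mul_zero, sub_zero, zero_sub] at hparts
      rw [intervalIntegral.integral_neg]
      simp only [mul_comm (deriv (fun τ => q τ s) _), mul_comm (q _ s)]
      exact hparts
    simp only [e1]
    rw [← hswap (fun t s => -(q t s * (e⁻¹ * (deriv (fun τ => h τ (s + e)) t -
          deriv (fun τ => h τ s) t))))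
        (cq.mul (continuous_const.mul ((hshift (f := fun t s => deriv (fun τ =>
            h τ s) t) cht e).sub cht))).neg]
    refine intervalIntegral.integral_congr fun t _ => ?_
    -- Translation of the periodic function `q ∂_t h` by `e`.
    have hper : Function.Periodic (fun s => e⁻¹ * (q t s * deriv (fun τ => h τ s) t)) 1 :=
        fun s => by
      have := periodic_deriv_left hhp t s
      simp only at this
      simp only [this, hqp t s]
    have c1 := hsec cq t
    have c2 := hsec (f := fun t s => deriv (fun τ => h τ s) t) cht t
    have hs1 := hper.intervalIntegral_add_eq 0 e
    rw [zero_add, show e + 1 = 1 + e by ring] at hs1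
    have hs2 : ∫ s in (0 : ℝ)..1, e⁻¹ * (q t (s + e) * deriv (fun τ => h τ (s + e)) t) =
        ∫ s in (0 : ℝ)..1, e⁻¹ * (q t s * deriv (fun τ => h τ s) t) := by
      rw [hs1, intervalIntegral.integral_comp_add_right
        (fun s => e⁻¹ * (q t s * deriv (fun τ => h τ s) t)), zero_add]
    have c3 : Continuous fun s => q t (s + e) := c1.comp (by fun_prop)
    have c4 : Continuous fun s => deriv (fun τ => h τ (s + e)) t :=
      c2.comp (by fun_prop : Continuous fun s : ℝ => s + e)
    have l1 : ∀ s, -(q t s * (e⁻¹ * (deriv (fun τ => h τ (s + e)) t - deriv (fun τ => h τ s) t))) =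
        e⁻¹ * (q t s * deriv (fun τ => h τ s) t) -
          e⁻¹ * (q t s * deriv (fun τ => h τ (s + e)) t) := fun s => by ring
    have l2 : ∀ s, (e⁻¹ * (q t (s + e) - q t s)) * deriv (fun τ => h τ (s + e)) t =
        e⁻¹ * (q t (s + e) * deriv (fun τ => h τ (s + e)) t) -
          e⁻¹ * (q t s * deriv (fun τ => h τ (s + e)) t) := fun s => by ring
    simp only [l1, l2]
    rw [intervalIntegral.integral_sub, intervalIntegral.integral_sub, hs2]
    · exact (continuous_const.mul (c3.mul c4)).intervalIntegrable _ _
    · exact (continuous_const.mul (c1.mul c4)).intervalIntegrable _ _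
    · exact (continuous_const.mul (c1.mul c2)).intervalIntegrable _ _
    · exact (continuous_const.mul (c1.mul c4)).intervalIntegrable _ _
  obtain ⟨M₁, hM₁, hL₁⟩ := exists_lipschitz_of_periodic hh hhp a b
  obtain ⟨M₂, hM₂, hL₂⟩ := exists_lipschitz_of_periodic hq hqp a b
  obtain ⟨M₃, hM₃, hB₁⟩ := exists_bound_of_periodic (f := fun t s => deriv (fun τ => q τ s) t) cqt
    (periodic_deriv_left hqp) (isCompact_Icc (a := a) (b := b))
  obtain ⟨M₄, hM₄, hB₂⟩ := exists_bound_of_periodic (f := fun t s => deriv (fun τ => h τ s) t) cht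
    (periodic_deriv_left hhp) (isCompact_Icc (a := a) (b := b))
  have hquot : ∀ {M y : ℝ} (n : ℕ), ‖y‖ ≤ M * |reg n| → ‖(reg n)⁻¹ * y‖ ≤ M := fun n hy => by
    rw [norm_mul, norm_inv, Real.norm_eq_abs, inv_mul_le_iff₀ (abs_pos.2 (reg_ne_zero n)), mul_comm]
    exact hy
  have t1 := tendsto_double_integral hab (M := M₃ * M₁) (fun n => cF (reg n))
    (f := fun t s => deriv (fun τ => q τ s) t * deriv (h t) s)
    (fun n t ht s => by
      rw [norm_mul]
      exact mul_le_mul (hB₁ t ht s) (hquot n (hL₁ t ht s _)) (norm_nonneg _) hM₃.le)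
    (fun t s => (tendsto_diff_quotient (hasDerivAt_right hh t s)).const_mul _)
  have t2 := tendsto_double_integral hab (M := M₂ * M₄)
    (F := fun n t s => ((reg n)⁻¹ * (q t (s + reg n) - q t s)) * deriv (fun τ => h τ (s + reg n)) t)
    (fun n => cG (reg n))
    (f := fun t s => deriv (q t) s * deriv (fun τ => h τ s) t)
    (fun n t ht s => by
      rw [norm_mul]
      exact mul_le_mul (hquot n (hL₂ t ht s _)) (hB₂ t ht _) (norm_nonneg _) hM₂.le)
    (fun t s => (tendsto_diff_quotient (hasDerivAt_right hq t s)).mul (by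
      have hc : Continuous fun σ => deriv (fun τ => h τ σ) t :=
        hsec (f := fun t s => deriv (fun τ => h τ s) t) cht t
      have h1 : Tendsto (fun n => s + reg n) atTop (𝓝 s) := by
        simpa using tendsto_reg.const_add s
      exact (hc.tendsto s).comp h1))
  simp only [hreg] at t1
  exact tendsto_nhds_unique t1 t2

end Calculus

/-- The rate of change of `∫_{A(t)} f`, in weak form, for a function `f = ∂₀ G`. The integral is
`∫ G(w) ∂_s w₁ ds` by the divergence theorem, and `integral_deriv_mul_deriv_comm` for
`q = g G(w)` and `h = w₁` moves the time derivative from `g` to `w`. -/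
theorem IsFront.integral_time {A : ℝ → Set Plane} {w : ℝ → ℝ → Plane} (hF : IsFront A w)
    {G : Plane → ℝ} (hG : ContDiff ℝ 1 G) {g : ℝ → ℝ} (hg : ContDiff ℝ 1 g) {a b : ℝ} (hab : a ≤ b)
    (hga : g a = 0) (hgb : g b = 0) :
    ∫ t in a..b, deriv g t * ∫ x in A t, fderiv ℝ G x (EuclideanSpace.single 0 1) =
      ∫ t in a..b, ∫ s in (0 : ℝ)..1, g t * (fderiv ℝ G (w t s) (EuclideanSpace.single 0 1) *
        inner ℝ (deriv (fun τ => w τ s) t) (perp (deriv (w t) s))) := by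
  set q : ℝ → ℝ → ℝ := fun t s => g t * G (w t s) with hq
  set h : ℝ → ℝ → ℝ := fun t s => w t s 1 with hh
  have cq : ContDiff ℝ 1 (fun p : ℝ × ℝ => q p.1 p.2) :=
    (hg.comp contDiff_fst).mul (hG.comp hF.contDiff)
  have ch : ContDiff ℝ 1 (fun p : ℝ × ℝ => h p.1 p.2) :=
    (EuclideanSpace.proj (1 : Fin 2) : Plane →L[ℝ] ℝ).contDiff.comp hF.contDiff
  have hkey := integral_deriv_mul_deriv_comm cq ch
    (fun t s => by simp only [hq, (hF.param t).periodic s])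
    (fun t s => by simp only [hh, (hF.param t).periodic s]) hab
    (fun s => by simp [hq, hga]) (fun s => by simp [hq, hgb])
  have dws : ∀ t s, HasDerivAt (w t) (deriv (w t) s) s := fun t s => (hF.param t).hasDerivAt s
  have dwt : ∀ t s, HasDerivAt (fun τ => w τ s) (deriv (fun τ => w τ s) t) t := fun t s =>
    (hF.hasDerivAt_time t s).differentiableAt.hasDerivAt
  have dhs : ∀ t s, deriv (h t) s = deriv (w t) s 1 := fun t s =>
    ((EuclideanSpace.proj (1 : Fin 2) : Plane →L[ℝ] ℝ).hasFDerivAt.comp_hasDerivAt s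
        (dws t s)).deriv
  have dht : ∀ t s, deriv (fun τ => h τ s) t = deriv (fun τ => w τ s) t 1 := fun t s =>
    ((EuclideanSpace.proj (1 : Fin 2) : Plane →L[ℝ] ℝ).hasFDerivAt.comp_hasDerivAt t
        (dwt t s)).deriv
  have dGs : ∀ t s, HasDerivAt (fun σ => G (w t σ)) (fderiv ℝ G (w t s) (deriv (w t) s)) s :=
    fun t s => (hG.differentiable (by norm_num) _).hasFDerivAt.comp_hasDerivAt s (dws t s)
  have dGt : ∀ t s, HasDerivAt (fun τ => G (w τ s))
      (fderiv ℝ G (w t s) (deriv (fun τ => w τ s) t)) t :=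
    fun t s => (hG.differentiable (by norm_num) _).hasFDerivAt.comp_hasDerivAt t (dwt t s)
  have dgg : ∀ t, HasDerivAt g (deriv g t) t := fun t =>
    (hg.differentiable (by norm_num) t).hasDerivAt
  have dqs : ∀ t s, deriv (q t) s = g t * fderiv ℝ G (w t s) (deriv (w t) s) := fun t s =>
    ((dGs t s).const_mul _).deriv
  have dqt : ∀ t s, deriv (fun τ => q τ s) t = deriv g t * G (w t s) +
      g t * fderiv ℝ G (w t s) (deriv (fun τ => w τ s) t) := fun t s =>
    ((dgg t).mul (dGt t s)).deriv
  simp only [dqs, dqt, dhs, dht] at hkey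
  have hdec : ∀ (L : Plane →L[ℝ] ℝ) (v : Plane), L v = v 0 * L (EuclideanSpace.single 0 1) +
      v 1 * L (EuclideanSpace.single 1 1) := by
    intro L v
    have : v = v 0 • EuclideanSpace.single 0 1 + v 1 • EuclideanSpace.single 1 1 := by
      ext i; fin_cases i <;> simp
    conv_lhs => rw [this]
    simp
  have c0 := hG.continuous.comp hF.continuous
  have c1 := hF.continuous_deriv
  have c2 := hF.continuous_time
  have cg' : Continuous (deriv g) := hg.continuous_deriv (by norm_num)
  have cg := hg.continuous
  have cDG : Continuous fun p : ℝ × ℝ => fderiv ℝ G (w p.1 p.2) :=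
    (hG.continuous_fderiv (by norm_num)).comp hF.continuous
  have hlhs : ∀ t, deriv g t * ∫ x in A t, fderiv ℝ G x (EuclideanSpace.single 0 1) =
      ∫ s in (0 : ℝ)..1, deriv g t * (G (w t s) * deriv (w t) s 1) := by
    intro t
    rw [(hF.param t).green (hF.isClosed t) (hF.isBounded t) hG, intervalIntegral.integral_const_mul,
      ← intervalIntegral.integral_neg]
    congr 1
    refine intervalIntegral.integral_congr fun s _ => ?_
    simp [EuclideanSpace.inner_single_right]
  simp only [hlhs]
  have hsub : ∀ {f₁ f₂ : ℝ → ℝ → ℝ}, Continuous (fun p : ℝ × ℝ => f₁ p.1 p.2) →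
      Continuous (fun p : ℝ × ℝ => f₂ p.1 p.2) →
      ∫ t in a..b, ∫ s in (0 : ℝ)..1, (f₁ t s - f₂ t s) =
        (∫ t in a..b, ∫ s in (0 : ℝ)..1, f₁ t s) - ∫ t in a..b, ∫ s in (0 : ℝ)..1, f₂ t s := by
    intro f₁ f₂ h₁ h₂
    rw [← intervalIntegral.integral_sub]
    · refine intervalIntegral.integral_congr fun t _ => ?_
      exact intervalIntegral.integral_sub
        ((h₁.comp (by fun_prop : Continuous fun s : ℝ => (t, s))).intervalIntegrable _ _)
        ((h₂.comp (by fun_prop : Continuous fun s : ℝ => (t, s))).intervalIntegrable _ _)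
    · exact (intervalIntegral.continuous_parametric_intervalIntegral_of_continuous'
        (f := f₁) h₁ 0 1).intervalIntegrable _ _
    · exact (intervalIntegral.continuous_parametric_intervalIntegral_of_continuous'
        (f := f₂) h₂ 0 1).intervalIntegrable _ _
  have c1' : Continuous fun p : ℝ × ℝ => deriv (w p.1) p.2 1 := by fun_prop
  have c2' : Continuous fun p : ℝ × ℝ => deriv (fun τ => w τ p.2) p.1 1 := by fun_prop
  have cA : Continuous fun p : ℝ × ℝ => (deriv g p.1 * G (w p.1 p.2) +
      g p.1 * fderiv ℝ G (w p.1 p.2) (deriv (fun τ => w τ p.2) p.1)) * deriv (w p.1) p.2 1 := by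
    have := cDG.clm_apply c2
    exact (((cg'.comp continuous_fst).mul c0).add ((cg.comp continuous_fst).mul this)).mul c1'
  have cB : Continuous fun p : ℝ × ℝ =>
      g p.1 * fderiv ℝ G (w p.1 p.2) (deriv (w p.1) p.2) * deriv (fun τ => w τ p.2) p.1 1 := by
    have := cDG.clm_apply c1
    fun_prop
  have cC : Continuous fun p : ℝ × ℝ =>
      g p.1 * fderiv ℝ G (w p.1 p.2) (deriv (fun τ => w τ p.2) p.1) * deriv (w p.1) p.2 1 := by
    have := cDG.clm_apply c2
    fun_prop
  have e1 := hsub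
    (f₁ := fun t s => (deriv g t * G (w t s) +
      g t * fderiv ℝ G (w t s) (deriv (fun τ => w τ s) t)) * deriv (w t) s 1)
    (f₂ := fun t s => g t * fderiv ℝ G (w t s) (deriv (fun τ => w τ s) t) * deriv (w t) s 1) cA cC
  have e2 := hsub
    (f₁ := fun t s => g t * fderiv ℝ G (w t s) (deriv (w t) s) * deriv (fun τ => w τ s) t 1)
    (f₂ := fun t s => g t * fderiv ℝ G (w t s) (deriv (fun τ => w τ s) t) * deriv (w t) s 1) cB cC
  rw [hkey, ← e2] at e1
  convert e1 using 1
  · refine intervalIntegral.integral_congr fun t _ => intervalIntegral.integral_congr fun s _ => ?_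
    simp only
    ring
  · refine intervalIntegral.integral_congr fun t _ => intervalIntegral.integral_congr fun s _ => ?_
    simp only
    rw [hdec _ (deriv (w t) s), hdec _ (deriv (fun τ => w τ s) t), inner_plane]
    simp only [perp_apply_zero, perp_apply_one]
    ring

section

/-! ### Mollification in space-time -/

instance : (volume : Measure (ℝ × Plane)).IsAddHaarMeasure :=
  inferInstanceAs ((volume : Measure ℝ).prod (volume : Measure Plane)).IsAddHaarMeasure

/-- A shrinking sequence of bump functions on space-time. -/
def bump (n : ℕ) : ContDiffBump (0 : ℝ × Plane) where
  rIn := reg n / 2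
  rOut := reg n
  rIn_pos := by unfold reg; positivity
  rIn_lt_rOut := by
    have : 0 < reg n := by unfold reg; positivity
    linarith

/-- The mollifier of unit mass obtained from `bump`. -/
def moll (n : ℕ) : ℝ × Plane → ℝ := (bump n).normed volume

/-- The mollification of a function on space-time. -/
def smooth (n : ℕ) (g : ℝ × Plane → ℝ) : ℝ × Plane → ℝ :=
  convolution (moll n) g (ContinuousLinearMap.lsmul ℝ ℝ) volume

theorem moll_contDiff (n : ℕ) : ContDiff ℝ ∞ (moll n) := (bump n).contDiff_normed

theorem moll_hasCompactSupport (n : ℕ) : HasCompactSupport (moll n) :=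
  (bump n).hasCompactSupport_normed

theorem moll_neg (n : ℕ) (p : ℝ × Plane) : moll n (-p) = moll n p := (bump n).normed_neg p

variable {g : ℝ × Plane → ℝ}

theorem contDiff_smooth (n : ℕ) (hg : LocallyIntegrable g volume) : ContDiff ℝ ∞ (smooth n g) :=
  (moll_hasCompactSupport n).contDiff_convolution_left (n := ⊤) _ (moll_contDiff n) hg

theorem abs_smooth_le (n : ℕ) {C : ℝ} (hg : ∀ p, |g p| ≤ C) (p : ℝ × Plane) :
    |smooth n g p| ≤ C := by
  rw [smooth, convolution_def, ← Real.norm_eq_abs]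
  refine (norm_integral_le_of_norm_le (g := fun t => moll n t * C)
    ((bump n).integrable_normed.mul_const C) (Eventually.of_forall fun t => ?_)).trans ?_
  · rw [ContinuousLinearMap.lsmul_apply, smul_eq_mul, norm_mul,
      Real.norm_of_nonneg (show 0 ≤ moll n t from (bump n).nonneg_normed t)]
    exact mul_le_mul_of_nonneg_left (hg _) ((bump n).nonneg_normed t)
  · rw [integral_mul_const]
    have : ∫ t, moll n t = 1 := (bump n).integral_normed
    rw [this, one_mul]

theorem tendsto_bump_rOut : Tendsto (fun n => (bump n).rOut) atTop (𝓝 0) := tendsto_reg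

theorem ae_tendsto_smooth (hg : LocallyIntegrable g volume) :
    ∀ᵐ p : ℝ × Plane, Tendsto (fun n => smooth n g p) atTop (𝓝 (g p)) :=
  ContDiffBump.ae_convolution_tendsto_right_of_locallyIntegrable (K := 2) tendsto_bump_rOut
    (Eventually.of_forall fun n => show reg n ≤ 2 * (reg n / 2) by linarith) hg

theorem tendsto_smooth (hg : Continuous g) (p : ℝ × Plane) :
    Tendsto (fun n => smooth n g p) atTop (𝓝 (g p)) :=
  ContDiffBump.convolution_tendsto_right_of_continuous tendsto_bump_rOut hg p

/-- The derivative of the mollifier in the direction `e`. -/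
def mollDeriv (n : ℕ) (e p : ℝ × Plane) : ℝ := fderiv ℝ (moll n) p e

theorem continuous_mollDeriv (n : ℕ) (e : ℝ × Plane) : Continuous (mollDeriv n e) :=
  ((moll_contDiff n).continuous_fderiv (by simp)).clm_apply continuous_const

theorem hasCompactSupport_mollDeriv (n : ℕ) (e : ℝ × Plane) :
    HasCompactSupport (mollDeriv n e) := (moll_hasCompactSupport n).fderiv_apply ℝ e

theorem mollDeriv_neg (n : ℕ) (e p : ℝ × Plane) : mollDeriv n e (-p) = -mollDeriv n e p := by
  have h1 : (fun p => moll n (-p)) = moll n := funext (moll_neg n)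
  have h2 : HasFDerivAt (fun p => moll n (-p))
      ((fderiv ℝ (moll n) (-p)).comp (-ContinuousLinearMap.id ℝ (ℝ × Plane))) p :=
    (((moll_contDiff n).differentiable (by simp) (-p)).hasFDerivAt).comp p (hasFDerivAt_id p).neg
  rw [h1] at h2
  rw [mollDeriv, mollDeriv, h2.fderiv]
  simp

theorem fderiv_smooth (n : ℕ) (hg : LocallyIntegrable g volume) (p e : ℝ × Plane) :
    fderiv ℝ (smooth n g) p e = ∫ q, mollDeriv n e (p - q) * g q := by
  have hc1 : ContDiff ℝ 1 (moll n) := (moll_contDiff n).of_le (by exact_mod_cast le_top)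
  have h := (moll_hasCompactSupport n).hasFDerivAt_convolution_left
    (ContinuousLinearMap.lsmul ℝ ℝ) hc1 hg p
  have h' : HasFDerivAt (smooth n g) _ p := h
  rw [h'.fderiv, convolution_eq_swap, ContinuousLinearMap.integral_apply]
  · rfl
  · have := ((moll_hasCompactSupport n).fderiv ℝ).convolutionExists_left
      (ContinuousLinearMap.precompL (ℝ × Plane) (ContinuousLinearMap.lsmul ℝ ℝ : ℝ →L[ℝ] ℝ →L[ℝ] ℝ))
      (hc1.continuous_fderiv (by norm_num)) hg p
    exact this.integrable_swap

/-- Mollification can be moved from one factor to the other, at the cost of a sign for the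
derivative. -/
theorem integral_mul_fderiv_smooth (n : ℕ) (e : ℝ × Plane) {X θ : ℝ × Plane → ℝ}
    (hX : Continuous X) (hXc : HasCompactSupport X) (hθm : AEStronglyMeasurable θ volume)
    (hθ : ∀ p, |θ p| ≤ 1) (hθl : LocallyIntegrable θ volume) :
    ∫ p, X p * fderiv ℝ (smooth n θ) p e = -∫ p, θ p * fderiv ℝ (smooth n X) p e := by
  have hk := continuous_mollDeriv n e
  have hc : Continuous fun z : (ℝ × Plane) × (ℝ × Plane) => X z.1 * mollDeriv n e (z.1 - z.2) := by
    fun_prop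
  have hcs : HasCompactSupport fun z : (ℝ × Plane) × (ℝ × Plane) =>
      X z.1 * mollDeriv n e (z.1 - z.2) := by
    refine HasCompactSupport.intro
      ((hXc.isCompact.prod (hasCompactSupport_mollDeriv n e).isCompact).image
        (by fun_prop : Continuous fun z : (ℝ × Plane) × (ℝ × Plane) => (z.1, z.1 - z.2))) ?_
    intro z hz
    by_contra hne
    refine hz ⟨(z.1, z.1 - z.2), ⟨subset_tsupport _ (left_ne_zero_of_mul hne),
      subset_tsupport _ (right_ne_zero_of_mul hne)⟩, ?_⟩
    simp
  have hint : Integrable (fun z : (ℝ × Plane) × (ℝ × Plane) =>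
      X z.1 * mollDeriv n e (z.1 - z.2) * θ z.2)
      ((volume : Measure (ℝ × Plane)).prod volume) := by
    refine Integrable.mul_bdd (c := 1) (hc.integrable_of_hasCompactSupport hcs) hθm.comp_snd
      (Eventually.of_forall fun z => hθ _)
  have e1 : ∀ p, X p * fderiv ℝ (smooth n θ) p e =
      ∫ q, X p * mollDeriv n e (p - q) * θ q := fun p => by
    rw [fderiv_smooth n hθl, ← integral_const_mul]
    simp only [mul_assoc]
  have e2 : ∀ q, -(θ q * fderiv ℝ (smooth n X) q e) =
      ∫ p, X p * mollDeriv n e (p - q) * θ q := fun q => by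
    rw [fderiv_smooth n hX.locallyIntegrable, ← integral_const_mul, ← integral_neg]
    congr 1
    ext p
    rw [← neg_sub p q, mollDeriv_neg]
    ring
  rw [← integral_neg]
  simp only [e1, e2]
  exact integral_integral_swap hint

theorem smooth_eq_zero (n : ℕ) {X : ℝ × Plane → ℝ} {U : Set (ℝ × Plane)}
    (hU : Metric.thickening (reg n) (tsupport X) ⊆ U) {p : ℝ × Plane} (hp : p ∉ U) :
    smooth n X p = 0 := by
  by_contra hne
  obtain ⟨a, ha, b, hb, rfl⟩ := support_convolution_subset _ hne
  refine hp (hU ?_)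
  have h1 : a ∈ Metric.ball (0 : ℝ × Plane) (reg n) := by
    have := (bump n).support_normed_eq (μ := volume)
    rw [← show (bump n).rOut = reg n from rfl, ← this]
    exact ha
  rw [Metric.mem_thickening_iff]
  refine ⟨b, subset_tsupport _ hb, ?_⟩
  rw [dist_eq_norm, add_sub_cancel_right]
  simpa using h1

end

/-- The spatial partial derivative of a function on space-time. -/
def pderiv (i : Fin 2) (φ : ℝ × Plane → ℝ) (p : ℝ × Plane) : ℝ :=
  fderiv ℝ φ p (0, EuclideanSpace.single i 1)

theorem hasFDerivAt_slice {φ : ℝ × Plane → ℝ} (hφ : ContDiff ℝ 1 φ) (t : ℝ) (x : Plane) :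
    HasFDerivAt (fun y => φ (t, y))
      ((fderiv ℝ φ (t, x)).comp (ContinuousLinearMap.inr ℝ ℝ Plane)) x :=
  ((hφ.differentiable (by norm_num) (t, x)).hasFDerivAt).comp x (hasFDerivAt_prodMk_right t x)

theorem pderiv_eq_slice {φ : ℝ × Plane → ℝ} (hφ : ContDiff ℝ 1 φ) (i : Fin 2) (t : ℝ) (x : Plane) :
    pderiv i φ (t, x) = fderiv ℝ (fun y => φ (t, y)) x (EuclideanSpace.single i 1) := by
  rw [(hasFDerivAt_slice hφ t x).fderiv]
  simp [pderiv]

theorem continuous_pderiv {φ : ℝ × Plane → ℝ} (hφ : ContDiff ℝ 1 φ) (i : Fin 2) :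
    Continuous (pderiv i φ) :=
  (hφ.continuous_fderiv (by norm_num)).clm_apply continuous_const

theorem tsupport_pderiv_subset (φ : ℝ × Plane → ℝ) (i : Fin 2) :
    tsupport (pderiv i φ) ⊆ tsupport φ := tsupport_fderiv_apply_subset ℝ _

theorem hasCompactSupport_pderiv {φ : ℝ × Plane → ℝ} (hφ : HasCompactSupport φ) (i : Fin 2) :
    HasCompactSupport (pderiv i φ) := hφ.fderiv_apply ℝ _

/-! ### The distributional gradient of the indicator function of a moving region -/

/-- The derivatives of the mollified indicator function converge to the boundary measure. -/
theorem IsFront.tendsto_integral_mul_pderiv {A : ℝ → Set Plane} {w : ℝ → ℝ → Plane}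
    (hF : IsFront A w) {θ X : ℝ × Plane → ℝ} (hθm : AEStronglyMeasurable θ volume)
    (hθ : ∀ p, |θ p| ≤ 1) (hθl : LocallyIntegrable θ volume) {a b : ℝ} (hab : a ≤ b)
    (hind : ∀ t ∈ Ioo a b, ∀ x, θ (t, x) = (A t).indicator (fun _ => 1) x)
    (hX : Continuous X) (hXc : HasCompactSupport X) (hXs : tsupport X ⊆ Ioo a b ×ˢ univ)
    (i : Fin 2) :
    Tendsto (fun n => ∫ p, X p * pderiv i (smooth n θ) p) atTop
      (𝓝 (∫ t in a..b, ∫ s in (0 : ℝ)..1,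
        X (t, w t s) * inner ℝ (perp (deriv (w t) s)) (EuclideanSpace.single i 1))) := by
  have hw := hF.continuous
  have hw' := hF.continuous_deriv
  have hN : Continuous fun p : ℝ × ℝ =>
      inner ℝ (perp (deriv (w p.1) p.2)) (EuclideanSpace.single i (1 : ℝ)) :=
    (continuous_perp.comp hw').inner continuous_const
  have hXl : LocallyIntegrable X volume := hX.locallyIntegrable
  have hsm : ∀ n, ContDiff ℝ 1 (smooth n X) := fun n =>
    (contDiff_smooth n hXl).of_le (by exact_mod_cast le_top)
  have hgraph : Continuous fun p : ℝ × ℝ => (p.1, w p.1 p.2) := continuous_fst.prodMk hw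
  obtain ⟨C, hC⟩ := hX.bounded_above_of_compact_support hXc
  obtain ⟨M, hM, hMb⟩ := exists_bound_of_periodic
    (f := fun t s => inner ℝ (perp (deriv (w t) s)) (EuclideanSpace.single i (1 : ℝ))) hN
    (fun t s => by simp only [(hF.param t).periodic_deriv s]) (isCompact_Icc (a := a) (b := b))
  have hlim := tendsto_double_integral hab (M := C * M)
    (F := fun n t s => smooth n X (t, w t s) *
      inner ℝ (perp (deriv (w t) s)) (EuclideanSpace.single i (1 : ℝ)))
    (f := fun t s => X (t, w t s) *
      inner ℝ (perp (deriv (w t) s)) (EuclideanSpace.single i (1 : ℝ)))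
    (fun n => ((hsm n).continuous.comp hgraph).mul hN)
    (fun n t ht s => by
      rw [norm_mul]
      exact mul_le_mul (abs_smooth_le n hC _) (hMb t ht s) (norm_nonneg _)
        ((norm_nonneg _).trans (hC 0)))
    (fun t s => (tendsto_smooth hX _).mul_const _)
  refine hlim.congr' ?_
  obtain ⟨ε, hε, hthick⟩ := hXc.isCompact.exists_thickening_subset_open
    (isOpen_Ioo.prod isOpen_univ) hXs
  filter_upwards [tendsto_reg.eventually (gt_mem_nhds hε)] with n hn
  have hzero : ∀ t x, t ∉ Ioo a b → smooth n X (t, x) = 0 := fun t x ht =>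
    smooth_eq_zero n ((Metric.thickening_mono hn.le _).trans hthick) fun h => ht h.1
  have hpz : ∀ t x, t ∉ Ioo a b → pderiv i (smooth n X) (t, x) = 0 := fun t x ht => by
    rw [pderiv_eq_slice (hsm n)]
    simp only [hzero t _ ht]
    simp
  have hYc : HasCompactSupport (smooth n X) := (moll_hasCompactSupport n).convolution _ hXc
  have hint : Integrable (fun p => θ p * pderiv i (smooth n X) p)
      ((volume : Measure ℝ).prod (volume : Measure Plane)) :=
    ((continuous_pderiv (hsm n) i).integrable_of_hasCompactSupport
      (hasCompactSupport_pderiv hYc i)).bdd_mul hθm (Eventually.of_forall hθ)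
  have hmove : ∫ p, X p * pderiv i (smooth n θ) p = -∫ p, θ p * pderiv i (smooth n X) p :=
    integral_mul_fderiv_smooth n _ hX hXc hθm hθ hθl
  rw [hmove, Measure.volume_eq_prod, integral_prod _ hint,
    ← setIntegral_eq_integral_of_forall_compl_eq_zero (s := Ioo a b)
      (fun t ht => by simp [hpz t _ ht]),
    intervalIntegral.integral_of_le hab, integral_Ioc_eq_integral_Ioo, ← integral_neg]
  refine setIntegral_congr_fun measurableSet_Ioo fun t ht => ?_
  have hslice : ContDiff ℝ 1 fun y => smooth n X (t, y) :=
    (hsm n).comp (contDiff_const.prodMk contDiff_id)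
  have hg := (hF.param t).green (hF.isClosed t) (hF.isBounded t) hslice (EuclideanSpace.single i 1)
  rw [← neg_eq_iff_eq_neg.2 hg, ← integral_indicator (hF.isClosed t).measurableSet]
  congr 2
  ext x
  rw [hind t ht, pderiv_eq_slice (hsm n)]
  by_cases hx : x ∈ A t <;> simp [hx]

/-! ### The flux of the velocity through the front -/

theorem spaceGrad_apply {φ : ℝ × Plane → ℝ} (hφ : ContDiff ℝ 1 φ) (t : ℝ) (x : Plane) (i : Fin 2) :
    spaceGrad φ t x i = pderiv i φ (t, x) := by
  rw [pderiv_eq_slice hφ, spaceGrad]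
  have := inner_gradient_left (f := fun y => φ (t, y)) (x := x) (y := EuclideanSpace.single i
      (1 : ℝ))
  rw [← this, EuclideanSpace.inner_single_right]
  simp

theorem integral_iterated {E : Type*} [NormedAddCommGroup E] [NormedSpace ℝ E] {T : ℝ}
    {f : ℝ × Plane → E} (hf : Integrable f volume) (h0 : ∀ t x, t ∉ Ioo 0 T → f (t, x) = 0) :
    ∫ t in Ioo 0 T, ∫ x, f (t, x) = ∫ p, f p := by
  rw [setIntegral_eq_integral_of_forall_compl_eq_zero fun t ht => by simp [h0 t _ ht],
    Measure.volume_eq_prod, integral_prod _ hf]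

theorem IsTestFunction.eq_zero {T : ℝ} {φ : ℝ × Plane → ℝ} (h : IsTestFunction T φ) {t : ℝ}
    (x : Plane) (ht : t ∉ Ioo 0 T) : φ (t, x) = 0 :=
  image_eq_zero_of_notMem_tsupport fun hh => ht (h.tsupport_subset hh).1

theorem IsTestFunction.contDiff_one {T : ℝ} {φ : ℝ × Plane → ℝ} (h : IsTestFunction T φ) :
    ContDiff ℝ 1 φ := h.smooth.of_le (by exact_mod_cast le_top)

section Velocity

variable {α T : ℝ} {θ : ℝ → Plane → ℝ} {u : ℝ → Plane → Plane}

theorem IsVelocity.integrable_smul (hu : IsVelocity α T θ u) {ψ : ℝ × Plane → ℝ}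
    (hψ : Continuous ψ) (hc : HasCompactSupport ψ) (hs : tsupport ψ ⊆ Ioo 0 T ×ˢ univ) :
    Integrable (fun p : ℝ × Plane => ψ p • u p.1 p.2) volume := by
  have h1 : IntegrableOn (fun p : ℝ × Plane => u p.1 p.2) (tsupport ψ) volume :=
    hu.locallyIntegrable.integrableOn_compact_subset hs hc.isCompact
  have h2 : IntegrableOn (fun p : ℝ × Plane => ψ p • u p.1 p.2) (tsupport ψ) volume :=
    h1.continuousOn_smul hψ.continuousOn hc.isCompact
  refine (integrableOn_iff_integrable_of_support_subset ?_).1 h2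
  exact (Function.support_smul_subset_left ψ _).trans (subset_tsupport ψ)

/-- The weak formulation of `u = ∇^⊥ (K * θ)` in coordinates. The potential may be replaced by any
continuous function `V` that agrees with it on a time interval containing the support of `ψ`. -/
theorem IsVelocity.integral_coord (hu : IsVelocity α T θ u) {a b : ℝ}
    {V : ℝ × Plane → ℝ} (hV : Continuous V)
    (hVθ : ∀ t ∈ Ioo a b, ∀ x, potential α (θ t) x = V (t, x)) {ψ : ℝ × Plane → ℝ}
    (hψ : IsTestFunction T ψ) (hs : tsupport ψ ⊆ Ioo a b ×ˢ univ) :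
    (∫ p : ℝ × Plane, ψ p * u p.1 p.2 0 = ∫ p, V p * pderiv 1 ψ p) ∧
      ∫ p : ℝ × Plane, ψ p * u p.1 p.2 1 = -∫ p, V p * pderiv 0 ψ p := by
  have h1 := hψ.contDiff_one
  have hpc := fun i => continuous_pderiv h1 i
  have hpcs := fun i => hasCompactSupport_pderiv hψ.hasCompactSupport i
  have hpz : ∀ i t x, t ∉ Ioo a b → pderiv i ψ (t, x) = 0 := fun i t x ht =>
    image_eq_zero_of_notMem_tsupport fun hh => ht (hs (tsupport_pderiv_subset ψ i hh)).1
  have hpz' : ∀ i t x, t ∉ Ioo 0 T → pderiv i ψ (t, x) = 0 := fun i t x ht =>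
    image_eq_zero_of_notMem_tsupport fun hh =>
      ht (hψ.tsupport_subset (tsupport_pderiv_subset ψ i hh)).1
  let P : ℝ × Plane → Plane := fun p => !₂[-pderiv 1 ψ p, pderiv 0 ψ p]
  have hP : Continuous P := by
    have h0 := hpc 0
    have h1 := hpc 1
    fun_prop
  have hPcs : HasCompactSupport P := by
    refine HasCompactSupport.intro hψ.hasCompactSupport fun p hp => ?_
    have h0 : ∀ i, pderiv i ψ p = 0 := fun i =>
      image_eq_zero_of_notMem_tsupport fun hh => hp (tsupport_pderiv_subset ψ i hh)
    ext i
    fin_cases i <;> simp [P, h0]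
  have hVP : Integrable (fun p => V p • P p) volume :=
    (hV.smul hP).integrable_of_hasCompactSupport (hPcs.smul_left)
  have hψu := hu.integrable_smul h1.continuous hψ.hasCompactSupport hψ.tsupport_subset
  have hPz : ∀ t x, (∀ i, pderiv i ψ (t, x) = 0) → P (t, x) = 0 := fun t x h => by
    ext i
    fin_cases i <;> simp [P, h]
  have hperp : ∀ t x, potential α (θ t) x • perp (spaceGrad ψ t x) = V (t, x) • P (t, x) := by
    intro t x
    have e : perp (spaceGrad ψ t x) = P (t, x) := by
      ext i
      fin_cases i <;> simp [P, spaceGrad_apply h1]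
    rw [e]
    by_cases ht : t ∈ Ioo a b
    · rw [hVθ t ht]
    · rw [hPz t x fun i => hpz i t x ht, smul_zero, smul_zero]
  have hweak := hu.weak_perp_grad ψ hψ
  simp only [hperp] at hweak
  rw [integral_iterated (f := fun p : ℝ × Plane => ψ p • u p.1 p.2) hψu (fun t x ht => by
      simp only [hψ.eq_zero x ht, zero_smul]),
    integral_iterated (f := fun p : ℝ × Plane => V p • P p) hVP (fun t x ht => by
      simp only [hPz t x fun i => hpz' i t x ht, smul_zero])] at hweak
  have hcoord : ∀ i : Fin 2, ∫ p : ℝ × Plane, ψ p * u p.1 p.2 i = -∫ p, V p * P p i := by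
    intro i
    have e1 := (EuclideanSpace.proj i : Plane →L[ℝ] ℝ).integral_comp_comm hψu
    have e2 := (EuclideanSpace.proj i : Plane →L[ℝ] ℝ).integral_comp_comm hVP
    have e3 := congrArg (EuclideanSpace.proj i : Plane →L[ℝ] ℝ) hweak
    rw [map_neg, ← e1, ← e2] at e3
    simpa using e3
  constructor
  · rw [hcoord 0, ← integral_neg]
    simp [P]
  · rw [hcoord 1]
    simp [P]

theorem pderiv_mul {f g : ℝ × Plane → ℝ} (hf : ContDiff ℝ 1 f) (hg : ContDiff ℝ 1 g) (i : Fin 2)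
    (p : ℝ × Plane) : pderiv i (fun p => f p * g p) p = pderiv i f p * g p +
        f p * pderiv i g p := by
  have h := (hf.differentiable (by norm_num) p).hasFDerivAt.mul
    (hg.differentiable (by norm_num) p).hasFDerivAt
  have h' : HasFDerivAt (fun p => f p * g p) _ p := h
  rw [pderiv, h'.fderiv]
  simp [pderiv]
  ring

theorem contDiff_pderiv {φ : ℝ × Plane → ℝ} (hφ : ContDiff ℝ ∞ φ) (i : Fin 2) :
    ContDiff ℝ ∞ (pderiv i φ) :=
  (hφ.fderiv_right (m := ∞) (by simp)).clm_apply contDiff_const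

theorem pderiv_comm {φ : ℝ × Plane → ℝ} (hφ : ContDiff ℝ ∞ φ) (p : ℝ × Plane) :
    pderiv 0 (pderiv 1 φ) p = pderiv 1 (pderiv 0 φ) p := by
  have hd : Differentiable ℝ (fderiv ℝ φ) :=
    (hφ.fderiv_right (m := ∞) (by simp)).differentiable (by simp)
  have key : ∀ i j, pderiv i (pderiv j φ) p =
      fderiv ℝ (fderiv ℝ φ) p (0, EuclideanSpace.single i 1) (0, EuclideanSpace.single j 1) := by
    intro i j
    have h := (hd p).hasFDerivAt.clm_apply
      (hasFDerivAt_const ((0, EuclideanSpace.single j 1) : ℝ × Plane) p)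
    have h' : HasFDerivAt (pderiv j φ) _ p := h
    rw [pderiv, h'.fderiv]
    simp
  rw [key, key]
  have h2 : (2 : WithTop ℕ∞) ≤ ∞ := WithTop.coe_le_coe.2 (le_top : (2 : ℕ∞) ≤ ⊤)
  exact (hφ.contDiffAt.isSymmSndFDerivAt (by simpa using h2)).eq _ _

/-- The term `∫∫ θ u · ∇φ` of the weak formulation, as an integral over the front. The function
`θ` is replaced by its mollification, so that `θ ∇φ` becomes admissible in the definition of `u`;
the derivative falls on `θ` and produces the boundary measure. -/
theorem IsVelocity.integral_flux (hu : IsVelocity α T θ u) (hα : α ∈ Ioo (0 : ℝ) 1)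
    {A : ℝ → Set Plane} {w : ℝ → ℝ → Plane} (hF : IsFront A w) {a b : ℝ} (hab : a ≤ b)
    (hT : Ioo a b ⊆ Ioo 0 T) (hind : ∀ t ∈ Ioo a b, θ t = (A t).indicator fun _ => 1)
    (hθm : AEStronglyMeasurable (fun p : ℝ × Plane => θ p.1 p.2)
      ((volume.restrict (Ioo 0 T)).prod volume))
    (hθ1 : ∀ t ∈ Ioo 0 T, ∀ x, |θ t x| ≤ 1) {φ : ℝ × Plane → ℝ} (hφ : IsTestFunction T φ)
    (hφs : tsupport φ ⊆ Ioo a b ×ˢ univ) :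
    ∫ p : ℝ × Plane, θ p.1 p.2 * (pderiv 0 φ p * u p.1 p.2 0 + pderiv 1 φ p * u p.1 p.2 1) =
      ∫ t in a..b, ∫ s in (0 : ℝ)..1, potential α ((A t).indicator fun _ => 1) (w t s) *
        fderiv ℝ φ (t, w t s) (0, deriv (w t) s) := by
  set V : ℝ × Plane → ℝ := fun p => potential α ((A p.1).indicator fun _ => 1) p.2 with hV
  have hVc : Continuous V := hF.continuous_potential hα
  set Θ : ℝ × Plane → ℝ := (Ioo 0 T ×ˢ univ).indicator fun p => θ p.1 p.2 with hΘ
  have hΘm : AEStronglyMeasurable Θ volume := by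
    rw [hΘ, aestronglyMeasurable_indicator_iff (measurableSet_Ioo.prod MeasurableSet.univ),
      Measure.volume_eq_prod, ← Measure.prod_restrict, Measure.restrict_univ]
    exact hθm
  have hΘ1 : ∀ p, |Θ p| ≤ 1 := fun p => by
    by_cases hp : p ∈ Ioo 0 T ×ˢ (univ : Set Plane)
    · rw [hΘ, indicator_of_mem hp]; exact hθ1 p.1 hp.1 p.2
    · rw [hΘ, indicator_of_notMem hp]; simp
  have hΘl : LocallyIntegrable Θ volume := by
    refine (locallyIntegrable_const (1 : ℝ)).mono hΘm (Eventually.of_forall fun p => ?_)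
    simpa using hΘ1 p
  have hφ1 := hφ.contDiff_one
  set v : Fin 2 → ℝ × Plane → ℝ := fun i p => u p.1 p.2 i with hv
  have hps : ∀ i, tsupport (pderiv i φ) ⊆ tsupport φ := tsupport_pderiv_subset φ
  have hpcs : ∀ i, HasCompactSupport (pderiv i φ) := hasCompactSupport_pderiv hφ.hasCompactSupport
  have hpsm : ∀ i, ContDiff ℝ ∞ (pderiv i φ) := contDiff_pderiv hφ.smooth
  have hpc : ∀ i, Continuous (pderiv i φ) := fun i => (hpsm i).continuous
  have hcoord : ∀ {ψ : ℝ × Plane → ℝ} (i : Fin 2), Continuous ψ → HasCompactSupport ψ →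
      tsupport ψ ⊆ Ioo 0 T ×ˢ univ → Integrable (fun p => ψ p * v i p) volume := by
    intro ψ i h1 h2 h3
    exact (EuclideanSpace.proj i : Plane →L[ℝ] ℝ).integrable_comp (hu.integrable_smul h1 h2 h3)
  have hI : ∀ i, Integrable (fun p => pderiv i φ p * v i p) volume := fun i =>
    hcoord i (hpc i) (hpcs i) ((hps i).trans hφ.tsupport_subset)
  set f : ℝ × Plane → ℝ := fun p => pderiv 0 φ p * v 0 p + pderiv 1 φ p * v 1 p with hf
  have hfI : Integrable f volume := (hI 0).add (hI 1)
  have hΘsm : ∀ n, ContDiff ℝ ∞ (smooth n Θ) := fun n => contDiff_smooth n hΘl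
  have hΘs1 : ∀ n, ContDiff ℝ 1 (smooth n Θ) := fun n =>
    (hΘsm n).of_le (by exact_mod_cast le_top)
  have lim1 : Tendsto (fun n => ∫ p, smooth n Θ p * f p) atTop (𝓝 (∫ p, Θ p * f p)) := by
    refine tendsto_integral_of_dominated_convergence (fun p => ‖f p‖)
      (fun n => (hΘsm n).continuous.aestronglyMeasurable.mul hfI.aestronglyMeasurable) hfI.norm
      (fun n => Eventually.of_forall fun p => ?_) ?_
    · rw [norm_mul]
      exact mul_le_of_le_one_left (norm_nonneg _) (abs_smooth_le n hΘ1 p)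
    · filter_upwards [ae_tendsto_smooth hΘl] with p hp using hp.mul_const _
  have hLHS : ∫ p : ℝ × Plane, θ p.1 p.2 * (pderiv 0 φ p * u p.1 p.2 0 +
      pderiv 1 φ p * u p.1 p.2 1) =
      ∫ p, Θ p * f p := by
    congr 1
    ext p
    by_cases hp : p ∈ Ioo 0 T ×ˢ (univ : Set Plane)
    · rw [hΘ, indicator_of_mem hp]
    · have h0 : ∀ i, pderiv i φ p = 0 := fun i => image_eq_zero_of_notMem_tsupport fun hh =>
        hp (hφ.tsupport_subset (hps i hh))
      simp [hf, h0]
  set ψ : ℕ → Fin 2 → ℝ × Plane → ℝ := fun n i p => smooth n Θ p * pderiv i φ p with hψ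
  have hψs : ∀ n i, tsupport (ψ n i) ⊆ tsupport φ := fun n i =>
    tsupport_mul_subset_right.trans (hps i)
  have hψt : ∀ n i, IsTestFunction T (ψ n i) := fun n i =>
    ⟨(hΘsm n).mul (hpsm i), (hpcs i).mul_left, (hψs n i).trans hφ.tsupport_subset⟩
  have hVX : ∀ i j, ∀ n, Integrable (fun p => (V p * pderiv i φ p) * pderiv j
      (smooth n Θ) p) volume := by
    intro i j n
    exact ((hVc.mul (hpc i)).mul (continuous_pderiv (hΘs1 n) j)).integrable_of_hasCompactSupport
      ((hpcs i).mul_left.mul_right)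
  have step : ∀ n, ∫ p, smooth n Θ p * f p =
      (∫ p, (V p * pderiv 0 φ p) * pderiv 1 (smooth n Θ) p) -
        ∫ p, (V p * pderiv 1 φ p) * pderiv 0 (smooth n Θ) p := by
    intro n
    have hVθ : ∀ t ∈ Ioo a b, ∀ x, potential α (θ t) x = V (t, x) := fun t ht x => by
      rw [hind t ht]
    have c0 := (hu.integral_coord hVc hVθ (hψt n 0) ((hψs n 0).trans hφs)).1
    have c1 := (hu.integral_coord hVc hVθ (hψt n 1) ((hψs n 1).trans hφs)).2
    have i0 := hcoord 0 (hψt n 0).smooth.continuous (hψt n 0).hasCompactSupport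
      (hψt n 0).tsupport_subset
    have i1 := hcoord 1 (hψt n 1).smooth.continuous (hψt n 1).hasCompactSupport
      (hψt n 1).tsupport_subset
    have hVψ : ∀ i j, Integrable (fun p => V p * pderiv j (ψ n i) p) volume := fun i j =>
      (hVc.mul (continuous_pderiv (hψt n i).contDiff_one j)).integrable_of_hasCompactSupport
        (hasCompactSupport_pderiv (hψt n i).hasCompactSupport j).mul_left
    have e1 : ∫ p, smooth n Θ p * f p = (∫ p, ψ n 0 p * v 0 p) + ∫ p, ψ n 1 p * v 1 p := by
      rw [← integral_add i0 i1]
      congr 1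
      ext p
      simp only [hf, hψ]
      ring
    rw [e1, c0, c1, ← sub_eq_add_neg, ← integral_sub (hVψ 0 1) (hVψ 1 0),
      ← integral_sub (hVX 0 1 n) (hVX 1 0 n)]
    congr 1
    ext p
    -- The second derivatives of `φ` cancel.
    simp only [hψ]
    rw [pderiv_mul (hΘs1 n) ((hpsm 0).of_le (by exact_mod_cast le_top)),
      pderiv_mul (hΘs1 n) ((hpsm 1).of_le (by exact_mod_cast le_top)), pderiv_comm hφ.smooth]
    ring
  have hΘind : ∀ t ∈ Ioo a b, ∀ x, Θ (t, x) = (A t).indicator (fun _ => 1) x := by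
    intro t ht x
    rw [hΘ, indicator_of_mem (show (t, x) ∈ Ioo 0 T ×ˢ univ from ⟨hT ht, mem_univ _⟩)]
    exact congrFun (hind t ht) x
  have lim2 := fun i j => hF.tendsto_integral_mul_pderiv (X :=
      fun p => V p * pderiv i φ p) hΘm hΘ1 hΘl
    hab hΘind (hVc.mul (hpc i)) (hpcs i).mul_left
    (tsupport_mul_subset_right.trans ((hps i).trans hφs)) j
  have lim3 := (lim2 0 1).sub (lim2 1 0)
  simp only [step] at lim1
  rw [hLHS, tendsto_nhds_unique lim1 lim3]
  have hw := hF.continuous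
  have hw' := hF.continuous_deriv
  have hgraph : Continuous fun p : ℝ × ℝ => (p.1, w p.1 p.2) := continuous_fst.prodMk hw
  have hc : ∀ i j, Continuous fun p : ℝ × ℝ => V (p.1, w p.1 p.2) * pderiv i φ (p.1, w p.1 p.2) *
      inner ℝ (perp (deriv (w p.1) p.2)) (EuclideanSpace.single j (1 : ℝ)) := fun i j =>
    ((hVc.comp hgraph).mul ((hpc i).comp hgraph)).mul
      ((continuous_perp.comp hw').inner continuous_const)
  have hci : ∀ i j t, IntervalIntegrable (fun s => V (t, w t s) * pderiv i φ (t, w t s) *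
      inner ℝ (perp (deriv (w t) s)) (EuclideanSpace.single j (1 : ℝ))) volume 0 1 := fun i j t =>
    ((hc i j).comp (by fun_prop : Continuous fun s : ℝ => (t, s))).intervalIntegrable _ _
  have hco : ∀ i j, IntervalIntegrable (fun t => ∫ s in (0 : ℝ)..1,
      V (t, w t s) * pderiv i φ (t, w t s) *
      inner ℝ (perp (deriv (w t) s)) (EuclideanSpace.single j (1 : ℝ))) volume a b := fun i j =>
    (intervalIntegral.continuous_parametric_intervalIntegral_of_continuous'
      (f := fun t s => V (t, w t s) * pderiv i φ (t, w t s) *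
      inner ℝ (perp (deriv (w t) s)) (EuclideanSpace.single j (1 : ℝ)))
          (hc i j) 0 1).intervalIntegrable _ _
  rw [← intervalIntegral.integral_sub (hco 0 1) (hco 1 0)]
  refine intervalIntegral.integral_congr fun t _ => ?_
  rw [← intervalIntegral.integral_sub (hci 0 1 t) (hci 1 0 t)]
  refine intervalIntegral.integral_congr fun s _ => ?_
  have hdec : ∀ x : Plane, ((0, x) : ℝ × Plane) = x 0 • ((0,
      EuclideanSpace.single 0 1) : ℝ × Plane) +
      x 1 • ((0, EuclideanSpace.single 1 1) : ℝ × Plane) := fun x => by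
    ext i
    · simp
    · fin_cases i <;> simp
  rw [hdec, map_add, map_smul, map_smul]
  simp only [EuclideanSpace.inner_single_right, perp_apply_zero, perp_apply_one, hV, pderiv]
  simp
  ring

end Velocity

/-! ### The evolution equation in weak form -/

section WeakEquation

variable {α T : ℝ} {θ : ℝ → Plane → ℝ} {u : ℝ → Plane → Plane}

theorem integrable_bounded_mul
    (hθm : AEStronglyMeasurable (fun p : ℝ × Plane => θ p.1 p.2)
      ((volume.restrict (Ioo 0 T)).prod volume))
    (hθ1 : ∀ t ∈ Ioo 0 T, ∀ x, |θ t x| ≤ 1) {f : ℝ × Plane → ℝ} (hf : Integrable f volume)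
    (h0 : ∀ t x, t ∉ Ioo 0 T → f (t, x) = 0) :
    Integrable (fun p => θ p.1 p.2 * f p) volume := by
  have hS : MeasurableSet (Ioo 0 T ×ˢ (univ : Set Plane)) :=
    measurableSet_Ioo.prod MeasurableSet.univ
  have hθm' : AEStronglyMeasurable (fun p : ℝ × Plane => θ p.1 p.2)
      (volume.restrict (Ioo 0 T ×ˢ (univ : Set Plane))) := by
    rw [Measure.volume_eq_prod, ← Measure.prod_restrict, Measure.restrict_univ]
    exact hθm
  have h1 : IntegrableOn (fun p => θ p.1 p.2 * f p) (Ioo 0 T ×ˢ (univ : Set Plane)) volume := by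
    refine (hf.integrableOn (s := Ioo 0 T ×ˢ (univ : Set Plane))).bdd_mul (c := 1) hθm' ?_
    filter_upwards [ae_restrict_mem hS] with p hp using hθ1 p.1 hp.1 p.2
  refine (integrableOn_iff_integrable_of_support_subset fun p hp => ?_).1 h1
  by_contra hh
  refine hp ?_
  have : f p = 0 := h0 p.1 p.2 fun h => hh ⟨h, mem_univ _⟩
  simp [this]

/-- Testing the equation with `g(t) β(x)` gives the weak form of `∂_t w · N + circ = 0`, where
`N = (∂_s w)^⊥`. -/
theorem IsVelocity.integral_normal_velocity (hu : IsVelocity α T θ u)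
    (hweak : ∀ φ : ℝ × Plane → ℝ, IsTestFunction T φ → ∫ t in Ioo 0 T, ∫ x,
      (θ t x * timeDeriv φ t x + θ t x * inner ℝ (u t x) (spaceGrad φ t x)) = 0)
    (hα : α ∈ Ioo (0 : ℝ) 1)
    {A : ℝ → Set Plane} {w : ℝ → ℝ → Plane} (hF : IsFront A w) {a b : ℝ} (hab : a ≤ b)
    (hT : Ioo a b ⊆ Ioo 0 T) (hind : ∀ t ∈ Ioo a b, θ t = (A t).indicator fun _ => 1)
    (hθm : AEStronglyMeasurable (fun p : ℝ × Plane => θ p.1 p.2)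
      ((volume.restrict (Ioo 0 T)).prod volume))
    (hθ1 : ∀ t ∈ Ioo 0 T, ∀ x, |θ t x| ≤ 1)
    {g : ℝ → ℝ} (hg : ContDiff ℝ ∞ g) (hgc : HasCompactSupport g) (hgs : tsupport g ⊆ Ioo a b)
    {β G : Plane → ℝ} (hβ : ContDiff ℝ ∞ β) (hβc : HasCompactSupport β) (hG : ContDiff ℝ 1 G)
    (hGβ : ∀ x, fderiv ℝ G x (EuclideanSpace.single 0 1) = β x) :
    ∫ t in a..b, ∫ s in (0 : ℝ)..1, g t * β (w t s) *
      (inner ℝ (deriv (fun τ => w τ s) t) (perp (deriv (w t) s)) +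
        circ α (w t) (w t s) (perp (deriv (w t) s))) = 0 := by
  set φ : ℝ × Plane → ℝ := fun p => g p.1 * β p.2 with hφdef
  have hφs : tsupport φ ⊆ tsupport g ×ˢ tsupport β := by
    refine closure_minimal (fun p hp => ?_) ((isClosed_tsupport g).prod (isClosed_tsupport β))
    have hp' : g p.1 * β p.2 ≠ 0 := hp
    exact ⟨subset_tsupport g (left_ne_zero_of_mul hp'),
      subset_tsupport β (right_ne_zero_of_mul hp')⟩
  have hφab : tsupport φ ⊆ Ioo a b ×ˢ univ := hφs.trans (prod_mono hgs (subset_univ _))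
  have hφ : IsTestFunction T φ :=
    ⟨(hg.comp contDiff_fst).mul (hβ.comp contDiff_snd),
      (hgc.isCompact.prod hβc.isCompact).of_isClosed_subset (isClosed_tsupport φ) hφs,
      hφab.trans (prod_mono hT le_rfl)⟩
  have hg1 : ContDiff ℝ 1 g := hg.of_le (by exact_mod_cast le_top)
  have hβ1 : ContDiff ℝ 1 β := hβ.of_le (by exact_mod_cast le_top)
  have hg0 : ∀ t, t ∉ Ioo a b → g t = 0 := fun t ht =>
    image_eq_zero_of_notMem_tsupport fun hh => ht (hgs hh)
  have hg'0 : ∀ t, t ∉ Ioo a b → deriv g t = 0 := fun t ht =>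
    image_eq_zero_of_notMem_tsupport fun hh => ht (hgs (tsupport_deriv_subset hh))
  have htime : ∀ t x, timeDeriv φ t x = deriv g t * β x := fun t x => by
    simp only [timeDeriv, hφdef]
    rw [deriv_mul_const (hg1.differentiable (by norm_num) t)]
  have hgrad : ∀ t x, (inner ℝ (u t x) (spaceGrad φ t x) : ℝ) =
      pderiv 0 φ (t, x) * u t x 0 + pderiv 1 φ (t, x) * u t x 1 := fun t x => by
    rw [inner_plane, spaceGrad_apply hφ.contDiff_one, spaceGrad_apply hφ.contDiff_one]
    ring
  have hp0 : ∀ i t x, t ∉ Ioo 0 T → pderiv i φ (t, x) = 0 := fun i t x ht =>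
    image_eq_zero_of_notMem_tsupport fun hh =>
      ht (hφ.tsupport_subset (tsupport_pderiv_subset φ i hh)).1
  have hI : ∀ i, Integrable (fun p : ℝ × Plane => pderiv i φ p * u p.1 p.2 i) volume := fun i =>
    (EuclideanSpace.proj i : Plane →L[ℝ] ℝ).integrable_comp
      (hu.integrable_smul (continuous_pderiv hφ.contDiff_one i)
        (hasCompactSupport_pderiv hφ.hasCompactSupport i)
        ((tsupport_pderiv_subset φ i).trans hφ.tsupport_subset))
  have hI1 : Integrable (fun p : ℝ × Plane => deriv g p.1 * β p.2) volume := by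
    have h1 : Integrable (deriv g) volume :=
      (hg1.continuous_deriv (by norm_num)).integrable_of_hasCompactSupport hgc.deriv
    have h2 : Integrable β volume := hβ1.continuous.integrable_of_hasCompactSupport hβc
    exact h1.mul_prod h2
  have hJ1 := integrable_bounded_mul hθm hθ1 hI1 fun t x ht => by
    simp only [hg'0 t fun h => ht (hT h), zero_mul]
  have hJ2 := integrable_bounded_mul hθm hθ1 ((hI 0).add (hI 1)) fun t x ht => by
    simp [hp0 _ t x ht]
  have hw := hweak φ hφ
  simp only [htime, hgrad] at hw
  rw [integral_iterated (f := fun p : ℝ × Plane => θ p.1 p.2 * (deriv g p.1 * β p.2) +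
      θ p.1 p.2 * (pderiv 0 φ p * u p.1 p.2 0 + pderiv 1 φ p * u p.1 p.2 1)) (hJ1.add hJ2)
      (fun t x ht => by simp [hp0 _ t x ht, hg'0 t fun h => ht (hT h)])] at hw
  have hadd := integral_add hJ1 hJ2
  simp only [Pi.add_apply] at hadd
  rw [hadd, hu.integral_flux hα hF hab hT hind hθm hθ1 hφ hφab] at hw
  have hterm1 : ∫ p : ℝ × Plane, θ p.1 p.2 * (deriv g p.1 * β p.2) =
      ∫ t in a..b, ∫ s in (0 : ℝ)..1, g t * (β (w t s) *
        inner ℝ (deriv (fun τ => w τ s) t) (perp (deriv (w t) s))) := by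
    have hga : g a = 0 := hg0 a (by simp)
    have hgb : g b = 0 := hg0 b (by simp)
    have key := hF.integral_time hG hg1 hab hga hgb
    simp only [hGβ] at key
    rw [← key, Measure.volume_eq_prod, integral_prod _ hJ1,
      ← setIntegral_eq_integral_of_forall_compl_eq_zero (s := Ioo a b)
        (fun t ht => by simp [hg'0 t ht]),
      intervalIntegral.integral_of_le hab, integral_Ioc_eq_integral_Ioo]
    refine setIntegral_congr_fun measurableSet_Ioo fun t ht => ?_
    simp only
    rw [← integral_const_mul, ← integral_indicator (hF.isClosed t).measurableSet]
    congr 1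
    ext x
    rw [hind t ht]
    by_cases hx : x ∈ A t <;> simp [hx]
  have hterm2 : ∀ t, ∫ s in (0 : ℝ)..1, potential α ((A t).indicator fun _ => 1) (w t s) *
        fderiv ℝ φ (t, w t s) (0, deriv (w t) s) =
      ∫ s in (0 : ℝ)..1, g t * β (w t s) * circ α (w t) (w t s) (perp (deriv (w t) s)) := by
    intro t
    have hφt : ContDiff ℝ 1 fun s => φ (t, w t s) :=
      hφ.contDiff_one.comp (contDiff_const.prodMk ((hF.param t).contDiff.of_le (by norm_num)))
    have hd : ∀ s, deriv (fun s => φ (t, w t s)) s = fderiv ℝ φ (t, w t s) (0, deriv (w t) s) := by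
      intro s
      have h1 := (hasDerivAt_const s t).prodMk ((hF.param t).hasDerivAt s)
      exact ((hφ.contDiff_one.differentiable
          (by norm_num) _).hasFDerivAt.comp_hasDerivAt s h1).deriv
    have := (hF.param t).integral_potential_mul_deriv (hF.isClosed t) (hF.isBounded t) hα hφt
      (fun s => by simp only [(hF.param t).periodic s])
    simpa only [hd] using this
  rw [hterm1] at hw
  simp only [hterm2] at hw
  have c1 := hF.continuous
  have c2 : Continuous fun p : ℝ × ℝ => perp (deriv (w p.1) p.2) :=
    continuous_perp.comp hF.continuous_deriv
  have c3 := (hF.continuous_time).inner (𝕜 := ℝ) c2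
  have c4 := hF.continuous_circ hα
  have cg : Continuous fun p : ℝ × ℝ => g p.1 := hg1.continuous.comp continuous_fst
  have cβ : Continuous fun p : ℝ × ℝ => β (w p.1 p.2) := hβ1.continuous.comp c1
  have d1 := cg.mul (cβ.mul c3)
  have d2 := (cg.mul cβ).mul c4
  have hin : ∀ {f : ℝ × ℝ → ℝ}, Continuous f → ∀ t,
      IntervalIntegrable (fun s => f (t, s)) volume 0 1 := fun hf t =>
    (hf.comp (by fun_prop : Continuous fun s : ℝ => (t, s))).intervalIntegrable _ _
  have hout : ∀ {f : ℝ × ℝ → ℝ}, Continuous f →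
      IntervalIntegrable (fun t => ∫ s in (0 : ℝ)..1, f (t, s)) volume a b := fun {f} hf =>
    (intervalIntegral.continuous_parametric_intervalIntegral_of_continuous'
      (f := fun t s => f (t, s)) hf 0 1).intervalIntegrable _ _
  refine Eq.trans ?_ ((intervalIntegral.integral_add (hout d1) (hout d2)).trans hw)
  refine intervalIntegral.integral_congr fun t _ => ?_
  refine Eq.trans ?_ (intervalIntegral.integral_add (hin d1 t) (hin d2 t))
  refine intervalIntegral.integral_congr fun s _ => ?_
  simp only [Pi.mul_apply]
  ring

end WeakEquation

/-! ### Localisation -/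

/-- A function of the form required of the spatial factor of a test function: a bump around `x₀`
that is a derivative in the first coordinate. -/
theorem exists_bump (x₀ : Plane) {ε : ℝ} (hε : 0 < ε) :
    ∃ β G : Plane → ℝ, ContDiff ℝ ∞ β ∧ HasCompactSupport β ∧ ContDiff ℝ 1 G ∧
      (∀ x, fderiv ℝ G x (EuclideanSpace.single 0 1) = β x) ∧ (∀ x, 0 ≤ β x) ∧ 0 < β x₀ ∧
      ∀ x, β x ≠ 0 → ‖x - x₀‖ < ε := by
  let b : ∀ i : Fin 2, ContDiffBump (x₀ i) := fun i => ⟨ε / 4, ε / 2, by positivity, by linarith⟩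
  let B : ℝ → ℝ := fun y => ∫ r in (0 : ℝ)..y, b 0 r
  have hb : ∀ i, ContDiff ℝ ∞ (b i) := fun i => (b i).contDiff
  have hB : ∀ y, HasDerivAt B (b 0 y) y := fun y =>
    intervalIntegral.integral_hasDerivAt_right ((b 0).continuous.intervalIntegrable _ _)
      ((b 0).continuous.stronglyMeasurableAtFilter _ _) (b 0).continuous.continuousAt
  have hB1 : ContDiff ℝ 1 B := by
    refine contDiff_one_iff_deriv.2 ⟨fun y => (hB y).differentiableAt, ?_⟩
    rw [show deriv B = b 0 from funext fun y => (hB y).deriv]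
    exact (b 0).continuous
  have hpr : ∀ i : Fin 2, ContDiff ℝ ∞ fun x : Plane => x i := fun i =>
    (EuclideanSpace.proj i : Plane →L[ℝ] ℝ).contDiff
  have hpr1 : ∀ i : Fin 2, ContDiff ℝ 1 fun x : Plane => x i := fun i =>
    (EuclideanSpace.proj i : Plane →L[ℝ] ℝ).contDiff
  have hsmall : ∀ x : Plane, b 0 (x 0) * b 1 (x 1) ≠ 0 → ‖x - x₀‖ < ε := by
    intro x hx
    have h0 : ∀ i, b i (x i) ≠ 0 → |(x - x₀) i| < ε / 2 := fun i hi => by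
      have : x i ∈ Metric.ball (x₀ i) (ε / 2) := by
        have h := (b i).support_eq
        rw [← h]
        exact hi
      rwa [Metric.mem_ball, Real.dist_eq] at this
    have e0 := sq_lt_sq' (abs_lt.1 (h0 0 (left_ne_zero_of_mul hx))).1
      (abs_lt.1 (h0 0 (left_ne_zero_of_mul hx))).2
    have e1 := sq_lt_sq' (abs_lt.1 (h0 1 (right_ne_zero_of_mul hx))).1
      (abs_lt.1 (h0 1 (right_ne_zero_of_mul hx))).2
    refine lt_of_pow_lt_pow_left₀ 2 hε.le ?_
    rw [norm_sq_plane]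
    nlinarith
  refine ⟨fun x => b 0 (x 0) * b 1 (x 1), fun x => B (x 0) * b 1 (x 1),
    ((hb 0).comp (hpr 0)).mul ((hb 1).comp (hpr 1)), ?_,
    (hB1.comp (hpr1 0)).mul ((b 1).contDiff.comp (hpr1 1)), fun x => ?_,
    fun x => mul_nonneg (b 0).nonneg (b 1).nonneg,
    mul_pos ((b 0).pos_of_mem_ball (Metric.mem_ball_self (b 0).rOut_pos))
      ((b 1).pos_of_mem_ball (Metric.mem_ball_self (b 1).rOut_pos)), hsmall⟩
  · refine HasCompactSupport.intro (isCompact_closedBall x₀ ε) fun x hx => ?_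
    by_contra hh
    exact hx (by rw [Metric.mem_closedBall, dist_eq_norm]; exact (hsmall x hh).le)
  · have h0 := (hB (x 0)).comp_hasFDerivAt x (EuclideanSpace.proj
      (0 : Fin 2) : Plane →L[ℝ] ℝ).hasFDerivAt
    have h1 := (((b 1).contDiff (n := 1)).differentiable (by norm_num)
        (x 1)).hasDerivAt.comp_hasFDerivAt x
      (EuclideanSpace.proj (1 : Fin 2) : Plane →L[ℝ] ℝ).hasFDerivAt
    have h : HasFDerivAt (fun x : Plane => B (x 0) * b 1 (x 1)) _ x := h0.mul h1
    rw [h.fderiv]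
    simp
    ring

/-- The fundamental lemma of the calculus of variations on a moving front: since the front has no
self-intersections, a bump in the plane is a bump in `(t, s)`. -/
theorem IsFront.eq_zero_of_integral_eq_zero {A : ℝ → Set Plane} {w : ℝ → ℝ → Plane}
    (hF : IsFront A w) {H : ℝ → ℝ → ℝ} (hH : Continuous fun p : ℝ × ℝ => H p.1 p.2)
    (hHp : ∀ t, Function.Periodic (H t) 1) {a b : ℝ} (hab : a < b)
    (h : ∀ g : ℝ → ℝ, ContDiff ℝ ∞ g → HasCompactSupport g → tsupport g ⊆ Ioo a b →
      ∀ β G : Plane → ℝ, ContDiff ℝ ∞ β → HasCompactSupport β → ContDiff ℝ 1 G →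
      (∀ x, fderiv ℝ G x (EuclideanSpace.single 0 1) = β x) →
      ∫ t in a..b, ∫ s in (0 : ℝ)..1, g t * β (w t s) * H t s = 0)
    {t₀ : ℝ} (ht₀ : t₀ ∈ Ioo a b) (s₀ : ℝ) : H t₀ s₀ = 0 := by
  by_contra hne
  obtain ⟨c, hc, hca⟩ := hF.exists_chord_arc (isCompact_Icc (a := a) (b := b))
  have hpos : ∀ᶠ p : ℝ × ℝ in 𝓝 (t₀, s₀), 0 < H p.1 p.2 * H t₀ s₀ :=
    (hH.mul continuous_const).continuousAt.eventually (lt_mem_nhds (mul_self_pos.2 hne))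
  obtain ⟨δ, hδ, hball⟩ := Metric.eventually_nhds_iff.1 hpos
  have hwt : ∀ᶠ t in 𝓝 t₀, ‖w t s₀ - w t₀ s₀‖ < c * δ / 2 := by
    have hc1 : Continuous fun t => ‖w t s₀ - w t₀ s₀‖ :=
      ((hF.continuous.comp (by fun_prop : Continuous fun t : ℝ => (t, s₀))).sub
        continuous_const).norm
    exact hc1.continuousAt.eventually (gt_mem_nhds (by simp; positivity))
  obtain ⟨η, hη, hηball⟩ := Metric.eventually_nhds_iff.1
    (hwt.and ((eventually_mem_set.2 (Metric.ball_mem_nhds t₀ hδ)).and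
      (eventually_mem_set.2 (Ioo_mem_nhds ht₀.1 ht₀.2))))
  obtain ⟨β, G, hβ, hβc, hG, hGβ, hβ0, hβx, hβs⟩ := exists_bump (w t₀ s₀)
    (show 0 < c * δ / 2 by positivity)
  let g : ContDiffBump t₀ := ⟨η / 4, η / 2, by positivity, by linarith⟩
  have hgη : tsupport g ⊆ Metric.ball t₀ η := by
    rw [g.tsupport_eq]
    exact Metric.closedBall_subset_ball (by show η / 2 < η; linarith)
  have hgab : tsupport g ⊆ Ioo a b := fun t ht => (hηball (hgη ht)).2.2
  have key := h g g.contDiff g.hasCompactSupport hgab β G hβ hβc hG hGβ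
  let F : ℝ → ℝ → ℝ := fun t s => g t * β (w t s) * H t s * H t₀ s₀
  have hFc : Continuous fun p : ℝ × ℝ => F p.1 p.2 :=
    (((g.continuous.comp continuous_fst).mul (hβ.continuous.comp hF.continuous)).mul hH).mul
      continuous_const
  have hFp : ∀ t, Function.Periodic (F t) 1 := fun t s => by
    simp only [F, hHp t s, (hF.param t).periodic s]
  have key' : ∫ t in a..b, ∫ s in (s₀ - 1 / 2)..(s₀ - 1 / 2 + 1), F t s = 0 := by
    have e : ∀ t, ∫ s in (s₀ - 1 / 2)..(s₀ - 1 / 2 + 1), F t s =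
        (∫ s in (0 : ℝ)..1, g t * β (w t s) * H t s) * H t₀ s₀ := fun t => by
      rw [(hFp t).intervalIntegral_add_eq _ 0, zero_add, ← intervalIntegral.integral_mul_const]
    simp only [e]
    rw [intervalIntegral.integral_mul_const, key, zero_mul]
  have hF0 : ∀ t, ∀ s ∈ Icc (s₀ - 1 / 2) (s₀ - 1 / 2 + 1), 0 ≤ F t s := by
    intro t s hs
    by_cases hz : g t * β (w t s) = 0
    · simp only [F, hz, zero_mul, le_refl]
    have ht := hηball (hgη (subset_tsupport _ (left_ne_zero_of_mul hz)))
    have hx := hβs _ (right_ne_zero_of_mul hz)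
    have h1 := hca t (Ioo_subset_Icc_self ht.2.2) s₀ (s - s₀)
      ⟨by linarith [hs.1], by linarith [hs.2]⟩
    rw [add_sub_cancel] at h1
    have h2 : ‖w t s - w t s₀‖ < c * δ := by
      have := norm_sub_le (w t s - w t₀ s₀) (w t s₀ - w t₀ s₀)
      rw [sub_sub_sub_cancel_right] at this
      linarith [ht.1]
    have h3 : |s - s₀| < δ := lt_of_mul_lt_mul_left (h1.trans_lt h2) hc.le
    have h4 : 0 < H t s * H t₀ s₀ := by
      refine hball (y := (t, s)) ?_
      rw [Prod.dist_eq, max_lt_iff]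
      exact ⟨ht.2.1, by rwa [Real.dist_eq]⟩
    have h5 : 0 ≤ g t * β (w t s) := mul_nonneg g.nonneg (hβ0 _)
    have : F t s = g t * β (w t s) * (H t s * H t₀ s₀) := by simp only [F]; ring
    rw [this]
    exact mul_nonneg h5 h4.le
  have hFpos : 0 < F t₀ s₀ := by
    have : F t₀ s₀ = g t₀ * β (w t₀ s₀) * (H t₀ s₀ * H t₀ s₀) := by simp only [F]; ring
    rw [this]
    exact mul_pos (mul_pos (g.pos_of_mem_ball (Metric.mem_ball_self g.rOut_pos)) hβx)
      (mul_self_pos.2 hne)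
  have hpos2 : 0 < ∫ t in a..b, ∫ s in (s₀ - 1 / 2)..(s₀ - 1 / 2 + 1), F t s := by
    refine intervalIntegral.integral_pos hab
      (intervalIntegral.continuous_parametric_intervalIntegral_of_continuous' hFc _ _).continuousOn
      (fun t _ => intervalIntegral.integral_nonneg (by linarith) fun s hs => hF0 t s hs)
      ⟨t₀, Ioo_subset_Icc_self ht₀, ?_⟩
    exact intervalIntegral.integral_pos (by linarith)
      (hFc.comp (by fun_prop : Continuous fun s : ℝ => (t₀, s))).continuousOn
      (fun s hs => hF0 t₀ s (Ioc_subset_Icc_self hs)) ⟨s₀, ⟨by linarith, by linarith⟩, hFpos⟩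
  exact hpos2.ne' key'

/-! ### The evolution equation -/

/-- Near a given time, the boundaries of a sharp front are a front defined for all times: the time
variable is composed with a smooth function that takes values in `(0,T)` and is locally the
identity. -/
theorem IsFrontParam.exists_isFront {T : ℝ} {A : ℝ → Set Plane} {w : ℝ → ℝ → Plane}
    (h : IsFrontParam T A w) (hA : ∀ t ∈ Ioo 0 T, IsClosed (A t))
    (hb : ∀ t ∈ Ioo 0 T, Bornology.IsBounded (A t)) {t₀ : ℝ} (ht₀ : t₀ ∈ Ioo 0 T) :
    ∃ a b, t₀ ∈ Ioo a b ∧ Ioo a b ⊆ Ioo 0 T ∧ ∃ τ : ℝ → ℝ, (∀ t ∈ Ioo a b, τ t = t) ∧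
      IsFront (fun t => A (τ t)) (fun t => w (τ t)) := by
  obtain ⟨r, hr, hrT⟩ := Metric.isOpen_iff.1 isOpen_Ioo t₀ ht₀
  let g : ContDiffBump t₀ := ⟨r / 2, r, by positivity, by linarith⟩
  let τ : ℝ → ℝ := fun t => t₀ + (t - t₀) * g t
  have hτ : ContDiff ℝ 2 τ := contDiff_const.add ((contDiff_id.sub contDiff_const).mul g.contDiff)
  have hτT : ∀ t, τ t ∈ Ioo 0 T := fun t => by
    refine hrT ?_
    rw [Metric.mem_ball, Real.dist_eq, show τ t - t₀ = (t - t₀) * g t by simp [τ], abs_mul,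
      abs_of_nonneg g.nonneg]
    by_cases ht : g t = 0
    · simpa [ht] using hr
    · have h1 : t ∈ Metric.ball t₀ r := by
        have := g.support_eq
        rw [← this]
        exact ht
      rw [Metric.mem_ball, Real.dist_eq] at h1
      exact (mul_le_of_le_one_right (abs_nonneg _) g.le_one).trans_lt h1
  have hball : Ioo (t₀ - r / 2) (t₀ + r / 2) = Metric.ball t₀ (r / 2) := (Real.ball_eq_Ioo _ _).symm
  refine ⟨t₀ - r / 2, t₀ + r / 2, ⟨by linarith, by linarith⟩, ?_, τ, fun t ht => ?_,
    ⟨fun t => h.param _ (hτT t), fun t => hA _ (hτT t), fun t => hb _ (hτT t), ?_, ?_⟩⟩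
  · rw [hball]
    exact (Metric.ball_subset_ball (by linarith)).trans hrT
  · rw [hball] at ht
    have : g t = 1 := g.one_of_mem_closedBall (Metric.ball_subset_closedBall ht)
    simp [τ, this]
  · exact h.contDiffOn.comp_contDiff (f := fun p : ℝ × ℝ => (τ p.1, p.2))
      (((hτ.of_le (by norm_num)).comp contDiff_fst).prodMk contDiff_snd)
      fun p => ⟨hτT p.1, mem_univ _⟩
  · exact h.continuousOn.comp_continuous (f := fun p : ℝ × ℝ => (τ p.1, p.2))
      ((hτ.continuous.comp continuous_fst).prodMk continuous_snd) fun p => ⟨hτT p.1, mem_univ _⟩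

/-- The evolution equation for an arbitrary parametrisation of the front. -/
theorem IsSharpFront.inner_time_deriv_add_circ {α T : ℝ} {A : ℝ → Set Plane} {θ : ℝ → Plane → ℝ}
    (hθ : IsSharpFront α T A θ) (hα : α ∈ Ioo (0 : ℝ) 1) {w : ℝ → ℝ → Plane} {τ : ℝ → ℝ}
    (hF : IsFront (fun t => A (τ t)) w) {a b : ℝ} (hT : Ioo a b ⊆ Ioo 0 T)
    (hτ : ∀ t ∈ Ioo a b, τ t = t) {t : ℝ} (ht : t ∈ Ioo a b) (s : ℝ) :
    inner ℝ (deriv (fun τ => w τ s) t) (perp (deriv (w t) s)) +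
      circ α (w t) (w t s) (perp (deriv (w t) s)) = 0 := by
  obtain ⟨u, hu, hweak⟩ := hθ.weakSolution.exists_velocity
  have hab : a < b := ht.1.trans ht.2
  have hind : ∀ t ∈ Ioo a b, θ t = (A (τ t)).indicator fun _ => 1 := fun t ht => by
    rw [hτ t ht, hθ.eq_indicator t (hT ht)]
  have hθ1 : ∀ t ∈ Ioo 0 T, ∀ x, |θ t x| ≤ 1 := fun t ht x => by
    rw [hθ.eq_indicator t ht]
    by_cases hx : x ∈ A t <;> simp [hx]
  have hper : ∀ t s, deriv (w t) (s + 1) = deriv (w t) s := fun t => (hF.param t).periodic_deriv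
  refine hF.eq_zero_of_integral_eq_zero (H := fun t s =>
      inner ℝ (deriv (fun τ => w τ s) t) (perp (deriv (w t) s)) +
        circ α (w t) (w t s) (perp (deriv (w t) s)))
    ((hF.continuous_time.inner (continuous_perp.comp hF.continuous_deriv)).add
      (hF.continuous_circ hα))
    (fun t s => ?_) hab (fun g hg hgc hgs β G hβ hβc hG hGβ => ?_) ht s
  · have e := hF.periodic_time t s
    simp only at e
    simp only [hper, e, (hF.param t).periodic s]
  · exact hu.integral_normal_velocity hweak hα hF hab.le hT hind hθ.weakSolution.memLp.1 hθ1 hg hgc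
      hgs hβ hβc hG hGβ

end SharpFront

end

theorem mainTheorem5 (α : ℝ) (hα : α ∈ Set.Ioo (0 : ℝ) 1) (T : ℝ)
    (A : ℝ → Set SharpFront.Plane) (θ : ℝ → SharpFront.Plane → ℝ)
    (hθ : SharpFront.IsSharpFront α T A θ)
    (z : ℝ → ℝ → SharpFront.Plane)
    (hz : ∀ t ∈ Set.Ioo 0 T, SharpFront.IsUniformSpeedParam (A t) (z t)) :
    ∀ t ∈ Set.Ioo 0 T, ∀ s : ℝ,
      IntervalIntegrable (SharpFront.cdeIntegrand α (z t) s) MeasureTheory.volume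
        (-1 / 2) (1 / 2) ∧
      ∀ v : SharpFront.Plane, HasDerivAt (fun τ => z τ s) v t →
        inner ℝ v (SharpFront.perp (deriv (z t) s)) =
          inner ℝ (-SharpFront.cdeIntegral α (z t) s) (SharpFront.perp (deriv (z t) s)) := by
  open SharpFront in
  intro t ht s
  have hcl := hθ.isClosed t ht
  have hbd := hθ.isBounded t ht
  have hzt := (hz t ht).toIsBoundaryParam
  refine ⟨hzt.intervalIntegrable_cdeIntegrand hcl hbd hα s _ _, fun v hv => ?_⟩
  obtain ⟨w₀, hw₀⟩ := hθ.exists_param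
  obtain ⟨a, b, htab, hT, τ, hτ, hF⟩ := hw₀.exists_isFront hθ.isClosed hθ.isBounded ht
  set w : ℝ → ℝ → Plane := fun t => w₀ (τ t)
  have hτt : τ t = t := hτ t htab
  have hwt : IsBoundaryParam (A t) (w t) := by
    have := hF.param t
    rwa [hτt] at this
  have hfr : ∀ h ∈ Ioo 0 T, ∀ σ, z h σ ∈ frontier (A h) := fun h hh σ =>
    (hz h hh).range_eq ▸ mem_range_self σ
  obtain ⟨σ, -, hσ⟩ := hwt.exists_eq_of_mem_frontier (hfr t ht s) 0
  have hvel := hF.inner_velocity_eq (x := fun h => z h s)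
    (by
      filter_upwards [Ioo_mem_nhds htab.1 htab.2] with h hh
      rw [hτ h hh]
      exact hfr h (hT hh) s) hσ.symm hv
  have hevol := hθ.inner_time_deriv_add_circ hα hF hT hτ htab σ
  -- The normals of the two parametrisations are parallel: a curve in a fixed boundary is tangent
  -- to it, which is the case of a front at rest.
  have htan : inner ℝ (deriv (z t) s) (perp (deriv (w t) σ)) = 0 := by
    have := (hwt.isFront hcl hbd).inner_velocity_eq (t := s) (x := z t)
      (Eventually.of_forall fun h => hfr t ht h) hσ.symm (hzt.hasDerivAt s)
    simpa using this
  have hcirc := circ_eq_circ hzt hwt hcl hbd hα hσ.symm htan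
    (by rw [real_inner_comm]; exact inner_perp_self _)
  have hI := hzt.inner_cdeIntegral hcl hbd hα s htan
  obtain ⟨c, hc⟩ := perp_eq_smul_perp (hwt.deriv_ne_zero σ) htan
  rw [hσ] at hcirc hevol
  rw [hc, real_inner_smul_right, real_inner_smul_right, hvel, inner_neg_left, hI, hcirc]
  linear_combination c * hevol
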